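/- Let $d\ge 1$ be an integer and $G=SL(2,\mathbb{R})$, with Lie algebra $\mathfrak g=\mathfrak{sl}(2,\mathbb R)$ and enveloping algebra $U(\mathfrak g)$. Let $I_d$ be the space of smooth functions $\phi:\mathbb{R}\to\mathbb{C}$ such that $x\mapsto x^{-d-1}\phi(-1/x)$ extends to a smooth function on $\mathbb{R}$. The group $G$ acts on $I_d$ by $$\left(\pi_d\begin{pmatrix}p&q\\ r&s\end{pmatrix}\phi\right)(x)=(rx+p)^{-d-1}\,\phi\!\left(\frac{sx+q}{rx+p}\right)$$ (extended by continuity to the zero of $rx+p$), and $U(\mathfrak g)$ acts on $I_d$ by the differentiated action. Give $I_d$ the Fréchet topology defined by the seminorms $$\|\phi\|_{d,D}=\left(\int_{-\infty}^{\infty}(1+x^2)^d\,|(D\phi)(x)|^2\,dx\right)^{1/2},\qquad D\in U(\mathfrak g).$$ For $J=[0,\infty)$ or $J=(-\infty,0]$ let $S_d(J)$ be the space of functions $f:J\to\mathbb{C}$ of the form $f(x)=|x|^{(d+1)/2}f_1(x)$, where $f_1$ is smooth on $J$ (one-sidedly at $0$) and $f_1$ and all its derivatives are rapidly decreasing at infinity.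 For $f\in S_d(J)$, extended by $0$ to $\mathbb{R}$, put $$T_d(f)(z)=(2\pi)^{-1/2}\int_{-\infty}^{\infty}|y|^{(d-1)/2}f(y)e^{iyz}\,dy .$$ Then $I_d^+=T_d(S_d([0,\infty)))$ and $I_d^-=T_d(S_d((-\infty,0]))$ are closed $G$-invariant subspaces of $I_d$, and with the induced topology and action each of them is an irreducible Fréchet representation of $G$: it is a Fréchet space on which $G$ acts with continuous action map $G\times I_d^\pm\to I_d^\pm$, it is nonzero, and its only closed $G$-invariant subspaces are $0$ and the whole space. -/

import Mathlib

open scoped ContDiff Topology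
open MeasureTheory

noncomputable section

namespace HankelKirillov

/-- The group `SL(2, ℝ)`, with its topology as a group of matrices. -/
abbrev SL2R : Type := Matrix.SpecialLinearGroup (Fin 2) ℝ

/-- The Lie algebra `𝔰𝔩(2, ℝ)`. -/
abbrev sl2R : Type := LieAlgebra.SpecialLinear.sl (Fin 2) ℝ

/-! ### The space `I_d` -/

/-- The space `I_d`, as a subspace of all functions: the smooth `φ : ℝ → ℂ` for which
`x ↦ x ^ (-d-1) * φ (-1/x)`, which is given on `ℝ \ {0}`, is (extends to) a smooth function
on `ℝ`. -/
def inducedSubmodule (d : ℕ) : Submodule ℂ (ℝ → ℂ) where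
  carrier := {φ | ContDiff ℝ ∞ φ ∧ ∃ ψ : ℝ → ℂ, ContDiff ℝ ∞ ψ ∧
    ∀ x : ℝ, x ≠ 0 → ψ x = ((x : ℂ) ^ (d + 1))⁻¹ * φ (-x⁻¹)}
  zero_mem' := ⟨contDiff_const, 0, contDiff_const, by simp⟩
  add_mem' := by
    rintro f g ⟨hf, ψ, hψ, e⟩ ⟨hg, ψ', hψ', e'⟩
    exact ⟨hf.add hg, ψ + ψ', hψ.add hψ', fun x hx => by simp [e x hx, e' x hx, mul_add]⟩
  smul_mem' := by
    rintro c f ⟨hf, ψ, hψ, e⟩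
    exact ⟨contDiff_const.smul hf, c • ψ, contDiff_const.smul hψ,
      fun x hx => by simp [e x hx, mul_left_comm]⟩

/-- The space `I_d` as a type of its own: it carries its Fréchet topology and not the
topology of pointwise convergence. -/
def ISpace (d : ℕ) : Type := inducedSubmodule d

instance (d : ℕ) : AddCommGroup (ISpace d) := inferInstanceAs (AddCommGroup (inducedSubmodule d))
instance (d : ℕ) : Module ℂ (ISpace d) := inferInstanceAs (Module ℂ (inducedSubmodule d))
instance (d : ℕ) : Module ℝ (ISpace d) := inferInstanceAs (Module ℝ (inducedSubmodule d))
instance (d : ℕ) : IsScalarTower ℝ ℂ (ISpace d) :=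
  inferInstanceAs (IsScalarTower ℝ ℂ (inducedSubmodule d))

/-- The inclusion of `I_d` in the space of all functions. -/
def ISpace.incl (d : ℕ) : ISpace d →ₗ[ℂ] (ℝ → ℂ) := (inducedSubmodule d).subtype

instance (d : ℕ) : CoeFun (ISpace d) (fun _ => ℝ → ℂ) := ⟨fun φ => ISpace.incl d φ⟩

variable {d : ℕ}

theorem ISpace.ext {φ φ' : ISpace d} (h : ∀ x, φ x = φ' x) : φ = φ' := Subtype.ext (funext h)

@[simp] theorem ISpace.add_apply (φ φ' : ISpace d) (x : ℝ) : (φ + φ') x = φ x + φ' x := rfl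
@[simp] theorem ISpace.smul_apply (c : ℂ) (φ : ISpace d) (x : ℝ) : (c • φ) x = c * φ x := rfl
@[simp] theorem ISpace.real_smul_apply (c : ℝ) (φ : ISpace d) (x : ℝ) :
    (c • φ) x = (c : ℂ) * φ x := by
  change c • (φ x) = _
  simp

theorem ISpace.contDiff (φ : ISpace d) : ContDiff ℝ ∞ φ := φ.2.1

theorem ISpace.exists_ext (φ : ISpace d) : ∃ ψ : ℝ → ℂ, ContDiff ℝ ∞ ψ ∧
    ∀ x : ℝ, x ≠ 0 → ψ x = ((x : ℂ) ^ (d + 1))⁻¹ * φ (-x⁻¹) := φ.2.2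

/-! ### The representation `π_d` of `SL(2, ℝ)` on `I_d` -/

/-- The value at `0` of the smooth extension of `x ↦ x ^ (-d-1) * φ (-1/x)`. -/
def weylAtZero (d : ℕ) (φ : ℝ → ℂ) : ℂ :=
  Filter.limUnder (𝓝[≠] (0 : ℝ)) fun x : ℝ => ((x : ℂ) ^ (d + 1))⁻¹ * φ (-x⁻¹)

/-- `u ^ (-d-1) * φ (v / u)`, extended by continuity to `u = 0` (for `φ ∈ I_d` and `v ≠ 0`). -/
def homog (d : ℕ) (φ : ℝ → ℂ) (u v : ℝ) : ℂ :=
  if u = 0 then (((-v : ℝ) : ℂ) ^ (d + 1))⁻¹ * weylAtZero d φ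
  else ((u : ℂ) ^ (d + 1))⁻¹ * φ (v / u)

theorem weylAtZero_eq {φ ψ : ℝ → ℂ} (hψ : Continuous ψ)
    (h : ∀ x : ℝ, x ≠ 0 → ψ x = ((x : ℂ) ^ (d + 1))⁻¹ * φ (-x⁻¹)) : weylAtZero d φ = ψ 0 := by
  refine Filter.Tendsto.limUnder_eq ?_
  refine (hψ.continuousAt (x := 0)).continuousWithinAt.tendsto.congr' ?_
  filter_upwards [self_mem_nhdsWithin] with x hx using h x hx

theorem homog_of_ne {φ : ℝ → ℂ} {u v : ℝ} (hu : u ≠ 0) :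
    homog d φ u v = ((u : ℂ) ^ (d + 1))⁻¹ * φ (v / u) := by simp [homog, hu]

theorem homog_eq_ext {φ ψ : ℝ → ℂ} (hψ : Continuous ψ)
    (h : ∀ x : ℝ, x ≠ 0 → ψ x = ((x : ℂ) ^ (d + 1))⁻¹ * φ (-x⁻¹)) {u v : ℝ} (hv : v ≠ 0) :
    homog d φ u v = (((-v : ℝ) : ℂ) ^ (d + 1))⁻¹ * ψ (-u / v) := by
  by_cases hu : u = 0
  · simp [homog, hu, weylAtZero_eq hψ h]
  · have hx : -u / v ≠ 0 := by simp [hu, hv]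
    rw [homog_of_ne hu, h _ hx, ← mul_assoc, ← mul_inv, ← mul_pow, ← Complex.ofReal_mul]
    congr 4 <;> field_simp

theorem homog_smul_smul (φ : ISpace d) {c u v : ℝ} (hc : c ≠ 0) :
    homog d φ (c * u) (c * v) = ((c : ℂ) ^ (d + 1))⁻¹ * homog d φ u v := by
  by_cases hu : u = 0
  · simp [homog, hu, ← mul_assoc, ← mul_inv, ← mul_pow]
  · rw [homog_of_ne hu, homog_of_ne (mul_ne_zero hc hu), mul_div_mul_left _ _ hc]
    push_cast
    rw [mul_pow, mul_inv, mul_assoc]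

theorem homog_add (φ φ' : ISpace d) (u v : ℝ) :
    homog d (φ + φ' : ISpace d) u v = homog d φ u v + homog d φ' u v := by
  obtain ⟨ψ, hψ, e⟩ := φ.exists_ext
  obtain ⟨ψ', hψ', e'⟩ := φ'.exists_ext
  by_cases hu : u = 0
  · simp only [homog, hu, if_true]
    rw [weylAtZero_eq hψ.continuous e, weylAtZero_eq hψ'.continuous e',
      weylAtZero_eq (ψ := ψ + ψ') (hψ.continuous.add hψ'.continuous)
        (fun x hx => by simp [e x hx, e' x hx, mul_add])]
    simp [mul_add]
  · simp [homog_of_ne hu, mul_add]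

theorem homog_smul (c : ℂ) (φ : ISpace d) (u v : ℝ) :
    homog d (c • φ : ISpace d) u v = c * homog d φ u v := by
  obtain ⟨ψ, hψ, e⟩ := φ.exists_ext
  by_cases hu : u = 0
  · simp only [homog, hu, if_true]
    rw [weylAtZero_eq hψ.continuous e,
      weylAtZero_eq (ψ := c • ψ) (continuous_const.smul hψ.continuous)
        (fun x hx => by simp [e x hx, mul_left_comm])]
    simp [mul_left_comm]
  · simp [homog_of_ne hu, mul_left_comm]

theorem contDiff_homog (φ : ISpace d) {U V : ℝ → ℝ} (hU : ContDiff ℝ ∞ U) (hV : ContDiff ℝ ∞ V)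
    (h : ∀ x, U x ≠ 0 ∨ V x ≠ 0) : ContDiff ℝ ∞ fun x => homog d φ (U x) (V x) := by
  obtain ⟨ψ, hψ, e⟩ := φ.exists_ext
  refine contDiff_iff_contDiffAt.2 fun x => ?_
  rcases h x with hx | hx
  · have : (fun y => homog d φ (U y) (V y)) =ᶠ[𝓝 x]
        fun y => ((U y : ℂ) ^ (d + 1))⁻¹ * φ (V y / U y) := by
      filter_upwards [hU.continuous.continuousAt.eventually_ne hx] with y hy
      exact homog_of_ne hy
    refine ContDiffAt.congr_of_eventuallyEq ?_ this
    refine ContDiffAt.mul (ContDiffAt.inv ?_ ?_) ?_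
    · exact ((Complex.ofRealCLM.contDiff.comp hU).pow _).contDiffAt
    · exact pow_ne_zero _ (by exact_mod_cast hx)
    · exact φ.contDiff.contDiffAt.comp x (hV.contDiffAt.div hU.contDiffAt hx)
  · have : (fun y => homog d φ (U y) (V y)) =ᶠ[𝓝 x]
        fun y => (((-V y : ℝ) : ℂ) ^ (d + 1))⁻¹ * ψ (-U y / V y) := by
      filter_upwards [hV.continuous.continuousAt.eventually_ne hx] with y hy
      exact homog_eq_ext hψ.continuous e hy
    refine ContDiffAt.congr_of_eventuallyEq ?_ this
    refine ContDiffAt.mul (ContDiffAt.inv ?_ ?_) ?_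
    · exact ((Complex.ofRealCLM.contDiff.comp hV.neg).pow _).contDiffAt
    · exact pow_ne_zero _ (by simpa using hx)
    · exact hψ.contDiffAt.comp x (hU.neg.contDiffAt.div hV.contDiffAt hx)

theorem row_mul_ne (g : SL2R) {u v : ℝ} (h : u ≠ 0 ∨ v ≠ 0) :
    u * g 0 0 + v * g 1 0 ≠ 0 ∨ u * g 0 1 + v * g 1 1 ≠ 0 := by
  by_contra! H
  have hdet := g.det_coe
  rw [Matrix.det_fin_two] at hdet
  obtain ⟨h1, h2⟩ := H
  have hu : u = 0 := by linear_combination (-u) * hdet + g 1 1 * h1 - g 1 0 * h2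
  have hv : v = 0 := by linear_combination (-v) * hdet - g 0 1 * h1 + g 0 0 * h2
  simp [hu, hv] at h

/-- For `g = [[p, q], [r, s]]`, the function
`(π_d(g) φ)(x) = (r x + p) ^ (-d-1) * φ ((s x + q) / (r x + p))`, extended by continuity to the
zero of `r x + p`. -/
def actFun (d : ℕ) (g : SL2R) (φ : ℝ → ℂ) (x : ℝ) : ℂ :=
  homog d φ (g 1 0 * x + g 0 0) (g 1 1 * x + g 0 1)

theorem actFun_ext (g : SL2R) (φ : ISpace d) {x : ℝ} (hx : x ≠ 0) :
    homog d φ (x * g 0 0 + (-1) * g 1 0) (x * g 0 1 + (-1) * g 1 1) =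
      ((x : ℂ) ^ (d + 1))⁻¹ * actFun d g φ (-x⁻¹) := by
  rw [actFun, ← homog_smul_smul φ hx]
  congr 1 <;> field_simp <;> ring

theorem contDiff_actFun_ext (g : SL2R) (φ : ISpace d) : ContDiff ℝ ∞ fun x : ℝ =>
    homog d φ (x * g 0 0 + (-1) * g 1 0) (x * g 0 1 + (-1) * g 1 1) :=
  contDiff_homog φ (by fun_prop) (by fun_prop) fun _ => row_mul_ne g (by simp)

theorem actFun_mem (g : SL2R) (φ : ISpace d) : actFun d g φ ∈ inducedSubmodule d := by
  refine ⟨contDiff_homog φ (by fun_prop) (by fun_prop) fun x => ?_, _, contDiff_actFun_ext g φ,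
    fun x hx => actFun_ext g φ hx⟩
  have := row_mul_ne g (u := 1) (v := x) (by simp)
  convert this using 2 <;> ring

theorem homog_actFun (g : SL2R) (φ : ISpace d) {u v : ℝ} (h : u ≠ 0 ∨ v ≠ 0) :
    homog d (actFun d g φ) u v = homog d φ (u * g 0 0 + v * g 1 0) (u * g 0 1 + v * g 1 1) := by
  by_cases hu : u = 0
  · have hv : -v ≠ 0 := by simpa [hu] using h
    rw [homog, if_pos hu, weylAtZero_eq (contDiff_actFun_ext g φ).continuous
      (fun x hx => actFun_ext g φ hx), ← homog_smul_smul φ hv]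
    congr 1 <;> simp [hu]
  · rw [homog_of_ne hu, actFun, ← homog_smul_smul φ hu]
    congr 1 <;> field_simp <;> ring

/-- The representation `π_d` of `SL(2, ℝ)` on `I_d`. -/
def rep (d : ℕ) : Representation ℂ SL2R (ISpace d) where
  toFun g :=
    { toFun := fun φ => ⟨actFun d g φ, actFun_mem g φ⟩
      map_add' := fun φ φ' => ISpace.ext fun x => homog_add φ φ' _ _
      map_smul' := fun c φ => ISpace.ext fun x => homog_smul c φ _ _ }
  map_one' := by
    ext φ
    refine ISpace.ext fun x => ?_
    change homog d φ _ _ = φ x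
    simp [homog]
  map_mul' g h := by
    ext φ
    refine ISpace.ext fun x => ?_
    change homog d φ _ _ = homog d (actFun d h φ) _ _
    rw [homog_actFun]
    · congr 1 <;> simp [Matrix.mul_apply, Fin.sum_univ_two] <;> ring
    · have := row_mul_ne g (u := 1) (v := x) (by simp)
      convert this using 2 <;> ring

/-! ### The action of the Lie algebra and of its enveloping algebra -/

attribute [local instance 100] LieRing.ofAssociativeRing
attribute [local instance 100] LieAlgebra.ofAssociativeAlgebra

/-- The first order operator by which `[[a, b], [c, -a]]` acts on `I_d`. -/
def lieOp (d : ℕ) (a b c : ℝ) (φ : ℝ → ℂ) (x : ℝ) : ℂ :=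
  (b - 2 * a * x - c * x ^ 2) * deriv φ x - (d + 1) * (a + c * x) * φ x

theorem contDiff_lieOp {φ : ℝ → ℂ} (hφ : ContDiff ℝ ∞ φ) (a b c : ℝ) :
    ContDiff ℝ ∞ (lieOp d a b c φ) := by
  have h0 : ContDiff ℝ ∞ fun x : ℝ => (x : ℂ) := Complex.ofRealCLM.contDiff
  have h1 : ContDiff ℝ ∞ (deriv φ) := (contDiff_infty_iff_deriv.1 hφ).2
  unfold lieOp
  fun_prop

theorem hasDerivAt_ofReal_comp (x : ℝ) : HasDerivAt (fun y : ℝ => (y : ℂ)) 1 x :=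
  Complex.ofRealCLM.hasDerivAt (x := x)

theorem lieOp_mem (φ : ISpace d) (a b c : ℝ) : lieOp d a b c φ ∈ inducedSubmodule d := by
  obtain ⟨ψ, hψ, e⟩ := φ.exists_ext
  refine ⟨contDiff_lieOp φ.contDiff a b c, lieOp d (-a) (-c) (-b) ψ,
    contDiff_lieOp hψ _ _ _, fun x hx => ?_⟩
  have hxc : (x : ℂ) ≠ 0 := by exact_mod_cast hx
  have hφd : HasDerivAt φ (deriv φ (-x⁻¹)) (-x⁻¹) :=
    (φ.contDiff.differentiable (by simp) _).hasDerivAt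
  have h1 : HasDerivAt (fun y : ℝ => -y⁻¹) (x ^ 2)⁻¹ x := by
    simpa using (hasDerivAt_inv hx).fun_neg
  have h2 : HasDerivAt (fun y : ℝ => φ (-y⁻¹)) ((x ^ 2)⁻¹ • deriv φ (-x⁻¹)) x :=
    hφd.scomp x h1
  have h3 : HasDerivAt (fun y : ℝ => ((y : ℂ) ^ (d + 1))⁻¹) _ x :=
    ((hasDerivAt_ofReal_comp x).fun_pow (d + 1)).fun_inv (pow_ne_zero _ hxc)
  have h4 := (HasDerivAt.congr_of_eventuallyEq (h3.fun_mul h2)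
    (show ψ =ᶠ[𝓝 x] _ by filter_upwards [eventually_ne_nhds hx] with y hy using e y hy)).deriv
  unfold lieOp
  rw [h4, e x hx]
  simp only [Complex.real_smul]
  push_cast
  field_simp
  ring

theorem hasDerivAt_lieOp {φ : ℝ → ℂ} (hφ : ContDiff ℝ ∞ φ) (a b c x : ℝ) :
    HasDerivAt (lieOp d a b c φ)
      ((-2 * a - 2 * c * x) * deriv φ x + (b - 2 * a * x - c * x ^ 2) * deriv (deriv φ) x
        - (d + 1) * (c * φ x + (a + c * x) * deriv φ x)) x := by
  have hx := hasDerivAt_ofReal_comp x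
  have h0 : HasDerivAt φ (deriv φ x) x := (hφ.differentiable (by simp) _).hasDerivAt
  have h1 : HasDerivAt (deriv φ) (deriv (deriv φ) x) x :=
    ((contDiff_infty_iff_deriv.1 hφ).2.differentiable (by simp) _).hasDerivAt
  have h2 : HasDerivAt (fun y : ℝ => (b - 2 * a * y - c * y ^ 2 : ℂ)) (-2 * a - 2 * c * x) x := by
    refine (((hx.const_mul (2 * a : ℂ)).const_sub (b : ℂ)).fun_sub
      ((hx.fun_pow 2).const_mul (c : ℂ))).congr_deriv ?_
    simp
    ring
  have h3 : HasDerivAt (fun y : ℝ => ((d + 1) * (a + c * y) : ℂ)) ((d + 1) * c) x := by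
    simpa using ((hx.const_mul (c : ℂ)).const_add (a : ℂ)).const_mul (d + 1 : ℂ)
  refine ((h2.fun_mul h1).fun_sub (h3.fun_mul h0)).congr_deriv ?_
  ring

theorem sl2R_apply_one_one (A : sl2R) : A.1 1 1 = -A.1 0 0 := by
  have h : Matrix.trace A.1 = 0 := A.2
  rw [Matrix.trace_fin_two] at h
  linarith

/-- The action of `[[a, b], [c, -a]]` on `I_d`. -/
def lieEnd (d : ℕ) (a b c : ℝ) : Module.End ℂ (ISpace d) where
  toFun φ := ⟨lieOp d a b c φ, lieOp_mem φ a b c⟩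
  map_add' φ φ' := ISpace.ext fun x => by
    change lieOp d a b c (fun y => φ y + φ' y) x = lieOp d a b c φ x + lieOp d a b c φ' x
    have h := φ.contDiff.differentiable (by simp) x
    have h' := φ'.contDiff.differentiable (by simp) x
    simp only [lieOp, deriv_fun_add h h']
    ring
  map_smul' t φ := ISpace.ext fun x => by
    change lieOp d a b c (fun y => t * φ y) x = t * lieOp d a b c φ x
    have h := φ.contDiff.differentiable (by simp) x
    simp only [lieOp, deriv_const_mul t h]
    ring

theorem lieEnd_apply (a b c : ℝ) (φ : ISpace d) (x : ℝ) :
    lieEnd d a b c φ x = lieOp d a b c φ x := rfl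

theorem lieEnd_comm (a b c a' b' c' : ℝ) :
    lieEnd d (b * c' - b' * c) (2 * (a * b' - a' * b)) (2 * (c * a' - c' * a)) =
      lieEnd d a b c * lieEnd d a' b' c' - lieEnd d a' b' c' * lieEnd d a b c := by
  ext φ
  refine ISpace.ext fun x => ?_
  change lieOp d _ _ _ φ x =
    lieOp d a b c (lieOp d a' b' c' φ) x - lieOp d a' b' c' (lieOp d a b c φ) x
  have h := (hasDerivAt_lieOp (d := d) φ.contDiff a b c x).deriv
  have h' := (hasDerivAt_lieOp (d := d) φ.contDiff a' b' c' x).deriv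
  conv_rhs => rw [lieOp, h', lieOp.eq_def d a' b' c' (lieOp d a b c φ), h]
  simp only [lieOp]
  push_cast
  ring

/-- The action of `𝔰𝔩(2, ℝ)` on `I_d`. -/
def lieRep (d : ℕ) : sl2R →ₗ⁅ℝ⁆ Module.End ℂ (ISpace d) where
  toFun A := lieEnd d (A.1 0 0) (A.1 0 1) (A.1 1 0)
  map_add' A B := by
    ext φ
    refine ISpace.ext fun x => ?_
    change lieOp d (A.1 0 0 + B.1 0 0) (A.1 0 1 + B.1 0 1) (A.1 1 0 + B.1 1 0) φ x =
      lieOp d _ _ _ φ x + lieOp d _ _ _ φ x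
    simp only [lieOp]
    push_cast
    ring
  map_smul' t A := by
    ext φ
    refine ISpace.ext fun x => ?_
    rw [RingHom.id_apply, LinearMap.smul_apply, ISpace.real_smul_apply]
    change lieOp d (t * A.1 0 0) (t * A.1 0 1) (t * A.1 1 0) φ x = t * lieOp d _ _ _ φ x
    simp only [lieOp]
    push_cast
    ring
  map_lie' {A B} := by
    rw [Ring.lie_def, ← lieEnd_comm]
    have h : (⁅A, B⁆ : sl2R).1 = A.1 * B.1 - B.1 * A.1 := rfl
    simp only [h, Matrix.sub_apply, Matrix.mul_apply, Fin.sum_univ_two, sl2R_apply_one_one]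
    congr 1 <;> ring

/-- The action of `A ∈ 𝔰𝔩(2, ℝ)` is the derivative of `π_d` along every curve in `SL(2, ℝ)`
that passes through `1` with velocity `A`. -/
theorem hasDerivAt_rep (φ : ISpace d) (A : sl2R) (γ : ℝ → SL2R) (h0 : γ 0 = 1)
    (hγ : ∀ i j, HasDerivAt (fun t => γ t i j) (A.1 i j) 0) (x : ℝ) :
    HasDerivAt (fun t => rep d (γ t) φ x) (lieRep d A φ x) 0 := by
  have hu : HasDerivAt (fun t => γ t 1 0 * x + γ t 0 0) (A.1 1 0 * x + A.1 0 0) 0 :=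
    ((hγ 1 0).mul_const x).add (hγ 0 0)
  have hv : HasDerivAt (fun t => γ t 1 1 * x + γ t 0 1) (A.1 1 1 * x + A.1 0 1) 0 :=
    ((hγ 1 1).mul_const x).add (hγ 0 1)
  have hu0 : γ 0 1 0 * x + γ 0 0 0 = 1 := by simp [h0]
  have hv0 : γ 0 1 1 * x + γ 0 0 1 = x := by simp [h0]
  have hne : γ 0 1 0 * x + γ 0 0 0 ≠ 0 := by simp [hu0]
  have hφ : HasDerivAt φ (deriv φ x) ((γ 0 1 1 * x + γ 0 0 1) / (γ 0 1 0 * x + γ 0 0 0)) := by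
    rw [hu0, hv0, div_one]
    exact (φ.contDiff.differentiable (by simp) _).hasDerivAt
  have h1 := hφ.scomp (0 : ℝ) (hv.div hu hne)
  have hne' : ((γ 0 1 0 * x + γ 0 0 0 : ℝ) : ℂ) ≠ 0 := by exact_mod_cast hne
  have h2 := (hu.ofReal_comp.fun_pow (d + 1)).fun_inv (pow_ne_zero _ hne')
  have h3 := h2.fun_mul h1
  refine (h3.congr_of_eventuallyEq ?_).congr_deriv ?_
  · filter_upwards [hu.continuousAt.eventually_ne hne] with t ht
    exact homog_of_ne ht
  · change _ = lieOp d _ _ _ φ x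
    simp only [Function.comp, Pi.div_apply, hu0, hv0, sl2R_apply_one_one, lieOp, Complex.real_smul]
    push_cast
    simp
    ring

/-- The action of the enveloping algebra `U(𝔤)` on `I_d`. -/
def envRep (d : ℕ) : UniversalEnvelopingAlgebra ℝ sl2R →ₐ[ℝ] Module.End ℂ (ISpace d) :=
  UniversalEnvelopingAlgebra.lift ℝ (lieRep d)

/-! ### The Fréchet topology of `I_d` -/

theorem exists_weight_bound (φ : ISpace d) :
    ∃ C : ℝ, ∀ x : ℝ, (1 + x ^ 2) ^ d * ‖φ x‖ ^ 2 ≤ C * (1 + x ^ 2)⁻¹ := by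
  obtain ⟨ψ, hψ, e⟩ := φ.exists_ext
  obtain ⟨M, hM⟩ := (isCompact_Icc (a := (-1 : ℝ)) (b := 1)).exists_bound_of_continuousOn
    φ.contDiff.continuous.continuousOn
  obtain ⟨N, hN⟩ := (isCompact_Icc (a := (-1 : ℝ)) (b := 1)).exists_bound_of_continuousOn
    hψ.continuous.continuousOn
  refine ⟨2 ^ (d + 1) * (M ^ 2 + N ^ 2), fun x => ?_⟩
  have hpos : 0 < 1 + x ^ 2 := by positivity
  rw [← div_eq_mul_inv, le_div_iff₀ hpos]
  have hle : (1 + x ^ 2) ^ (d + 1) * ‖φ x‖ ^ 2 ≤ 2 ^ (d + 1) * (M ^ 2 + N ^ 2) := by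
    by_cases hx : |x| ≤ 1
    · have h1 := hM x (abs_le.1 hx)
      have h2 : x ^ 2 ≤ 1 := (sq_le_one_iff_abs_le_one x).2 hx
      gcongr
      · linarith
      · have : ‖φ x‖ ^ 2 ≤ M ^ 2 := by gcongr
        nlinarith [sq_nonneg N]
    · push Not at hx
      have hx0 : x ≠ 0 := by rintro rfl; simp at hx; linarith
      have hy : |(-x⁻¹)| ≤ 1 := by
        rw [abs_neg, abs_inv]
        exact inv_le_one_of_one_le₀ hx.le
      have h1 := hN _ (abs_le.1 hy)
      rw [e _ (by simpa using hx0)] at h1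
      simp only [inv_neg, inv_inv, neg_neg, norm_mul, norm_inv, norm_pow, Complex.norm_real,
        norm_neg, Real.norm_eq_abs, inv_pow] at h1
      have h2 : 1 ≤ x ^ 2 := by rw [← sq_abs]; exact one_le_pow₀ hx.le
      calc (1 + x ^ 2) ^ (d + 1) * ‖φ x‖ ^ 2
          ≤ (2 * x ^ 2) ^ (d + 1) * ‖φ x‖ ^ 2 := by gcongr; linarith
        _ = 2 ^ (d + 1) * (|x| ^ (d + 1) * ‖φ x‖) ^ 2 := by
            rw [mul_pow, ← sq_abs x]; ring
        _ ≤ 2 ^ (d + 1) * N ^ 2 := by gcongr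
        _ ≤ _ := by gcongr; nlinarith [sq_nonneg M]
  calc _ = (1 + x ^ 2) ^ (d + 1) * ‖φ x‖ ^ 2 := by ring
    _ ≤ _ := hle

/-- `(1 + x ^ 2) ^ (d / 2) * φ x`. -/
def weighted (d : ℕ) (φ : ℝ → ℂ) (x : ℝ) : ℂ := (√(1 + x ^ 2) ^ d : ℝ) * φ x

theorem norm_weighted_sq (φ : ℝ → ℂ) (x : ℝ) :
    ‖weighted d φ x‖ ^ 2 = (1 + x ^ 2) ^ d * ‖φ x‖ ^ 2 := by
  rw [weighted, norm_mul, mul_pow, Complex.norm_real, Real.norm_eq_abs, sq_abs, ← pow_mul,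
    mul_comm d, pow_mul, Real.sq_sqrt (by positivity)]

theorem memLp_weighted (φ : ISpace d) : MemLp (weighted d φ) 2 volume := by
  have hc : Continuous (weighted d φ) := by
    have := φ.contDiff.continuous
    unfold weighted
    fun_prop
  rw [memLp_two_iff_integrable_sq_norm hc.aestronglyMeasurable]
  obtain ⟨C, hC⟩ := exists_weight_bound φ
  refine (integrable_inv_one_add_sq.const_mul C).mono' (by fun_prop) (.of_forall fun x => ?_)
  rw [Real.norm_of_nonneg (by positivity), norm_weighted_sq]
  exact hC x

/-- `φ ↦ (1 + x ^ 2) ^ (d / 2) * φ x`, as a linear map from `I_d` to `L ^ 2 (ℝ)`. -/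
def toL2 (d : ℕ) : ISpace d →ₗ[ℂ] Lp ℂ 2 (volume : Measure ℝ) where
  toFun φ := (memLp_weighted φ).toLp _
  map_add' φ φ' := by
    rw [← MemLp.toLp_add, MemLp.toLp_eq_toLp_iff]
    exact .of_forall fun x => by simp [weighted, mul_add]
  map_smul' c φ := by
    rw [RingHom.id_apply, ← MemLp.toLp_const_smul, MemLp.toLp_eq_toLp_iff]
    exact .of_forall fun x => by simp [weighted, mul_left_comm]

theorem norm_toL2 (φ : ISpace d) : ‖toL2 d φ‖ = √(∫ x : ℝ, (1 + x ^ 2) ^ d * ‖φ x‖ ^ 2) := by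
  change ‖(memLp_weighted φ).toLp _‖ = _
  rw [Lp.norm_toLp, (memLp_weighted φ).eLpNorm_eq_integral_rpow_norm (by simp) (by simp),
    ENNReal.toReal_ofReal (by positivity), Real.sqrt_eq_rpow]
  simp [norm_weighted_sq]

/-- The norm `φ ↦ (∫ (1 + x ^ 2) ^ d * |φ x| ^ 2 dx) ^ (1/2)` of `I_d`. -/
def l2Seminorm (d : ℕ) : Seminorm ℂ (ISpace d) where
  toFun φ := √(∫ x : ℝ, (1 + x ^ 2) ^ d * ‖φ x‖ ^ 2)
  map_zero' := by rw [← norm_toL2, map_zero, norm_zero]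
  add_le' φ φ' := by rw [← norm_toL2, ← norm_toL2, ← norm_toL2, map_add]; exact norm_add_le _ _
  neg' φ := by rw [← norm_toL2, ← norm_toL2, map_neg, norm_neg]
  smul' c φ := by rw [← norm_toL2, ← norm_toL2, map_smul, norm_smul]

/-- The seminorms `‖φ‖_{d,D} = (∫ (1 + x ^ 2) ^ d * |(D φ)(x)| ^ 2 dx) ^ (1/2)`, `D ∈ U(𝔤)`. -/
def seminormFamily (d : ℕ) : SeminormFamily ℂ (ISpace d) (UniversalEnvelopingAlgebra ℝ sl2R) :=
  fun D => (l2Seminorm d).comp (envRep d D)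

/-- The uniform structure, and with it the Fréchet topology, of `I_d`: the coarsest one for
which all the seminorms `‖·‖_{d,D}`, `D ∈ U(𝔤)`, are uniformly continuous. -/
instance (d : ℕ) : UniformSpace (ISpace d) :=
  ⨅ D, (seminormFamily d D).toSeminormedAddCommGroup.toUniformSpace

instance (d : ℕ) : IsUniformAddGroup (ISpace d) :=
  isUniformAddGroup_iInf fun D =>
    letI := (seminormFamily d D).toSeminormedAddCommGroup
    inferInstance

theorem withSeminorms (d : ℕ) : WithSeminorms (seminormFamily d) :=
  (SeminormFamily.withSeminorms_iff_uniformSpace_eq_iInf _).2 rfl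

/-! ### The Schwartz spaces on half lines and the operator `T_d` -/

/-- `f` is a Schwartz function on the closed half line `s`: it is smooth on `s` (one-sidedly
at the end point), and `f` and all its derivatives are rapidly decreasing. Only the values of
`f` on `s` matter. -/
structure IsSchwartzOn (s : Set ℝ) (f : ℝ → ℂ) : Prop where
  smooth : ContDiffOn ℝ ∞ f s
  decay : ∀ k n : ℕ, ∃ C : ℝ, ∀ x ∈ s, |x| ^ k * ‖iteratedDerivWithin n f s x‖ ≤ C

theorem IsSchwartzOn.add {s : Set ℝ} (hs : UniqueDiffOn ℝ s) {f g : ℝ → ℂ}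
    (hf : IsSchwartzOn s f) (hg : IsSchwartzOn s g) : IsSchwartzOn s (f + g) := by
  refine ⟨hf.smooth.add hg.smooth, fun k n => ?_⟩
  obtain ⟨C, hC⟩ := hf.decay k n
  obtain ⟨C', hC'⟩ := hg.decay k n
  refine ⟨C + C', fun x hx => ?_⟩
  rw [iteratedDerivWithin_add hx hs ((hf.smooth x hx).of_le (by exact_mod_cast le_top))
    ((hg.smooth x hx).of_le (by exact_mod_cast le_top))]
  calc _ ≤ |x| ^ k * (‖iteratedDerivWithin n f s x‖ + ‖iteratedDerivWithin n g s x‖) := by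
        gcongr; exact norm_add_le _ _
    _ ≤ C + C' := by rw [mul_add]; exact add_le_add (hC x hx) (hC' x hx)

theorem IsSchwartzOn.smul {s : Set ℝ} {f : ℝ → ℂ} (c : ℂ) (hf : IsSchwartzOn s f) :
    IsSchwartzOn s (c • f) := by
  refine ⟨contDiffOn_const.smul hf.smooth, fun k n => ?_⟩
  obtain ⟨C, hC⟩ := hf.decay k n
  refine ⟨‖c‖ * C, fun x hx => ?_⟩
  rw [iteratedDerivWithin_const_smul_field, norm_smul, mul_left_comm]
  gcongr
  exact hC x hx

/-- The space `S_d(s)` of the functions on the half line `s` of the form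
`|x| ^ ((d + 1) / 2) * f₁ x` with `f₁` a Schwartz function on `s`. Its elements are extended by
zero to `ℝ`. -/
def halfSpace (d : ℕ) (s : Set ℝ) (hs : UniqueDiffOn ℝ s) : Submodule ℂ (ℝ → ℂ) where
  carrier := {f | (∃ f₁ : ℝ → ℂ, IsSchwartzOn s f₁ ∧
    ∀ x ∈ s, f x = (|x| ^ (((d : ℝ) + 1) / 2) : ℝ) * f₁ x) ∧ ∀ x ∉ s, f x = 0}
  zero_mem' := by
    refine ⟨⟨0, ⟨contDiffOn_const, fun k n => ⟨0, fun x _ => ?_⟩⟩, by simp⟩, by simp⟩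
    simp [iteratedDerivWithin_const_zero]
  add_mem' := by
    rintro f g ⟨⟨f₁, hf, e⟩, z⟩ ⟨⟨g₁, hg, e'⟩, z'⟩
    exact ⟨⟨f₁ + g₁, hf.add hs hg, fun x hx => by simp [e x hx, e' x hx, mul_add]⟩,
      fun x hx => by simp [z x hx, z' x hx]⟩
  smul_mem' := by
    rintro c f ⟨⟨f₁, hf, e⟩, z⟩
    exact ⟨⟨c • f₁, hf.smul c, fun x hx => by simp [e x hx, mul_left_comm]⟩,
      fun x hx => by simp [z x hx]⟩

theorem integrable_kernel {s : Set ℝ} {hs : UniqueDiffOn ℝ s} (hm : MeasurableSet s) {f : ℝ → ℂ}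
    (hf : f ∈ halfSpace d s hs) (z : ℝ) : Integrable fun y : ℝ =>
      ((|y| ^ (((d : ℝ) - 1) / 2) : ℝ) : ℂ) * f y * Complex.exp (Complex.I * y * z) := by
  obtain ⟨⟨f₁, h₁, e⟩, h0⟩ := hf
  have hfi : f = s.indicator fun x => ((|x| ^ (((d : ℝ) + 1) / 2) : ℝ) : ℂ) * f₁ x := by
    funext x
    by_cases hx : x ∈ s
    · simp [hx, e x hx]
    · simp [hx, h0 x hx]
  have hfm : AEStronglyMeasurable f volume := by
    rw [hfi, aestronglyMeasurable_indicator_iff hm]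
    refine AEStronglyMeasurable.mul ?_ (h₁.smooth.continuousOn.aestronglyMeasurable hm)
    exact Measurable.aestronglyMeasurable (by fun_prop)
  obtain ⟨C, hC⟩ := h₁.decay d 0
  obtain ⟨C', hC'⟩ := h₁.decay (d + 2) 0
  simp only [iteratedDerivWithin_zero] at hC hC'
  refine (integrable_inv_one_add_sq.const_mul (|C| + |C'|)).mono' ?_ (.of_forall fun y => ?_)
  · refine AEStronglyMeasurable.mul (AEStronglyMeasurable.mul ?_ hfm) ?_
    · exact Measurable.aestronglyMeasurable (by fun_prop)
    · exact Continuous.aestronglyMeasurable (by fun_prop)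
  · have hexp : ‖Complex.exp (Complex.I * y * z)‖ = 1 := by
      rw [show Complex.I * y * z = ((y * z : ℝ) : ℂ) * Complex.I by push_cast; ring]
      exact Complex.norm_exp_ofReal_mul_I _
    rw [norm_mul, hexp, mul_one, norm_mul, Complex.norm_real, Real.norm_of_nonneg (by positivity)]
    by_cases hy : y ∈ s
    · rw [e y hy, norm_mul, Complex.norm_real, Real.norm_of_nonneg (by positivity), ← mul_assoc]
      have hpow : |y| ^ (((d : ℝ) - 1) / 2) * |y| ^ (((d : ℝ) + 1) / 2) ≤ |y| ^ d := by
        rcases eq_or_ne y 0 with rfl | h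
        · rw [abs_zero, Real.zero_rpow (x := ((d : ℝ) + 1) / 2) (by positivity), mul_zero]
          positivity
        · rw [← Real.rpow_add (abs_pos.2 h), ← Real.rpow_natCast]
          apply le_of_eq
          congr 1
          ring
      rw [← div_eq_mul_inv, le_div_iff₀ (by positivity)]
      calc _ ≤ |y| ^ d * ‖f₁ y‖ * (1 + y ^ 2) := by gcongr
        _ = |y| ^ d * ‖f₁ y‖ + |y| ^ (d + 2) * ‖f₁ y‖ := by rw [← sq_abs y]; ring
        _ ≤ _ := add_le_add ((hC y hy).trans (le_abs_self _)) ((hC' y hy).trans (le_abs_self _))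
    · rw [h0 y hy, norm_zero, mul_zero]
      positivity

/-- The operator `T_d(f)(z) = (2π) ^ (-1/2) * ∫ |y| ^ ((d - 1) / 2) * f(y) * e ^ (i y z) dy`. -/
def opT (d : ℕ) (s : Set ℝ) (hs : UniqueDiffOn ℝ s) (hm : MeasurableSet s) :
    halfSpace d s hs →ₗ[ℂ] (ℝ → ℂ) where
  toFun f z := ((√(2 * Real.pi) : ℝ) : ℂ)⁻¹ * ∫ y : ℝ,
    ((|y| ^ (((d : ℝ) - 1) / 2) : ℝ) : ℂ) * f.1 y * Complex.exp (Complex.I * y * z)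
  map_add' f g := by
    funext z
    rw [Pi.add_apply, ← mul_add, ← integral_add (integrable_kernel hm f.2 z)
      (integrable_kernel hm g.2 z)]
    congr 2
    funext y
    simp only [Submodule.coe_add, Pi.add_apply]
    ring
  map_smul' c f := by
    funext z
    rw [RingHom.id_apply, Pi.smul_apply, smul_eq_mul, mul_left_comm c, ← integral_const_mul c]
    congr 2
    funext y
    simp only [Submodule.coe_smul, Pi.smul_apply, smul_eq_mul]
    ring

/-- `T_d(S_d([0, ∞)))`, as a space of functions on `ℝ`. -/
def imagePlus (d : ℕ) : Submodule ℂ (ℝ → ℂ) :=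
  LinearMap.range (opT d (Set.Ici 0) (uniqueDiffOn_Ici 0) measurableSet_Ici)

/-- `T_d(S_d((-∞, 0]))`, as a space of functions on `ℝ`. -/
def imageMinus (d : ℕ) : Submodule ℂ (ℝ → ℂ) :=
  LinearMap.range (opT d (Set.Iic 0) (uniqueDiffOn_Iic 0) measurableSet_Iic)

/-- `I_d⁺`, as a subspace of `I_d`. -/
def IPlus (d : ℕ) : Submodule ℂ (ISpace d) := (imagePlus d).comap (ISpace.incl d)

/-- `I_d⁻`, as a subspace of `I_d`. -/
def IMinus (d : ℕ) : Submodule ℂ (ISpace d) := (imageMinus d).comap (ISpace.incl d)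

/-! ### Fréchet representations -/

/-- A Fréchet space over `ℂ`: a locally convex, Hausdorff, metrizable and complete
topological vector space. -/
structure IsFrechetSpace (V : Type*) [AddCommGroup V] [Module ℂ V] [Module ℝ V]
    [IsScalarTower ℝ ℂ V] [UniformSpace V] : Prop where
  uniformAddGroup : IsUniformAddGroup V
  continuousSMul : ContinuousSMul ℂ V
  locallyConvex : LocallyConvexSpace ℝ V
  metrizable : TopologicalSpace.MetrizableSpace V
  complete : CompleteSpace V

/-- A Fréchet representation: a representation on a Fréchet space with continuous action map
`G × V → V`. -/
structure IsFrechetRepresentation {G V : Type*} [Group G] [TopologicalSpace G] [AddCommGroup V]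
    [Module ℂ V] [Module ℝ V] [IsScalarTower ℝ ℂ V] [UniformSpace V]
    (ρ : Representation ℂ G V) : Prop where
  frechet : IsFrechetSpace V
  continuous_act : Continuous fun p : G × V => ρ p.1 p.2

/-- An irreducible Fréchet representation: it is not zero, and it has no closed invariant
subspaces besides zero and the whole space. -/
structure IsIrreducibleFrechetRepresentation {G V : Type*} [Group G] [TopologicalSpace G]
    [AddCommGroup V] [Module ℂ V] [Module ℝ V] [IsScalarTower ℝ ℂ V] [UniformSpace V]
    (ρ : Representation ℂ G V) : Prop extends IsFrechetRepresentation ρ where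
  nontrivial : Nontrivial V
  irreducible : ∀ W : Subrepresentation ρ, IsClosed (W.toSubmodule : Set V) →
    W.toSubmodule = ⊥ ∨ W.toSubmodule = ⊤

end HankelKirillov

end

open scoped ContDiff Topology
open MeasureTheory

noncomputable section

namespace HankelKirillov

variable {d : ℕ}

/-! ### Restriction of the homogeneous function to the unit circle -/

/-! A vector `φ` of `I_d` is a chart of a function on the punctured plane, homogeneous of degree
`-d-1`. Restricting it to the unit circle (`lift`) identifies `I_d` with the smooth functions of an
angle that satisfy `A(θ + π) = (-1)^(d+1) A(θ)`. The weight `(1 + x²)^d` is the one that turns the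
basic norm into an `L²` norm over half a circle, and the rotation generator `rotOp` becomes `d/dθ`.
With a Sobolev inequality, and since all of `U(𝔤)` acts by smooth differential operators on the
circle, the given topology is that of uniform convergence of all angular derivatives
(`isInducing_jet`). Completeness follows from `isClosed_range_jet`. Joint continuity of the action
follows by moving `rotOp` past `π_d(g)` (`rotOp_pow_rep`), which leaves only a statement of order
zero.

On the circle the vectors `kType d k`, of weight `d + 1 + 2k`, span a dense subspace; on the line
they are `(1 - ix)^(-d-1) ((1 + ix)/(1 - ix))^k`. Let `hardy d` consist of the vectors with no
component for `k < 0`. By `mem_hardy_iff` these are exactly the vectors whose Fourier transform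
vanishes on `(-∞, 0]`. The first description is stable under rotations, the second under upper
triangular matrices, and together these generate the group (`rep_mem_hardy`). For irreducibility, a
closed invariant subspace contains every `kType d k` that occurs in one of its vectors, by
Hahn-Banach and uniqueness of Fourier series. The generator of translations links neighbouring
weights with coefficients that do not vanish for `k ≥ 0`, except for the step down from `k = 0`
(`lieEnd_transl_kType`, `eq_hardy_of_le`).

It remains to see that `I_d⁺` is `hardy d` (`IPlus_eq_hardy`). Up to a constant, `T_d` sends
`|y|^((d+1)/2) f₁` to `∫ y^d f₁(y) e^(iyx) dy`. For `f₁` Schwartz on `[0, ∞)` this lies in `I_d`,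
because the generator that differentiates at infinity acts on `f₁` by a second order operator
preserving the Schwartz space (`lieOp_synth`, `synth_mem`). Conversely, for `φ` in the Hardy space,
`y^(-d)` times its Fourier transform is smooth up to `0`: subtracting multiples of the functions `(1
- ix)^(-n-1)`, whose transforms are explicit, leaves a remainder that vanishes at `0` to any
prescribed order (`exists_hat_eq_add`, `exists_norm_hat_le`).

The case of `I_d⁻` follows by the reflection `x ↦ -x`, which intertwines `π_d` with its twist by an
automorphism of the group. -/

theorem lieOp_ext {φ ψ : ℝ → ℂ} (hφ : ContDiff ℝ ∞ φ)
    (e : ∀ x : ℝ, x ≠ 0 → ψ x = ((x : ℂ) ^ (d + 1))⁻¹ * φ (-x⁻¹)) (a b c : ℝ) {x : ℝ}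
    (hx : x ≠ 0) :
    lieOp d (-a) (-c) (-b) ψ x = ((x : ℂ) ^ (d + 1))⁻¹ * lieOp d a b c φ (-x⁻¹) := by
  have hxc : (x : ℂ) ≠ 0 := by exact_mod_cast hx
  have hφd : HasDerivAt φ (deriv φ (-x⁻¹)) (-x⁻¹) :=
    (hφ.differentiable (by simp) _).hasDerivAt
  have h1 : HasDerivAt (fun y : ℝ => -y⁻¹) (x ^ 2)⁻¹ x := by
    simpa using (hasDerivAt_inv hx).fun_neg
  have h2 : HasDerivAt (fun y : ℝ => φ (-y⁻¹)) ((x ^ 2)⁻¹ • deriv φ (-x⁻¹)) x :=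
    hφd.scomp x h1
  have h3 : HasDerivAt (fun y : ℝ => ((y : ℂ) ^ (d + 1))⁻¹) _ x :=
    ((hasDerivAt_ofReal_comp x).fun_pow (d + 1)).fun_inv (pow_ne_zero _ hxc)
  have h4 := (HasDerivAt.congr_of_eventuallyEq (h3.fun_mul h2)
    (show ψ =ᶠ[𝓝 x] _ by filter_upwards [eventually_ne_nhds hx] with y hy using e y hy)).deriv
  unfold lieOp
  rw [h4, e x hx]
  simp only [Complex.real_smul]
  push_cast
  field_simp
  ring

theorem cos_ne_zero_or_sin_ne_zero (θ : ℝ) : Real.cos θ ≠ 0 ∨ Real.sin θ ≠ 0 := by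
  by_contra! h
  have := Real.sin_sq_add_cos_sq θ
  simp [h.1, h.2] at this

theorem continuous_homog_cos_sin (φ : ISpace d) :
    Continuous fun θ : ℝ => homog d φ (Real.cos θ) (Real.sin θ) :=
  (contDiff_homog φ Real.contDiff_cos Real.contDiff_sin cos_ne_zero_or_sin_ne_zero).continuous

/-- The restriction to the unit circle of the homogeneous function on `ℝ² \ {0}` attached
to `φ ∈ I_d`, as a function of the angle. -/
def lift (d : ℕ) : ISpace d →ₗ[ℂ] C(AddCircle (2 * Real.pi), ℂ) where
  toFun φ :=
    { toFun := Function.Periodic.lift (f := fun θ : ℝ => homog d φ (Real.cos θ) (Real.sin θ))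
        (fun θ => by simp)
      continuous_toFun := by
        refine (QuotientAddGroup.isQuotientMap_mk _).continuous_iff.2 ?_
        exact continuous_homog_cos_sin φ }
  map_add' φ φ' := by
    ext t
    induction t using QuotientAddGroup.induction_on with
    | H θ => exact homog_add φ φ' _ _
  map_smul' c φ := by
    ext t
    induction t using QuotientAddGroup.induction_on with
    | H θ => exact homog_smul c φ _ _

theorem lift_coe (φ : ISpace d) (θ : ℝ) :
    lift d φ (θ : AddCircle (2 * Real.pi)) = homog d φ (Real.cos θ) (Real.sin θ) := rfl

theorem lift_add_pi (φ : ISpace d) (θ : ℝ) :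
    lift d φ ((θ + Real.pi : ℝ) : AddCircle (2 * Real.pi)) = (-1) ^ (d + 1) * lift d φ (θ : ℝ) := by
  rw [lift_coe, lift_coe, Real.cos_add_pi, Real.sin_add_pi, neg_eq_neg_one_mul,
    neg_eq_neg_one_mul (Real.sin θ), homog_smul_smul φ (by norm_num)]
  congr 1
  push_cast
  rw [← inv_pow]
  norm_num

/-- The point `(1, x)` has norm `√(1 + x²)` and angle `arctan x`, so homogeneity gives the factor.
This is the dictionary between the line and the circle. -/
theorem lift_arctan (φ : ISpace d) (x : ℝ) :
    lift d φ (Real.arctan x : ℝ) = ((√(1 + x ^ 2) : ℝ) : ℂ) ^ (d + 1) * φ x := by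
  have h : √(1 + x ^ 2) ≠ 0 := by positivity
  rw [lift_coe, Real.cos_arctan, Real.sin_arctan, homog_of_ne (by positivity)]
  congr 1
  · push_cast
    rw [one_div, inv_pow, inv_inv]
  · field_simp

/-- The values of `arctan` fill an open interval of length `π`; continuity adds its end points, and
the parity under `θ ↦ θ + π` reaches all other angles. -/
theorem eq_of_eq_arctan {F G : ℝ → ℂ} (hF : Continuous F) (hG : Continuous G)
    (hF' : ∀ θ, F (θ + Real.pi) = (-1) ^ (d + 1) * F θ)
    (hG' : ∀ θ, G (θ + Real.pi) = (-1) ^ (d + 1) * G θ)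
    (h : ∀ x, F (Real.arctan x) = G (Real.arctan x)) : F = G := by
  have hper : Function.Periodic (fun θ => F θ = G θ) Real.pi := by
    intro θ
    simp only [hF', hG', eq_iff_iff]
    refine mul_right_inj' (pow_ne_zero _ (by norm_num))
  have hcl : IsClosed {θ | F θ = G θ} := isClosed_eq hF hG
  have hsub : Set.Icc (-(Real.pi / 2)) (Real.pi / 2) ⊆ {θ | F θ = G θ} := by
    rw [← closure_Ioo (by linarith [Real.pi_pos]), ← Real.range_arctan]
    refine hcl.closure_subset_iff.2 ?_
    rintro _ ⟨x, rfl⟩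
    exact h x
  funext θ
  obtain ⟨n, hn, -⟩ := existsUnique_sub_zsmul_mem_Ico Real.pi_pos θ (-(Real.pi / 2))
  have h1 : F (θ - n • Real.pi) = G (θ - n • Real.pi) := by
    refine hsub ⟨hn.1, ?_⟩
    have := hn.2.le
    linarith
  have h2 := hper.sub_zsmul_eq n (x := θ)
  exact h2 ▸ h1

theorem lift_injective : Function.Injective (lift d) := by
  intro φ φ' h
  refine ISpace.ext fun x => ?_
  have h1 := lift_arctan φ x
  rw [h, lift_arctan] at h1
  have : ((√(1 + x ^ 2) : ℝ) : ℂ) ^ (d + 1) ≠ 0 :=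
    pow_ne_zero _ (by exact_mod_cast (by positivity : √(1 + x ^ 2) ≠ 0))
  exact (mul_left_cancel₀ this h1).symm

/-- The action of the generator of the rotation group. -/
def rotOp (d : ℕ) : Module.End ℂ (ISpace d) := lieEnd d 0 1 (-1)

/-- Stated for any rotating pair `(u, w)`, so that it serves both charts: `(cos, sin)` with `φ`, and
`(-sin, cos)` with the extension `ψ` at infinity. -/
theorem hasDerivAt_homog_aux {f : ℝ → ℂ} (hf : ContDiff ℝ ∞ f) {u w : ℝ → ℝ} {θ : ℝ}
    (hu : HasDerivAt u (-w θ) θ) (hw : HasDerivAt w (u θ) θ) (h0 : u θ ≠ 0) :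
    HasDerivAt (fun t => ((u t : ℂ) ^ (d + 1))⁻¹ * f (w t / u t))
      (((u θ : ℂ) ^ (d + 1))⁻¹ * lieOp d 0 1 (-1) f (w θ / u θ)) θ := by
  have h0' : (u θ : ℂ) ≠ 0 := by exact_mod_cast h0
  have h1 : HasDerivAt f (deriv f (w θ / u θ)) (w θ / u θ) :=
    (hf.differentiable (by simp) _).hasDerivAt
  have h2 := h1.scomp θ (hw.fun_div hu h0)
  have h3 := (hu.ofReal_comp.fun_pow (d + 1)).fun_inv (pow_ne_zero _ h0')
  refine (h3.fun_mul h2).congr_deriv ?_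
  simp only [lieOp, Complex.real_smul, Function.comp]
  push_cast
  field_simp
  ring

/-- Where `cos θ = 0` the computation is made in the chart at infinity. The rotation generator has
the same expression there, because `(a, b, c) ↦ (-a, -c, -b)` fixes `(0, 1, -1)`. -/
theorem hasDerivAt_lift (φ : ISpace d) (θ : ℝ) :
    HasDerivAt (fun t : ℝ => lift d φ (t : AddCircle (2 * Real.pi)))
      (lift d (rotOp d φ) (θ : AddCircle (2 * Real.pi))) θ := by
  simp only [lift_coe]
  rcases cos_ne_zero_or_sin_ne_zero θ with h | h
  · rw [homog_of_ne h]
    refine (hasDerivAt_homog_aux φ.contDiff (Real.hasDerivAt_cos θ) (Real.hasDerivAt_sin θ)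
      h).congr_of_eventuallyEq ?_
    filter_upwards [Real.continuous_cos.continuousAt.eventually_ne h] with t ht
    exact homog_of_ne ht
  · obtain ⟨ψ, hψ, e⟩ := φ.exists_ext
    have e' : ∀ x : ℝ, x ≠ 0 → lieOp d 0 1 (-1) ψ x = ((x : ℂ) ^ (d + 1))⁻¹ *
        rotOp d φ (-x⁻¹) := by
      intro x hx
      have := lieOp_ext φ.contDiff e 0 1 (-1) hx
      rwa [neg_zero, neg_neg] at this
    rw [homog_eq_ext (contDiff_lieOp hψ _ _ _).continuous e' h]
    have := hasDerivAt_homog_aux (d := d) hψ (u := fun t => -Real.sin t) (w := Real.cos)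
      (Real.hasDerivAt_sin θ).fun_neg (Real.hasDerivAt_cos θ) (by simpa using h)
    rw [neg_div, ← div_neg]
    refine this.congr_of_eventuallyEq ?_
    filter_upwards [Real.continuous_sin.continuousAt.eventually_ne h] with t ht
    rw [homog_eq_ext hψ.continuous e ht, neg_div, ← div_neg]

theorem contDiff_inv_sqrt_pow (n : ℕ) :
    ContDiff ℝ ∞ fun x : ℝ => (((√(1 + x ^ 2) : ℝ) : ℂ) ^ n)⁻¹ := by
  have h : ∀ x : ℝ, 1 + x ^ 2 ≠ 0 := fun x => by positivity
  refine ContDiff.inv ((Complex.ofRealCLM.contDiff.comp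
    (ContDiff.sqrt (by fun_prop) h)).pow n) fun x => pow_ne_zero _ ?_
  exact_mod_cast (by positivity : √(1 + x ^ 2) ≠ 0)

/-- The element of `I_d` whose restriction to the unit circle is a given function. -/
def ofCircle {A : ℝ → ℂ} (hA : ContDiff ℝ ∞ A)
    (hA' : ∀ θ, A (θ + Real.pi) = (-1) ^ (d + 1) * A θ) : ISpace d :=
  ⟨fun x => (((√(1 + x ^ 2) : ℝ) : ℂ) ^ (d + 1))⁻¹ * A (Real.arctan x), by
    refine ⟨(contDiff_inv_sqrt_pow _).mul (hA.comp Real.contDiff_arctan),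
      -- The angle of `-1/x` is `arctan x - π/2` for `x > 0`. For `x < 0` it exceeds this by `π`,
      -- and the resulting sign is compensated by replacing `|x|` with `-x`.
      fun x => (((√(1 + x ^ 2) : ℝ) : ℂ) ^ (d + 1))⁻¹ * A (Real.arctan x - Real.pi / 2),
      (contDiff_inv_sqrt_pow _).mul (hA.comp (Real.contDiff_arctan.sub contDiff_const)),
      fun x hx => ?_⟩
    have hs : √(1 + (-x⁻¹) ^ 2) = √(1 + x ^ 2) / |x| := by
      rw [← Real.sqrt_sq_eq_abs, ← Real.sqrt_div (by positivity)]
      congr 1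
      field_simp
      ring
    dsimp only
    rw [hs]
    rcases lt_or_gt_of_ne hx with h | h
    · have h1 : Real.arctan (-x⁻¹) = Real.arctan x - Real.pi / 2 + Real.pi := by
        rw [Real.arctan_neg, Real.arctan_inv_of_neg h]
        ring
      have hxc : (x : ℂ) ≠ 0 := by exact_mod_cast hx
      rw [h1, hA', abs_of_neg h]
      push_cast
      rw [div_pow, inv_div]
      have h2 : (-x : ℂ) ^ (d + 1) * (-1) ^ (d + 1) = (x : ℂ) ^ (d + 1) := by
        rw [← mul_pow]; simp
      have h3 : ((x : ℂ) ^ (d + 1))⁻¹ * (x : ℂ) ^ (d + 1) = 1 :=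
        inv_mul_cancel₀ (pow_ne_zero _ hxc)
      have key : ∀ S w : ℂ, S⁻¹ * w = ((x : ℂ) ^ (d + 1))⁻¹ *
          ((-x : ℂ) ^ (d + 1) / S * ((-1) ^ (d + 1) * w)) := by
        intro S w
        generalize (-x : ℂ) ^ (d + 1) = N at h2 ⊢
        generalize (-1 : ℂ) ^ (d + 1) = E at h2 ⊢
        generalize (x : ℂ) ^ (d + 1) = X at h2 h3 ⊢
        linear_combination (-(S⁻¹ * w)) * h3 - X⁻¹ * S⁻¹ * w * h2
      exact key _ _
    · have h1 : Real.arctan (-x⁻¹) = Real.arctan x - Real.pi / 2 := by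
        rw [Real.arctan_neg, Real.arctan_inv_of_pos h]
        ring
      have hxc : (x : ℂ) ≠ 0 := by exact_mod_cast hx
      rw [h1, abs_of_pos h]
      push_cast
      rw [div_pow, inv_div]
      field_simp⟩

theorem lift_ofCircle {A : ℝ → ℂ} (hA : ContDiff ℝ ∞ A)
    (hA' : ∀ θ, A (θ + Real.pi) = (-1) ^ (d + 1) * A θ) (θ : ℝ) :
    lift d (ofCircle hA hA') θ = A θ := by
  refine congrFun (eq_of_eq_arctan (d := d) (F := fun θ : ℝ => lift d (ofCircle hA hA') θ)
    ?_ hA.continuous (lift_add_pi _) hA' fun x => ?_) θ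
  · exact (lift d _).continuous.comp (AddCircle.continuous_mk' _)
  · rw [lift_arctan]
    exact mul_inv_cancel_left₀ (pow_ne_zero _
      (by exact_mod_cast (by positivity : √(1 + x ^ 2) ≠ 0))) _

section

attribute [local instance 100] LieRing.ofAssociativeRing
attribute [local instance 100] LieAlgebra.ofAssociativeAlgebra

/-! ### The topology of `I_d` in terms of uniform convergence on the circle -/

instance : Fact (0 < 2 * Real.pi) := ⟨Real.two_pi_pos⟩

theorem contDiff_lift (φ : ISpace d) :
    ContDiff ℝ ∞ fun θ : ℝ => lift d φ (θ : AddCircle (2 * Real.pi)) :=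
  contDiff_homog φ Real.contDiff_cos Real.contDiff_sin cos_ne_zero_or_sin_ne_zero

theorem continuous_lift_coe (φ : ISpace d) :
    Continuous fun θ : ℝ => lift d φ (θ : AddCircle (2 * Real.pi)) :=
  (contDiff_lift φ).continuous

theorem integral_comp_arctan {E : Type*} [NormedAddCommGroup E] [NormedSpace ℝ E] (G : ℝ → E) :
    ∫ x : ℝ, (1 + x ^ 2)⁻¹ • G (Real.arctan x) =
      ∫ θ in (-(Real.pi / 2))..(Real.pi / 2), G θ := by
  have h := integral_image_eq_integral_abs_deriv_smul (s := Set.univ) (f := Real.arctan)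
    (f' := fun x => 1 / (1 + x ^ 2)) MeasurableSet.univ
    (fun x _ => (Real.hasDerivAt_arctan x).hasDerivWithinAt) Real.arctan_injective.injOn G
  rw [Set.image_univ, Real.range_arctan, Measure.restrict_univ] at h
  rw [intervalIntegral.integral_of_le (by linarith [Real.pi_pos]), integral_Ioc_eq_integral_Ioo, h]
  refine integral_congr_ae (.of_forall fun x => ?_)
  dsimp only
  rw [abs_of_nonneg (by positivity), one_div]

theorem norm_lift_arctan_sq (φ : ISpace d) (x : ℝ) :
    ‖lift d φ (Real.arctan x : ℝ)‖ ^ 2 = (1 + x ^ 2) ^ (d + 1) * ‖φ x‖ ^ 2 := by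
  rw [lift_arctan, norm_mul, mul_pow, norm_pow, Complex.norm_real, Real.norm_eq_abs, ← pow_mul,
    mul_comm (d + 1), pow_mul, sq_abs, Real.sq_sqrt (by positivity)]

/-- Since `dθ = dx / (1 + x²)` and `|lift φ|² = (1 + x²)^(d+1) |φ|²`, the weight `(1 + x²)^d` is
exactly what gives the unweighted `L²` norm in the angle. -/
theorem l2Seminorm_eq (φ : ISpace d) : l2Seminorm d φ =
    √(∫ θ in (-(Real.pi / 2))..(Real.pi / 2), ‖lift d φ (θ : ℝ)‖ ^ 2) := by
  rw [← integral_comp_arctan fun θ : ℝ => ‖lift d φ (θ : ℝ)‖ ^ 2]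
  change √(∫ x : ℝ, (1 + x ^ 2) ^ d * ‖φ x‖ ^ 2) = _
  congr 2
  funext x
  have : 1 + x ^ 2 ≠ 0 := by positivity
  rw [norm_lift_arctan_sq, smul_eq_mul, pow_succ]
  field_simp
  ring

theorem l2Seminorm_le (φ : ISpace d) : l2Seminorm d φ ≤ √Real.pi * ‖lift d φ‖ := by
  rw [l2Seminorm_eq]
  refine Real.sqrt_le_iff.2 ⟨by positivity, ?_⟩
  have hpi := Real.pi_pos
  rw [mul_pow, Real.sq_sqrt hpi.le]
  have hc := continuous_lift_coe φ
  calc _ ≤ ∫ θ in (-(Real.pi / 2))..(Real.pi / 2), ‖lift d φ‖ ^ 2 := by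
        refine intervalIntegral.integral_mono (by linarith)
          ((hc.norm.pow 2).intervalIntegrable _ _) intervalIntegrable_const fun θ => ?_
        dsimp only
        gcongr
        exact (lift d φ).norm_coe_le_norm _
    _ = _ := by simp

theorem integral_norm_lift_le (φ : ISpace d) :
    ∫ θ in (-(Real.pi / 2))..(Real.pi / 2), ‖lift d φ (θ : ℝ)‖ ≤
      √Real.pi * l2Seminorm d φ := by
  have hpi := Real.pi_pos
  have hc := (continuous_lift_coe φ).norm
  rw [l2Seminorm_eq, ← Real.sqrt_mul hpi.le]
  refine Real.le_sqrt_of_sq_le ?_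
  set I := ∫ θ in (-(Real.pi / 2))..(Real.pi / 2), ‖lift d φ (θ : ℝ)‖ with hI
  set J := ∫ θ in (-(Real.pi / 2))..(Real.pi / 2), ‖lift d φ (θ : ℝ)‖ ^ 2 with hJ
  -- Cauchy-Schwarz, from the nonnegativity of the variance about the mean `I / π`.
  have h0 : 0 ≤ ∫ θ in (-(Real.pi / 2))..(Real.pi / 2), (‖lift d φ (θ : ℝ)‖ - I / Real.pi) ^ 2 :=
    intervalIntegral.integral_nonneg (by linarith) fun θ _ => sq_nonneg _
  have h1 : ∫ θ in (-(Real.pi / 2))..(Real.pi / 2), (‖lift d φ (θ : ℝ)‖ - I / Real.pi) ^ 2 =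
      J - 2 * (I / Real.pi) * I + Real.pi * (I / Real.pi) ^ 2 := by
    have e : ∀ θ : ℝ, (‖lift d φ (θ : ℝ)‖ - I / Real.pi) ^ 2 = ‖lift d φ (θ : ℝ)‖ ^ 2 -
        2 * (I / Real.pi) * ‖lift d φ (θ : ℝ)‖ + (I / Real.pi) ^ 2 := fun θ => by ring
    simp only [e]
    rw [intervalIntegral.integral_add, intervalIntegral.integral_sub,
      intervalIntegral.integral_const_mul, intervalIntegral.integral_const, ← hI, ← hJ]
    · simp
    all_goals exact Continuous.intervalIntegrable (by fun_prop) _ _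
  rw [h1] at h0
  field_simp at h0
  nlinarith

theorem norm_lift_sub_le (φ : ISpace d) {θ τ : ℝ}
    (hθ : θ ∈ Set.Icc (-(Real.pi / 2)) (Real.pi / 2))
    (hτ : τ ∈ Set.Icc (-(Real.pi / 2)) (Real.pi / 2)) :
    ‖lift d φ (θ : ℝ)‖ ≤ ‖lift d φ (τ : ℝ)‖ +
      ∫ t in (-(Real.pi / 2))..(Real.pi / 2), ‖lift d (rotOp d φ) (t : ℝ)‖ := by
  have hc := continuous_lift_coe (rotOp d φ)
  have h := intervalIntegral.integral_eq_sub_of_hasDerivAt (a := τ) (b := θ)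
    (fun t _ => hasDerivAt_lift φ t) (hc.intervalIntegrable _ _)
  have h1 : ‖lift d φ (θ : ℝ)‖ ≤ ‖lift d φ (τ : ℝ)‖ +
      ‖∫ t in τ..θ, lift d (rotOp d φ) (t : ℝ)‖ := by
    rw [h]
    exact norm_le_norm_add_norm_sub' _ _
  refine h1.trans ?_
  gcongr
  refine (intervalIntegral.norm_integral_le_integral_norm_uIoc).trans ?_
  rw [intervalIntegral.integral_of_le (by linarith [Real.pi_pos])]
  refine setIntegral_mono_set (hc.norm.integrableOn_Ioc) (.of_forall fun _ => norm_nonneg _) ?_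
  refine LE.le.eventuallyLE ?_
  exact Set.Ioc_subset_Ioc (le_min hτ.1 hθ.1) (max_le hτ.2 hθ.2)

theorem exists_mem_Icc_norm_lift_eq (φ : ISpace d) (t : AddCircle (2 * Real.pi)) :
    ∃ θ ∈ Set.Icc (-(Real.pi / 2)) (Real.pi / 2), ‖lift d φ t‖ = ‖lift d φ (θ : ℝ)‖ := by
  induction t using QuotientAddGroup.induction_on with
  | H θ =>
    obtain ⟨n, hn, -⟩ := existsUnique_sub_zsmul_mem_Ico Real.pi_pos θ (-(Real.pi / 2))
    refine ⟨θ - n • Real.pi, ⟨hn.1, by linarith [hn.2]⟩, ?_⟩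
    have hper : Function.Periodic (fun θ : ℝ => ‖lift d φ (θ : ℝ)‖) Real.pi := fun θ => by
      dsimp only
      rw [lift_add_pi]
      simp
    exact (hper.sub_zsmul_eq n).symm

/-- A Sobolev inequality. -/
theorem norm_lift_le (φ : ISpace d) :
    ‖lift d φ‖ ≤ √Real.pi * (l2Seminorm d φ + l2Seminorm d (rotOp d φ)) := by
  have hpi := Real.pi_pos
  have hs : 1 ≤ √Real.pi := Real.one_le_sqrt.2 (by linarith [Real.pi_gt_three])
  have hn := apply_nonneg (l2Seminorm d) φ
  have hn' := apply_nonneg (l2Seminorm d) (rotOp d φ)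
  rw [ContinuousMap.norm_le _ (by positivity)]
  intro t
  obtain ⟨θ, hθ, e⟩ := exists_mem_Icc_norm_lift_eq φ t
  rw [e]
  -- The bound at `θ` by the value at `τ` is averaged over `τ` in an interval of length `π`.
  have h1 : ∫ τ in (-(Real.pi / 2))..(Real.pi / 2), ‖lift d φ (θ : ℝ)‖ ≤
      ∫ τ in (-(Real.pi / 2))..(Real.pi / 2), (‖lift d φ (τ : ℝ)‖ +
      ∫ t in (-(Real.pi / 2))..(Real.pi / 2), ‖lift d (rotOp d φ) (t : ℝ)‖) := by
    have hc := continuous_lift_coe φ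
    refine intervalIntegral.integral_mono_on (by linarith) intervalIntegrable_const
      (Continuous.intervalIntegrable (by fun_prop) _ _) fun τ hτ => norm_lift_sub_le φ hθ hτ
  rw [intervalIntegral.integral_add
    ((continuous_lift_coe φ).norm.intervalIntegrable _ _) intervalIntegrable_const] at h1
  simp only [intervalIntegral.integral_const, smul_eq_mul, sub_neg_eq_add, add_halves] at h1
  have h2 := integral_norm_lift_le φ
  have h3 := integral_norm_lift_le (rotOp d φ)
  have h4 : Real.pi * ‖lift d φ (θ : ℝ)‖ ≤ √Real.pi * l2Seminorm d φ +
      Real.pi * (√Real.pi * l2Seminorm d (rotOp d φ)) := by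
    refine h1.trans (add_le_add h2 ?_)
    gcongr
  have h5 : √Real.pi * l2Seminorm d φ ≤ Real.pi * (√Real.pi * l2Seminorm d φ) :=
    le_mul_of_one_le_left (by positivity) (by linarith [Real.pi_gt_three])
  refine le_of_mul_le_mul_left ?_ hpi
  linarith

/-- The sequence of the derivatives of the restriction to the unit circle. -/
def jet (d : ℕ) : ISpace d →ₗ[ℂ] (ℕ → C(AddCircle (2 * Real.pi), ℂ)) :=
  LinearMap.pi fun j => lift d ∘ₗ (rotOp d) ^ j

theorem jet_apply (φ : ISpace d) (j : ℕ) : jet d φ j = lift d ((rotOp d ^ j) φ) := rfl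

theorem jet_injective : Function.Injective (jet d) := fun _ _ h => lift_injective (congrFun h 0)

theorem jet_rotOp (φ : ISpace d) (j : ℕ) : jet d (rotOp d φ) j = jet d φ (j + 1) := rfl

/-- Continuity of an endomorphism of `I_d` for the topology of the uniform convergence of all
derivatives on the circle. -/
def JetContinuous (T : Module.End ℂ (ISpace d)) : Prop :=
  @Continuous _ _ (TopologicalSpace.induced (jet d) inferInstance) _ fun φ => jet d (T φ)

theorem jetContinuous_one : JetContinuous (1 : Module.End ℂ (ISpace d)) := continuous_induced_dom

theorem JetContinuous.mul {S T : Module.End ℂ (ISpace d)} (hS : JetContinuous S)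
    (hT : JetContinuous T) : JetContinuous (S * T) := by
  let _ : TopologicalSpace (ISpace d) := TopologicalSpace.induced (jet d) inferInstance
  have hT' : @Continuous _ _ (TopologicalSpace.induced (jet d) inferInstance)
      (TopologicalSpace.induced (jet d) inferInstance) T := continuous_induced_rng.2 hT
  exact @Continuous.comp _ _ _ (TopologicalSpace.induced (jet d) inferInstance)
    (TopologicalSpace.induced (jet d) inferInstance) _ T (fun φ => jet d (S φ)) hS hT'

theorem JetContinuous.add {S T : Module.End ℂ (ISpace d)} (hS : JetContinuous S)
    (hT : JetContinuous T) : JetContinuous (S + T) := by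
  unfold JetContinuous at *
  let _ : TopologicalSpace (ISpace d) := TopologicalSpace.induced (jet d) inferInstance
  simp only [LinearMap.add_apply, map_add]
  exact Continuous.add hS hT

theorem JetContinuous.smul (c : ℂ) {T : Module.End ℂ (ISpace d)}
    (hT : JetContinuous T) : JetContinuous (c • T) := by
  unfold JetContinuous at *
  let _ : TopologicalSpace (ISpace d) := TopologicalSpace.induced (jet d) inferInstance
  simp only [LinearMap.smul_apply, map_smul]
  exact Continuous.const_smul hT c

theorem jetContinuous_rotOp : JetContinuous (rotOp d) := by
  unfold JetContinuous
  let _ : TopologicalSpace (ISpace d) := TopologicalSpace.induced (jet d) inferInstance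
  refine continuous_pi fun j => ?_
  simp only [jet_rotOp]
  exact (continuous_apply (j + 1)).comp continuous_induced_dom

/-- Multiplication by a smooth function of period `π` of the angle. -/
def mulOp {c : ℝ → ℂ} (hc : ContDiff ℝ ∞ c) (hp : Function.Periodic c Real.pi) :
    Module.End ℂ (ISpace d) where
  toFun φ := ofCircle (hc.mul (contDiff_lift φ)) fun θ => by
    rw [hp θ, lift_add_pi, mul_left_comm]
  map_add' φ φ' := ISpace.ext fun x => by
    change _ * (_ * lift d (φ + φ') _) = _ * (_ * lift d φ _) + _ * (_ * lift d φ' _)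
    rw [map_add, ContinuousMap.add_apply]
    ring
  map_smul' t φ := ISpace.ext fun x => by
    change _ * (_ * lift d (t • φ) _) = t * (_ * (_ * lift d φ _))
    rw [map_smul, ContinuousMap.smul_apply, smul_eq_mul]
    ring

theorem lift_mulOp {c : ℝ → ℂ} (hc : ContDiff ℝ ∞ c) (hp : Function.Periodic c Real.pi)
    (φ : ISpace d) (θ : ℝ) : lift d (mulOp hc hp φ) (θ : ℝ) = c θ * lift d φ (θ : ℝ) :=
  lift_ofCircle _ _ θ

theorem mulOp_apply {c : ℝ → ℂ} (hc : ContDiff ℝ ∞ c) (hp : Function.Periodic c Real.pi)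
    (φ : ISpace d) (x : ℝ) : mulOp hc hp φ x = c (Real.arctan x) * φ x := by
  have h := lift_mulOp hc hp φ (Real.arctan x)
  rw [lift_arctan, lift_arctan, mul_left_comm] at h
  refine mul_left_cancel₀ (pow_ne_zero (d + 1) ?_) h
  exact_mod_cast (by positivity : √(1 + x ^ 2) ≠ 0)

theorem lift_ext {f g : C(AddCircle (2 * Real.pi), ℂ)} (h : ∀ θ : ℝ, f θ = g θ) : f = g := by
  ext t
  induction t using QuotientAddGroup.induction_on with
  | H θ => exact h θ

theorem periodic_deriv {c : ℝ → ℂ} (hp : Function.Periodic c Real.pi) :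
    Function.Periodic (deriv c) Real.pi := by
  intro θ
  rw [← deriv_comp_add_const]
  congr 1
  funext t
  exact hp t

theorem rotOp_mulOp {c : ℝ → ℂ} (hc : ContDiff ℝ ∞ c) (hp : Function.Periodic c Real.pi)
    (φ : ISpace d) : rotOp d (mulOp hc hp φ) =
      mulOp (contDiff_infty_iff_deriv.1 hc).2 (periodic_deriv hp) φ + mulOp hc hp (rotOp d φ) := by
  refine lift_injective (lift_ext fun θ => ?_)
  have h1 := hasDerivAt_lift (mulOp hc hp φ) θ
  simp only [lift_mulOp] at h1
  rw [map_add, ContinuousMap.add_apply, lift_mulOp, lift_mulOp]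
  exact h1.unique (((hc.differentiable (by simp) θ).hasDerivAt).fun_mul (hasDerivAt_lift φ θ))

/-- Induction on the order of the jet with the Leibniz rule; `c` is generalized because its
derivatives appear as multipliers. -/
theorem jetContinuous_mulOp {c : ℝ → ℂ} (hc : ContDiff ℝ ∞ c)
    (hp : Function.Periodic c Real.pi) : JetContinuous (mulOp (d := d) hc hp) := by
  unfold JetContinuous
  let _ : TopologicalSpace (ISpace d) := TopologicalSpace.induced (jet d) inferInstance
  refine continuous_pi fun j => ?_
  have hK : Continuous (rotOp d) := continuous_induced_rng.2 jetContinuous_rotOp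
  induction j generalizing c with
  | zero =>
    have hp2 : Function.Periodic c (2 * Real.pi) := by simpa using hp.nat_mul 2
    let c' : C(AddCircle (2 * Real.pi), ℂ) := ⟨hp2.lift,
      (QuotientAddGroup.isQuotientMap_mk _).continuous_iff.2 hc.continuous⟩
    have : ∀ φ : ISpace d, jet d (mulOp hc hp φ) 0 = c' * jet d φ 0 := fun φ =>
      lift_ext fun θ => lift_mulOp hc hp φ θ
    simp only [this]
    exact continuous_const.mul ((continuous_apply 0).comp continuous_induced_dom)
  | succ j ih =>
    simp only [← jet_rotOp, rotOp_mulOp, map_add, Pi.add_apply]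
    exact (ih _ _).add ((ih hc hp).comp hK)

/-! ### The enveloping algebra in the angular coordinate -/

theorem cos_two_arctan (x : ℝ) : Real.cos (2 * Real.arctan x) = (1 - x ^ 2) / (1 + x ^ 2) := by
  have h : 1 + x ^ 2 ≠ 0 := by positivity
  rw [Real.cos_two_mul, Real.cos_sq_arctan]
  field_simp
  ring

theorem sin_two_arctan (x : ℝ) : Real.sin (2 * Real.arctan x) = 2 * x / (1 + x ^ 2) := by
  have h : 1 + x ^ 2 ≠ 0 := by positivity
  rw [Real.sin_two_mul, Real.sin_arctan, Real.cos_arctan]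
  have h1 : √(1 + x ^ 2) * √(1 + x ^ 2) = 1 + x ^ 2 := Real.mul_self_sqrt (by positivity)
  have h2 : √(1 + x ^ 2) ≠ 0 := by positivity
  field_simp
  rw [sq (√(1 + x ^ 2)), h1]

theorem contDiff_trig (p q r : ℝ) :
    ContDiff ℝ ∞ fun θ : ℝ =>
      ((p + q * Real.cos (2 * θ) + r * Real.sin (2 * θ) : ℝ) : ℂ) :=
  Complex.ofRealCLM.contDiff.comp
    ((contDiff_const.add (contDiff_const.mul (Real.contDiff_cos.comp (by fun_prop)))).add
      (contDiff_const.mul (Real.contDiff_sin.comp (by fun_prop))))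

theorem periodic_trig (p q r : ℝ) : Function.Periodic (fun θ : ℝ =>
      ((p + q * Real.cos (2 * θ) + r * Real.sin (2 * θ) : ℝ) : ℂ)) Real.pi := fun θ => by
  simp only [mul_add, Real.cos_add_two_pi, Real.sin_add_two_pi]

/-- Dividing the quadratic vector field by `1 + x²`, with `x = tan θ`, gives a trigonometric
polynomial in `2θ`. Hence each element of the Lie algebra is a first order operator on the circle
with smooth coefficients of period `π`. -/
theorem lieEnd_eq (a b c : ℝ) : lieEnd d a b c =
    mulOp (contDiff_trig ((b - c) / 2) ((b + c) / 2) (-a)) (periodic_trig _ _ _) * rotOp d +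
      (-(d + 1) : ℂ) • mulOp (contDiff_trig 0 a ((b + c) / 2)) (periodic_trig _ _ _) := by
  ext φ
  refine ISpace.ext fun x => ?_
  rw [LinearMap.add_apply, Module.End.mul_apply, LinearMap.smul_apply, ISpace.add_apply,
    ISpace.smul_apply, mulOp_apply, mulOp_apply, cos_two_arctan, sin_two_arctan]
  have h : (1 + (x : ℂ) ^ 2) ≠ 0 := by
    exact_mod_cast (by positivity : 1 + x ^ 2 ≠ 0)
  change lieOp d a b c φ x = _ * lieOp d 0 1 (-1) φ x + _
  simp only [lieOp]
  push_cast
  field_simp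
  ring

theorem jetContinuous_lieEnd (a b c : ℝ) : JetContinuous (lieEnd d a b c) := by
  rw [lieEnd_eq]
  exact ((jetContinuous_mulOp _ _).mul jetContinuous_rotOp).add
    ((jetContinuous_mulOp _ _).smul _)

/-- The algebra of the continuous endomorphisms of `I_d`. -/
def jetContinuousSubalgebra (d : ℕ) : Subalgebra ℝ (Module.End ℂ (ISpace d)) where
  carrier := {T | JetContinuous T}
  mul_mem' := JetContinuous.mul
  add_mem' := JetContinuous.add
  algebraMap_mem' r := by
    have : algebraMap ℝ (Module.End ℂ (ISpace d)) r = (r : ℂ) • 1 := by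
      ext φ
      exact ISpace.ext fun x => ISpace.real_smul_apply r φ x
    rw [this]
    exact jetContinuous_one.smul _

/-- The continuous endomorphisms form an algebra containing the image of the Lie algebra, so by the
uniqueness in the universal property the action of `U(𝔤)` factors through it. -/
theorem jetContinuous_envRep (D : UniversalEnvelopingAlgebra ℝ sl2R) :
    JetContinuous (envRep d D) := by
  let f : sl2R →ₗ⁅ℝ⁆ jetContinuousSubalgebra d :=
    { toFun := fun A => ⟨lieRep d A, jetContinuous_lieEnd _ _ _⟩
      map_add' := fun A B => Subtype.ext ((lieRep d).map_add A B)
      map_smul' := fun t A => Subtype.ext ((lieRep d).map_smul t A)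
      map_lie' := fun {A B} => Subtype.ext ((lieRep d).map_lie A B) }
  have h : envRep d = (jetContinuousSubalgebra d).val.comp
      (UniversalEnvelopingAlgebra.lift ℝ f) := by
    refine UniversalEnvelopingAlgebra.hom_ext ℝ (LieHom.ext fun A => ?_)
    simp [envRep, f]
  rw [h]
  exact (UniversalEnvelopingAlgebra.lift ℝ f D).2

/-! ### Comparison of the seminorm topology with uniform convergence of derivatives -/

theorem continuous_seminorm_comp (T : Module.End ℂ (ISpace d))
    (hT : ∃ D, envRep d D = T) : Continuous fun φ => l2Seminorm d (T φ) := by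
  obtain ⟨D, rfl⟩ := hT
  exact (withSeminorms d).continuous_seminorm D

theorem exists_envRep_eq_pow (j : ℕ) : ∃ D, envRep d D = rotOp d ^ j := by
  have hA : (!![0, 1; -1, 0] : Matrix (Fin 2) (Fin 2) ℝ) ∈ LieAlgebra.SpecialLinear.sl (Fin 2) ℝ := by
    change Matrix.trace (!![0, 1; -1, 0] : Matrix (Fin 2) (Fin 2) ℝ) = 0
    simp [Matrix.trace_fin_two]
  refine ⟨(UniversalEnvelopingAlgebra.ι ℝ (⟨_, hA⟩ : sl2R)) ^ j, ?_⟩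
  rw [map_pow, envRep, UniversalEnvelopingAlgebra.lift_ι_apply]
  rfl

/-- The Sobolev inequality costs one derivative, so the jet component of order `j` is controlled by
the seminorms of `rotOp ^ j` and `rotOp ^ (j + 1)`, both of which come from `U(𝔤)`. -/
theorem continuous_jet : Continuous (jet d) := by
  refine continuous_pi fun j => continuous_iff_continuousAt.2 fun φ₀ => ?_
  refine tendsto_iff_norm_sub_tendsto_zero.2 ?_
  have h1 := continuous_seminorm_comp _ (exists_envRep_eq_pow (d := d) j)
  have h2 := continuous_seminorm_comp _ (exists_envRep_eq_pow (d := d) (j + 1))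
  have h3 : Filter.Tendsto (fun φ => √Real.pi * (l2Seminorm d ((rotOp d ^ j) (φ - φ₀)) +
      l2Seminorm d ((rotOp d ^ (j + 1)) (φ - φ₀)))) (𝓝 φ₀) (𝓝 0) := by
    have h4 : Continuous fun φ => √Real.pi * (l2Seminorm d ((rotOp d ^ j) (φ - φ₀)) +
      l2Seminorm d ((rotOp d ^ (j + 1)) (φ - φ₀))) :=
      continuous_const.mul ((h1.comp (continuous_id.sub continuous_const)).add
        (h2.comp (continuous_id.sub continuous_const)))
    simpa using h4.tendsto φ₀
  refine squeeze_zero (fun _ => norm_nonneg _) (fun φ => ?_) h3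
  rw [← Pi.sub_apply, ← map_sub, jet_apply]
  refine (norm_lift_le _).trans (le_of_eq ?_)
  rw [pow_succ' (rotOp d) j]
  rfl

/-- One half is `continuous_jet`. For the other, `‖φ‖_{d,D}` is at most `√π` times the sup norm of
`D φ` on the circle, and `D` is continuous for the jet topology. -/
theorem isInducing_jet : Topology.IsInducing (jet d) := by
  refine Topology.isInducing_iff_nhds.2 fun φ₀ => le_antisymm
    (Filter.map_le_iff_le_comap.1 continuous_jet.continuousAt) ?_
  refine (((withSeminorms d).tendsto_nhds (id : ISpace d → ISpace d) φ₀).2 fun D ε hε => ?_ :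
    Filter.Tendsto id (Filter.comap (jet d) (𝓝 (jet d φ₀))) (𝓝 φ₀))
  have h1 := jetContinuous_envRep (d := d) D
  have h2 : Filter.Tendsto (fun φ => jet d (envRep d D φ))
      (Filter.comap (jet d) (𝓝 (jet d φ₀))) (𝓝 (jet d (envRep d D φ₀))) := by
    rw [← nhds_induced]
    exact @Continuous.continuousAt _ _ (TopologicalSpace.induced (jet d) inferInstance) _
      (fun φ => jet d (envRep d D φ)) φ₀ h1
  have h3 := ((continuous_apply 0).tendsto _).comp h2
  have h4 := (tendsto_iff_norm_sub_tendsto_zero.1 h3).const_mul (√Real.pi)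
  rw [mul_zero] at h4
  filter_upwards [h4.eventually_lt_const hε] with φ hφ
  refine lt_of_le_of_lt ?_ hφ
  change l2Seminorm d (envRep d D (φ - φ₀)) ≤ _
  refine (l2Seminorm_le _).trans (le_of_eq ?_)
  rw [map_sub, map_sub]
  rfl

end

/-! ### `I_d` is a Fréchet space -/

theorem isUniformInducing_jet : IsUniformInducing (jet d) :=
  AddMonoidHom.isUniformInducing_of_isInducing (f := (jet d).toAddMonoidHom) isInducing_jet

/-- Allows smoothness to be read off from an explicit list of candidates for the successive
derivatives, as in limits of jets and in integrals with a parameter. -/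
theorem contDiff_of_hasDerivAt_succ {F : Type*} [NormedAddCommGroup F] [NormedSpace ℝ F]
    {A : ℕ → ℝ → F} (h : ∀ j x, HasDerivAt (A j) (A (j + 1) x) x) (j : ℕ) :
    ContDiff ℝ ∞ (A j) := by
  refine contDiff_infty.2 fun n => ?_
  induction n generalizing j with
  | zero => exact contDiff_zero.2 (continuous_iff_continuousAt.2 fun x => (h j x).continuousAt)
  | succ n ih =>
    have : deriv (A j) = A (j + 1) := funext fun x => (h j x).deriv
    rw [Nat.cast_add, Nat.cast_one]
    refine contDiff_succ_iff_deriv.2 ⟨fun x => (h j x).differentiableAt, by simp, ?_⟩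
    rw [this]
    exact ih _

/-- A limit of jets is again a sequence of functions each of which is the derivative of the one
before, by uniform convergence, and the parity passes to the limit. `ofCircle` then yields a vector
of `I_d` with this jet. -/
theorem isClosed_range_jet : IsClosed (Set.range (jet d)) := by
  refine IsSeqClosed.isClosed fun u B hu hB => ?_
  choose φ hφ using hu
  have hlim : ∀ j, TendstoUniformly (fun n (t : AddCircle (2 * Real.pi)) => u n j t) (B j)
      Filter.atTop := fun j =>
    ContinuousMap.tendsto_iff_tendstoUniformly.1 (((continuous_apply j).tendsto B).comp hB)
  have hder : ∀ n j (θ : ℝ), HasDerivAt (fun t : ℝ => u n j t) (u n (j + 1) θ) θ := by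
    intro n j θ
    rw [← hφ, jet_apply, jet_apply, pow_succ']
    exact hasDerivAt_lift _ θ
  have hB' : ∀ j (θ : ℝ), HasDerivAt (fun t : ℝ => B j t) (B (j + 1) θ) θ := by
    intro j θ
    refine hasDerivAt_of_tendstoUniformly (l := Filter.atTop)
      (f := fun n (t : ℝ) => u n j t) (f' := fun n (t : ℝ) => u n (j + 1) t)
      ((hlim (j + 1)).comp (fun t : ℝ => (t : AddCircle (2 * Real.pi))))
      (.of_forall fun n θ => hder n j θ) (fun θ => (hlim j).tendsto_at _) θ
  have hsmooth := contDiff_of_hasDerivAt_succ hB' 0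
  have hanti : ∀ θ : ℝ, B 0 ((θ + Real.pi : ℝ) : AddCircle (2 * Real.pi)) =
      (-1) ^ (d + 1) * B 0 (θ : AddCircle (2 * Real.pi)) := by
    intro θ
    refine tendsto_nhds_unique ((hlim 0).tendsto_at _)
      ((((hlim 0).tendsto_at (θ : AddCircle (2 * Real.pi))).const_mul ((-1) ^ (d + 1))).congr ?_)
    intro n
    rw [← hφ, jet_apply]
    exact (lift_add_pi _ θ).symm
  refine ⟨ofCircle hsmooth hanti, funext fun j => ?_⟩
  induction j with
  | zero => exact lift_ext fun θ => lift_ofCircle _ _ θ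
  | succ j ih =>
    refine lift_ext fun θ => ?_
    have h1 := hasDerivAt_lift ((rotOp d ^ j) (ofCircle hsmooth hanti)) θ
    rw [← jet_apply, ih] at h1
    rw [jet_apply, pow_succ']
    exact h1.unique (hB' j θ)

theorem isFrechetSpace_ISpace (d : ℕ) : IsFrechetSpace (ISpace d) where
  uniformAddGroup := inferInstance
  continuousSMul := (withSeminorms d).continuousSMul
  locallyConvex := (withSeminorms d).toLocallyConvexSpace
  metrizable := (⟨isInducing_jet, jet_injective⟩ :
    Topology.IsEmbedding (jet d)).metrizableSpace
  complete := (completeSpace_iff_isComplete_range isUniformInducing_jet).2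
    isClosed_range_jet.isComplete

instance (d : ℕ) : ContinuousSMul ℂ (ISpace d) := (isFrechetSpace_ISpace d).continuousSMul
instance (d : ℕ) : LocallyConvexSpace ℝ (ISpace d) := (isFrechetSpace_ISpace d).locallyConvex
instance (d : ℕ) : CompleteSpace (ISpace d) := (isFrechetSpace_ISpace d).complete
instance (d : ℕ) : TopologicalSpace.MetrizableSpace (ISpace d) :=
  (isFrechetSpace_ISpace d).metrizable

/-! ### Continuity of the action -/

theorem JetContinuous.continuous {T : Module.End ℂ (ISpace d)} (hT : JetContinuous T) :
    Continuous T := by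
  refine isInducing_jet.continuous_iff.2 ?_
  rw [JetContinuous, ← isInducing_jet.eq_induced] at hT
  exact hT

theorem continuous_lieEnd (a b c : ℝ) : Continuous (lieEnd d a b c) :=
  (jetContinuous_lieEnd a b c).continuous

theorem continuous_lift : Continuous (lift d) := (continuous_apply 0).comp continuous_jet

theorem rep_apply (g : SL2R) (φ : ISpace d) (x : ℝ) :
    rep d g φ x = homog d φ (g 1 0 * x + g 0 0) (g 1 1 * x + g 0 1) := rfl

theorem SL2R_det (g : SL2R) : g 0 0 * g 1 1 - g 0 1 * g 1 0 = 1 := by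
  have := g.det_coe
  rwa [Matrix.det_fin_two] at this

theorem hasDerivAt_homog_affine {f : ℝ → ℂ} (hf : ContDiff ℝ ∞ f) (r p s q : ℝ) {x : ℝ}
    (hx : r * x + p ≠ 0) :
    HasDerivAt (fun y : ℝ => (((r * y + p : ℝ) : ℂ) ^ (d + 1))⁻¹ * f ((s * y + q) / (r * y + p)))
      ((((r * x + p : ℝ) : ℂ) ^ (d + 1))⁻¹ *
        ((p * s - q * r) / (r * x + p) ^ 2 * deriv f ((s * x + q) / (r * x + p)) -
        (d + 1) * r / (r * x + p) * f ((s * x + q) / (r * x + p)))) x := by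
  have hx' : (r * x + p : ℂ) ≠ 0 := by exact_mod_cast hx
  have hu : HasDerivAt (fun y => r * y + p) r x := by
    simpa using ((hasDerivAt_id x).const_mul r).add_const p
  have hv : HasDerivAt (fun y => s * y + q) s x := by
    simpa using ((hasDerivAt_id x).const_mul s).add_const q
  have h1 : HasDerivAt f (deriv f ((s * x + q) / (r * x + p))) ((s * x + q) / (r * x + p)) :=
    (hf.differentiable (by simp) _).hasDerivAt
  have h2 := h1.scomp x (hv.fun_div hu hx)
  have h3 := (hu.ofReal_comp.fun_pow (d + 1)).fun_inv (pow_ne_zero _ (by exact_mod_cast hx))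
  refine (h3.fun_mul h2).congr_deriv ?_
  simp only [Complex.real_smul, Function.comp]
  push_cast
  field_simp
  ring

/-- The identity `X π(g) = π(g) Ad(g⁻¹)X`: the new parameters are the entries of `g⁻¹ X g`. It is
computed where `r x + p ≠ 0` and extended by density and continuity. -/
theorem lieEnd_rep (g : SL2R) (a b c : ℝ) (φ : ISpace d) :
    lieEnd d a b c (rep d g φ) = rep d g (lieEnd d
      (a * (g 0 0 * g 1 1 + g 0 1 * g 1 0) + b * (g 1 0 * g 1 1) - c * (g 0 0 * g 0 1))
      (2 * a * (g 0 1 * g 1 1) + b * g 1 1 ^ 2 - c * g 0 1 ^ 2)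
      (-(2 * a * (g 0 0 * g 1 0)) - b * g 1 0 ^ 2 + c * g 0 0 ^ 2) φ) := by
  have hdet := SL2R_det g
  have hdense : Dense {x : ℝ | g 1 0 * x + g 0 0 ≠ 0} := by
    by_cases hr : g 1 0 = 0
    · have hp : g 0 0 ≠ 0 := by
        rintro hp
        simp [hr, hp] at hdet
      have : {x : ℝ | g 1 0 * x + g 0 0 ≠ 0} = Set.univ := by
        ext x
        simp [hr, hp]
      rw [this]
      exact dense_univ
    · have : {x : ℝ | g 1 0 * x + g 0 0 ≠ 0} = {-g 0 0 / g 1 0}ᶜ := by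
        ext x
        simp only [ne_eq, Set.mem_ofPred_eq, Set.mem_compl_iff, Set.mem_singleton_iff]
        rw [eq_div_iff hr, not_iff_not]
        constructor <;> intro h <;> linarith
      rw [this]
      exact dense_compl_singleton _
  refine ISpace.ext fun x => congrFun (Continuous.ext_on hdense
    (ISpace.contDiff _).continuous (ISpace.contDiff _).continuous fun x hx => ?_) x
  rw [Set.mem_ofPred_eq] at hx
  rw [rep_apply, homog_of_ne hx, lieEnd_apply, lieEnd_apply]
  have hd : HasDerivAt (rep d g φ) _ x :=
    HasDerivAt.congr_of_eventuallyEq (hasDerivAt_homog_affine φ.contDiff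
      (g 1 0) (g 0 0) (g 1 1) (g 0 1) hx) (by
      have : Continuous fun x : ℝ => g 1 0 * x + g 0 0 := by fun_prop
      filter_upwards [this.continuousAt.eventually_ne hx] with y hy using homog_of_ne hy)
  rw [lieOp, hd.deriv, rep_apply, homog_of_ne hx, lieOp]
  generalize deriv φ ((g 1 1 * x + g 0 1) / (g 1 0 * x + g 0 0)) = F'
  generalize φ ((g 1 1 * x + g 0 1) / (g 1 0 * x + g 0 0)) = F
  have hdet' : (g 0 0 * g 1 1 - g 0 1 * g 1 0 : ℂ) = 1 := by exact_mod_cast hdet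
  have hx' : (g 1 0 * x + g 0 0 : ℂ) ≠ 0 := by exact_mod_cast hx
  clear hd hdense
  push_cast
  generalize (g 0 0 : ℂ) = p at *
  generalize (g 0 1 : ℂ) = q at *
  generalize (g 1 0 : ℂ) = r at *
  generalize (g 1 1 : ℂ) = s at *
  generalize (x : ℂ) = x at *
  generalize (a : ℂ) = a
  generalize (b : ℂ) = b
  generalize (c : ℂ) = c
  generalize ((r * x + p) ^ (d + 1))⁻¹ = E
  have e1 : (2 * a * (q * s) + b * s ^ 2 - c * q ^ 2 -
      2 * (a * (p * s + q * r) + b * (r * s) - c * (p * q)) * ((s * x + q) / (r * x + p)) -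
      (-(2 * a * (p * r)) - b * r ^ 2 + c * p ^ 2) * ((s * x + q) / (r * x + p)) ^ 2) =
      (b - 2 * a * x - c * x ^ 2) * ((p * s - q * r) / (r * x + p) ^ 2) := by
    field_simp
    linear_combination (b - 2 * a * x - c * x ^ 2) * (p * s - q * r) * hdet'
  have e2 : a * (p * s + q * r) + b * (r * s) - c * (p * q) +
      (-(2 * a * (p * r)) - b * r ^ 2 + c * p ^ 2) * ((s * x + q) / (r * x + p)) =
      a + c * x + r / (r * x + p) * (b - 2 * a * x - c * x ^ 2) := by
    field_simp
    linear_combination (r * (b - 2 * a * x - c * x ^ 2) + (a + c * x) * (r * x + p)) * hdet'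
  rw [e1, e2]
  ring

/-- The generator of the rotations, conjugated by an element of the group. -/
def adRot (d : ℕ) (g : SL2R) : Module.End ℂ (ISpace d) :=
  lieEnd d (g 1 0 * g 1 1 + g 0 0 * g 0 1) (g 1 1 ^ 2 + g 0 1 ^ 2) (-(g 1 0 ^ 2 + g 0 0 ^ 2))

theorem rotOp_rep (g : SL2R) (φ : ISpace d) : rotOp d (rep d g φ) = rep d g (adRot d g φ) := by
  rw [rotOp, lieEnd_rep, adRot]
  congr 2
  congr 1 <;> ring

/-- Angular derivatives of `π(g) φ` become values of `π(g)` on other vectors, so that continuity of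
the action in all derivatives reduces to uniform continuity without derivatives. -/
theorem rotOp_pow_rep (g : SL2R) (j : ℕ) (φ : ISpace d) :
    (rotOp d ^ j) (rep d g φ) = rep d g ((adRot d g ^ j) φ) := by
  induction j generalizing φ with
  | zero => rfl
  | succ j ih =>
    rw [pow_succ, pow_succ, Module.End.mul_apply, rotOp_rep, ih]
    rfl

theorem lieEnd_eq_sum (a b c : ℝ) (φ : ISpace d) : lieEnd d a b c φ =
    (a : ℂ) • lieEnd d 1 0 0 φ + (b : ℂ) • lieEnd d 0 1 0 φ + (c : ℂ) • lieEnd d 0 0 1 φ := by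
  refine ISpace.ext fun x => ?_
  simp only [ISpace.add_apply, ISpace.smul_apply, lieEnd_apply, lieOp]
  push_cast
  ring

theorem continuous_entry (i j : Fin 2) : Continuous fun g : SL2R => g i j :=
  (continuous_subtype_val : Continuous fun g : SL2R => g.1).matrix_elem i j

/-- The conjugated generator is a combination of three fixed continuous operators with coefficients
polynomial in `g`. -/
theorem continuous_adRot_pow (j : ℕ) :
    Continuous fun p : SL2R × ISpace d => (adRot d p.1 ^ j) p.2 := by
  induction j with
  | zero => exact continuous_snd
  | succ j ih =>
    simp only [pow_succ', Module.End.mul_apply]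
    have h : Continuous fun p : SL2R × ISpace d => adRot d p.1 p.2 := by
      unfold adRot
      simp only [lieEnd_eq_sum (d := d) (_ + _)]
      have h00 := (continuous_entry 0 0).comp (continuous_fst (X := SL2R) (Y := ISpace d))
      have h01 := (continuous_entry 0 1).comp (continuous_fst (X := SL2R) (Y := ISpace d))
      have h10 := (continuous_entry 1 0).comp (continuous_fst (X := SL2R) (Y := ISpace d))
      have h11 := (continuous_entry 1 1).comp (continuous_fst (X := SL2R) (Y := ISpace d))
      have hL : ∀ a b c, Continuous fun p : SL2R × ISpace d => lieEnd d a b c p.2 :=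
        fun a b c => (continuous_lieEnd a b c).comp continuous_snd
      have h1 := Complex.continuous_ofReal.comp ((h10.mul h11).add (h00.mul h01))
      have h2 := Complex.continuous_ofReal.comp ((h11.pow 2).add (h01.pow 2))
      have h3 := Complex.continuous_ofReal.comp ((h10.pow 2).add (h00.pow 2)).neg
      exact ((h1.smul (hL 1 0 0)).add (h2.smul (hL 0 1 0))).add (h3.smul (hL 0 0 1))
    exact h.comp (continuous_fst.prodMk ih)

theorem homog_eq_lift (φ : ISpace d) {u v : ℝ} (h : u ≠ 0 ∨ v ≠ 0) :
    homog d φ u v = (((√(u ^ 2 + v ^ 2) : ℝ) : ℂ) ^ (d + 1))⁻¹ *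
      lift d φ (Complex.arg ⟨u, v⟩ : ℝ) := by
  have hz : (⟨u, v⟩ : ℂ) ≠ 0 := by
    intro h0
    have h1 := congrArg Complex.re h0
    have h2 := congrArg Complex.im h0
    simp only [Complex.zero_re, Complex.zero_im] at h1 h2
    simp [h1, h2] at h
  have hn : ‖(⟨u, v⟩ : ℂ)‖ = √(u ^ 2 + v ^ 2) := by
    rw [Complex.norm_eq_sqrt_sq_add_sq]
  have hn0 : √(u ^ 2 + v ^ 2) ≠ 0 := by
    rw [← hn]
    simpa using hz
  rw [lift_coe, Complex.cos_arg hz, Complex.sin_arg, hn, ← homog_smul_smul φ hn0]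
  congr 1 <;> field_simp

theorem lift_rep (g : SL2R) (φ : ISpace d) (θ : ℝ) : lift d (rep d g φ) (θ : ℝ) =
    homog d φ (Real.cos θ * g 0 0 + Real.sin θ * g 1 0)
      (Real.cos θ * g 0 1 + Real.sin θ * g 1 1) :=
  homog_actFun g φ (cos_ne_zero_or_sin_ne_zero θ)

/-- In polar coordinates the value at an angle is jointly continuous in `g`, `φ` and the angle;
currying the angle turns this into continuity for the sup norm. -/
theorem continuous_lift_rep : Continuous fun p : SL2R × ISpace d => lift d (rep d p.1 p.2) := by
  refine ContinuousMap.continuous_of_continuous_uncurry _ ?_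
  let U : (SL2R × ISpace d) × AddCircle (2 * Real.pi) → ℝ := fun p =>
    Real.Angle.cos p.2 * p.1.1 0 0 + Real.Angle.sin p.2 * p.1.1 1 0
  let V : (SL2R × ISpace d) × AddCircle (2 * Real.pi) → ℝ := fun p =>
    Real.Angle.cos p.2 * p.1.1 0 1 + Real.Angle.sin p.2 * p.1.1 1 1
  have hcos : Continuous fun p : (SL2R × ISpace d) × AddCircle (2 * Real.pi) =>
    Real.Angle.cos p.2 := Real.Angle.continuous_cos.comp continuous_snd
  have hsin : Continuous fun p : (SL2R × ISpace d) × AddCircle (2 * Real.pi) =>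
    Real.Angle.sin p.2 := Real.Angle.continuous_sin.comp continuous_snd
  have hg : ∀ i j, Continuous fun p : (SL2R × ISpace d) × AddCircle (2 * Real.pi) =>
    p.1.1 i j := fun i j => (continuous_entry i j).comp (continuous_fst.comp continuous_fst)
  have hU : Continuous U := (hcos.mul (hg 0 0)).add (hsin.mul (hg 1 0))
  have hV : Continuous V := (hcos.mul (hg 0 1)).add (hsin.mul (hg 1 1))
  have hne : ∀ p, U p ≠ 0 ∨ V p ≠ 0 := by
    rintro ⟨⟨g, φ⟩, t⟩
    induction t using QuotientAddGroup.induction_on with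
    | H θ => exact row_mul_ne g (cos_ne_zero_or_sin_ne_zero θ)
  have hne' : ∀ p, (⟨U p, V p⟩ : ℂ) ≠ 0 := by
    intro p h0
    have h1 := congrArg Complex.re h0
    have h2 := congrArg Complex.im h0
    simp only [Complex.zero_re, Complex.zero_im] at h1 h2
    have := hne p
    simp [h1, h2] at this
  have hpos : ∀ p, 0 < U p ^ 2 + V p ^ 2 := by
    intro p
    rcases hne p with h | h <;> positivity
  have heq : (Function.uncurry fun (p : SL2R × ISpace d) (t : AddCircle (2 * Real.pi)) =>
      lift d (rep d p.1 p.2) t) = fun p => (((√(U p ^ 2 + V p ^ 2) : ℝ) : ℂ) ^ (d + 1))⁻¹ *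
      lift d p.1.2 (Complex.arg ⟨U p, V p⟩ : ℝ) := by
    funext p
    rw [← homog_eq_lift p.1.2 (hne p)]
    obtain ⟨⟨g, φ⟩, t⟩ := p
    induction t using QuotientAddGroup.induction_on with
    | H θ => exact lift_rep g φ θ
  have harg : Continuous fun p => ((Complex.arg ⟨U p, V p⟩ : ℝ) : AddCircle (2 * Real.pi)) := by
    have hz : Continuous fun p => (⟨U p, V p⟩ : ℂ) := by
      have : (fun p => (⟨U p, V p⟩ : ℂ)) = fun p => (U p : ℂ) + V p * Complex.I := by
        funext p
        exact Complex.mk_eq_add_mul_I _ _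
      rw [this]
      fun_prop
    -- The argument jumps on the negative axis, but it is continuous modulo `2π`.
    exact continuous_iff_continuousAt.2 fun p => ContinuousAt.comp'
      (f := fun p => (⟨U p, V p⟩ : ℂ)) (Complex.continuousAt_arg_coe_angle (hne' p)) hz.continuousAt
  rw [heq]
  refine Continuous.mul (Continuous.inv₀ (by fun_prop) fun p => pow_ne_zero _ ?_) ?_
  · have := (Real.sqrt_pos.2 (hpos p)).ne'
    exact_mod_cast this
  · have hl : Continuous fun p : (SL2R × ISpace d) × AddCircle (2 * Real.pi) => lift d p.1.2 :=
      continuous_lift.comp (continuous_snd.comp continuous_fst)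
    exact (continuous_eval (F := C(AddCircle (2 * Real.pi), ℂ))).comp (hl.prodMk harg)

theorem continuous_rep : Continuous fun p : SL2R × ISpace d => rep d p.1 p.2 := by
  refine isInducing_jet.continuous_iff.2 (continuous_pi fun j => ?_)
  simp only [Function.comp_apply, jet_apply, rotOp_pow_rep]
  have h : Continuous fun p : SL2R × ISpace d => (p.1, (adRot d p.1 ^ j) p.2) :=
    continuous_fst.prodMk (continuous_adRot_pow j)
  have h2 := continuous_lift_rep.comp h
  exact h2

/-! ### Fourier coefficients on the circle -/

theorem fourier_coe_two_pi (n : ℤ) (θ : ℝ) :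
    fourier n (θ : AddCircle (2 * Real.pi)) = Complex.exp (n * θ * Complex.I) := by
  rw [fourier_coe_apply]
  congr 1
  have : (Real.pi : ℂ) ≠ 0 := by exact_mod_cast Real.pi_ne_zero
  push_cast
  field_simp

theorem zpow_neg_one_mul (k : ℤ) : ((-1 : ℂ) ^ ((d : ℤ) + 1 + 2 * k)) = (-1) ^ (d + 1) := by
  rw [zpow_add₀ (by norm_num), zpow_mul]
  norm_num
  norm_cast

theorem exp_int_mul_add_pi (n : ℤ) (θ : ℝ) : Complex.exp (n * ((θ + Real.pi : ℝ) : ℂ) * Complex.I) =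
    (-1) ^ n * Complex.exp (n * θ * Complex.I) := by
  rw [show (n * ((θ + Real.pi : ℝ) : ℂ) * Complex.I) = n * (Real.pi * Complex.I) +
    n * θ * Complex.I by push_cast; ring, Complex.exp_add, Complex.exp_int_mul, Complex.exp_pi_mul_I]

/-- The vectors of `I_d` on which the rotation group acts by a character. -/
def kType (d : ℕ) (k : ℤ) : ISpace d :=
  ofCircle (A := fun θ : ℝ => Complex.exp (((d + 1 + 2 * k : ℤ) : ℂ) * θ * Complex.I))
    (Complex.contDiff_exp.comp ((contDiff_const.mul Complex.ofRealCLM.contDiff).mul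
      contDiff_const)) fun θ => by rw [exp_int_mul_add_pi, zpow_neg_one_mul]

theorem lift_kType (k : ℤ) : lift d (kType d k) = fourier (d + 1 + 2 * k) :=
  lift_ext fun θ => (lift_ofCircle _ _ θ).trans (fourier_coe_two_pi _ θ).symm

theorem rotOp_kType (k : ℤ) :
    rotOp d (kType d k) = (((d + 1 + 2 * k : ℤ) : ℂ) * Complex.I) • kType d k := by
  refine lift_injective (lift_ext fun θ => ?_)
  have h := hasDerivAt_lift (kType d k) θ
  simp only [lift_kType, fourier_coe_two_pi] at h
  rw [map_smul, ContinuousMap.smul_apply, lift_kType, fourier_coe_two_pi, smul_eq_mul]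
  refine h.unique ?_
  have h1 := ((((hasDerivAt_ofReal_comp θ).const_mul ((d + 1 + 2 * k : ℤ) : ℂ))).mul_const
    Complex.I).cexp
  exact h1.congr_deriv (by ring)

theorem rotOp_pow_kType (k : ℤ) (j : ℕ) :
    (rotOp d ^ j) (kType d k) = (((d + 1 + 2 * k : ℤ) : ℂ) * Complex.I) ^ j • kType d k := by
  induction j with
  | zero => simp
  | succ j ih => rw [pow_succ', Module.End.mul_apply, ih, map_smul, rotOp_kType, smul_smul, pow_succ]

/-- The Fourier coefficients on the unit circle. -/
def coeff (φ : ISpace d) (n : ℤ) : ℂ := fourierCoeff (lift d φ) n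

theorem coeff_eq_integral (φ : ISpace d) (n : ℤ) (a : ℝ) : coeff φ n =
    (2 * Real.pi : ℂ)⁻¹ * ∫ θ in a..(a + 2 * Real.pi),
      Complex.exp (-(n * θ * Complex.I)) * lift d φ (θ : ℝ) := by
  rw [coeff, fourierCoeff_eq_intervalIntegral _ _ a]
  simp only [fourier_coe_two_pi, smul_eq_mul, Complex.real_smul]
  push_cast
  rw [one_div]
  congr 2
  funext θ
  congr 2
  ring

theorem coeff_add (φ φ' : ISpace d) (n : ℤ) : coeff (φ + φ') n = coeff φ n + coeff φ' n := by
  simp only [coeff, map_add]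
  exact congrFun (fourierCoeff.add ((lift d φ).continuous.integrable_of_hasCompactSupport
    (HasCompactSupport.of_compactSpace _)) ((lift d φ').continuous.integrable_of_hasCompactSupport
    (HasCompactSupport.of_compactSpace _))) n

theorem norm_fourierCoeff_le (f : C(AddCircle (2 * Real.pi), ℂ)) (n : ℤ) :
    ‖fourierCoeff f n‖ ≤ ‖f‖ := by
  refine (norm_integral_le_of_norm_le_const (C := ‖f‖) (.of_forall fun t => ?_)).trans (by simp)
  rw [norm_smul]
  refine (mul_le_of_le_one_left (norm_nonneg _) ?_).trans (f.norm_coe_le_norm t)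
  rw [fourier_apply]
  exact (Circle.norm_coe _).le

/-- The Fourier coefficient as a continuous linear functional. -/
def fourierCoeffCLM (n : ℤ) : C(AddCircle (2 * Real.pi), ℂ) →L[ℂ] ℂ :=
  LinearMap.mkContinuous
    { toFun := fun f => fourierCoeff f n
      map_add' := fun f g => congrFun (fourierCoeff.add (f.continuous.integrable_of_hasCompactSupport
        (HasCompactSupport.of_compactSpace _)) (g.continuous.integrable_of_hasCompactSupport
        (HasCompactSupport.of_compactSpace _))) n
      map_smul' := fun c f => fourierCoeff.const_smul f c n } 1 fun f => by
    rw [one_mul]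
    exact norm_fourierCoeff_le f n

theorem continuous_coeff (n : ℤ) : Continuous fun φ : ISpace d => coeff φ n :=
  (fourierCoeffCLM n).continuous.comp continuous_lift

theorem integral_deriv_period {F F' : ℝ → ℂ} (hF : ∀ θ, HasDerivAt F (F' θ) θ)
    (hF' : Continuous F') (hp : Function.Periodic F (2 * Real.pi)) :
    ∫ θ in (0 : ℝ)..(0 + 2 * Real.pi), F' θ = 0 := by
  rw [intervalIntegral.integral_eq_sub_of_hasDerivAt (fun θ _ => hF θ)
    (hF'.intervalIntegrable _ _), hp, sub_self]

theorem periodic_exp_mul_lift (φ : ISpace d) (n : ℤ) : Function.Periodic (fun θ : ℝ =>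
    Complex.exp (-(n * θ * Complex.I)) * lift d φ (θ : ℝ)) (2 * Real.pi) := by
  have h : (fun θ : ℝ => Complex.exp (-(n * θ * Complex.I)) * lift d φ (θ : ℝ)) =
      fun θ : ℝ => (fourier (-n) (θ : AddCircle (2 * Real.pi)) : ℂ) * lift d φ (θ : ℝ) := by
    funext θ
    rw [fourier_coe_two_pi]
    congr 2
    push_cast
    ring
  rw [h]
  intro θ
  simp only [AddCircle.coe_add_period]

theorem coeff_rotOp (φ : ISpace d) (n : ℤ) :
    coeff (rotOp d φ) n = n * Complex.I * coeff φ n := by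
  have hd : ∀ θ : ℝ, HasDerivAt (fun θ : ℝ => Complex.exp (-(n * θ * Complex.I)) *
      lift d φ (θ : ℝ)) (Complex.exp (-(n * θ * Complex.I)) * lift d (rotOp d φ) (θ : ℝ) -
        n * Complex.I * (Complex.exp (-(n * θ * Complex.I)) * lift d φ (θ : ℝ))) θ := by
    intro θ
    have h1 := ((((hasDerivAt_ofReal_comp θ).const_mul (n : ℂ))).mul_const Complex.I).fun_neg.cexp
    exact (h1.fun_mul (hasDerivAt_lift φ θ)).congr_deriv (by ring)
  have hc := continuous_lift_coe φ
  have hc' := continuous_lift_coe (rotOp d φ)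
  have h := integral_deriv_period hd (by fun_prop) (periodic_exp_mul_lift φ n)
  rw [intervalIntegral.integral_sub (Continuous.intervalIntegrable (by fun_prop) _ _)
    (Continuous.intervalIntegrable (by fun_prop) _ _), intervalIntegral.integral_const_mul] at h
  rw [coeff_eq_integral _ _ 0, coeff_eq_integral _ _ 0, sub_eq_zero.1 h]
  ring

theorem coeff_rotOp_pow (φ : ISpace d) (n : ℤ) (j : ℕ) :
    coeff ((rotOp d ^ j) φ) n = (n * Complex.I) ^ j * coeff φ n := by
  induction j with
  | zero => simp
  | succ j ih => rw [pow_succ', Module.End.mul_apply, coeff_rotOp, ih]; ring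

theorem coeff_shift (φ : ISpace d) (n : ℤ) (α : ℝ) :
    (2 * Real.pi : ℂ)⁻¹ * ∫ θ in (0 : ℝ)..(0 + 2 * Real.pi),
      Complex.exp (-(n * θ * Complex.I)) * lift d φ ((θ + α : ℝ) : AddCircle (2 * Real.pi)) =
    Complex.exp (n * α * Complex.I) * coeff φ n := by
  have h1 : ∀ θ : ℝ, Complex.exp (-(n * θ * Complex.I)) *
      lift d φ ((θ + α : ℝ) : AddCircle (2 * Real.pi)) = Complex.exp (n * α * Complex.I) *
      (Complex.exp (-(n * (θ + α : ℝ) * Complex.I)) *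
        lift d φ ((θ + α : ℝ) : AddCircle (2 * Real.pi))) := by
    intro θ
    rw [← mul_assoc, ← Complex.exp_add]
    congr 2
    push_cast
    ring
  simp only [h1]
  rw [intervalIntegral.integral_const_mul, coeff_eq_integral _ _ (0 + α),
    intervalIntegral.integral_comp_add_right (fun θ : ℝ => Complex.exp (-(n * θ * Complex.I)) *
        lift d φ (θ : AddCircle (2 * Real.pi))) α]
  rw [show 0 + α + 2 * Real.pi = 0 + 2 * Real.pi + α by ring]
  ring

/-- Translation by `π` multiplies the function by `(-1)^(d+1)` and its `n`-th coefficient by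
`(-1)^n`. -/
theorem coeff_eq_zero_of_parity (φ : ISpace d) {n : ℤ} (hn : ∀ k : ℤ, n ≠ d + 1 + 2 * k) :
    coeff φ n = 0 := by
  have h := coeff_shift φ n Real.pi
  simp only [lift_add_pi, mul_left_comm _ ((-1 : ℂ) ^ (d + 1))] at h
  rw [intervalIntegral.integral_const_mul, mul_left_comm, ← coeff_eq_integral φ n 0,
    mul_assoc, Complex.exp_int_mul, Complex.exp_pi_mul_I] at h
  have hodd : Odd (n + (d + 1)) := by
    rw [← Int.not_even_iff_odd]
    rintro ⟨m, hm⟩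
    exact hn (m - (d + 1)) (by linarith)
  have h2 : (-1 : ℂ) ^ n * (-1) ^ (d + 1) = -1 := by
    have := hodd.neg_one_zpow (α := ℂ)
    rw [zpow_add₀ (by norm_num)] at this
    exact_mod_cast this
  have h3 : (-1 : ℂ) ^ (d + 1) * (-1) ^ (d + 1) = 1 := by
    rw [← mul_pow]; norm_num
  have h4 : coeff φ n = -coeff φ n := by
    linear_combination (-1 : ℂ) ^ (d + 1) * h + coeff φ n * h2 - coeff φ n * h3
  exact self_eq_neg.1 h4

theorem summable_coeff (φ : ISpace d) : Summable (coeff φ) := by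
  have h1 : Summable fun n : ℤ => ‖lift d ((rotOp d ^ 2) φ)‖ * (1 / (n : ℝ) ^ 2) :=
    (Real.summable_one_div_int_pow.2 (by norm_num)).mul_left _
  refine Summable.of_norm_bounded_eventually h1 ?_
  filter_upwards [(Set.finite_singleton (0 : ℤ)).compl_mem_cofinite] with n hn
  have hn' : (n : ℝ) ≠ 0 := by exact_mod_cast hn
  have h2 := norm_fourierCoeff_le (lift d ((rotOp d ^ 2) φ)) n
  change ‖coeff _ n‖ ≤ _ at h2
  rw [coeff_rotOp_pow, norm_mul, norm_pow, norm_mul, Complex.norm_I, mul_one,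
    Complex.norm_intCast, sq_abs] at h2
  rw [mul_one_div, le_div_iff₀ (by positivity)]
  linarith

theorem hasSum_of_eq {α β : Type*} [AddCommMonoid α] [TopologicalSpace α] {f g : β → α} {a : α}
    (h : HasSum f a) (e : ∀ k, g k = f k) : HasSum g a := (funext e : g = f) ▸ h

theorem injective_weight (d : ℕ) : Function.Injective fun k : ℤ => (d + 1 + 2 * k : ℤ) := by
  intro a b h
  simpa using h

theorem hasSum_lift (φ : ISpace d) :
    HasSum (fun k : ℤ => coeff φ (d + 1 + 2 * k) • lift d (kType d k)) (lift d φ) := by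
  simp only [lift_kType]
  refine ((injective_weight d).hasSum_iff (f := fun n : ℤ => coeff φ n • (fourier n :
    C(AddCircle (2 * Real.pi), ℂ))) fun n hn => ?_).2
    (hasSum_fourier_series_of_summable (summable_coeff φ))
  rw [coeff_eq_zero_of_parity φ, zero_smul]
  exact fun k hk => hn ⟨k, hk.symm⟩

/-- The Fourier series of each angular derivative converges uniformly, and it is the termwise
derivative of the series of `φ`. Hence the expansion converges in the topology of `I_d`, so that
continuous functionals may be applied term by term. -/
theorem hasSum_kType (φ : ISpace d) :
    HasSum (fun k : ℤ => coeff φ (d + 1 + 2 * k) • kType d k) φ := by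
  have h : HasSum (fun k : ℤ => jet d (coeff φ (d + 1 + 2 * k) • kType d k)) (jet d φ) := by
    refine Pi.hasSum.2 fun j => ?_
    have h1 := hasSum_lift ((rotOp d ^ j) φ)
    refine hasSum_of_eq h1 ?_
    intro k
    rw [jet_apply, map_smul, rotOp_pow_kType, coeff_rotOp_pow, map_smul, map_smul, smul_smul]
    congr 1
    push_cast
    ring
  refine (isInducing_jet.tendsto_nhds_iff).2 (h.congr fun s => ?_)
  exact (map_sum (jet d) _ s).symm

/-- Rotations. -/
def rot (α : ℝ) : SL2R :=
  ⟨!![Real.cos α, Real.sin α; -Real.sin α, Real.cos α], by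
    rw [Matrix.det_fin_two_of]
    linear_combination Real.cos_sq_add_sin_sq α⟩

theorem lift_rep_rot (α : ℝ) (φ : ISpace d) (θ : ℝ) :
    lift d (rep d (rot α) φ) (θ : ℝ) = lift d φ ((θ + α : ℝ) : AddCircle (2 * Real.pi)) := by
  rw [lift_rep, lift_coe, Real.cos_add, Real.sin_add]
  congr 1 <;> simp [rot] <;> ring

theorem coeff_rep_rot (α : ℝ) (φ : ISpace d) (n : ℤ) :
    coeff (rep d (rot α) φ) n = Complex.exp (n * α * Complex.I) * coeff φ n := by
  rw [← coeff_shift, coeff_eq_integral _ _ 0]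
  simp only [lift_rep_rot]

theorem eq_zero_of_hasSum_fourier {c : ℤ → ℂ}
    (h : ∀ θ : ℝ, HasSum (fun k : ℤ => c k * Complex.exp (((d + 1 + 2 * k : ℤ) : ℂ) * θ * Complex.I)) 0)
    (k : ℤ) : c k = 0 := by
  -- At `θ = 0` the exponentials are `1`, so the hypothesis already gives summability of the
  -- coefficients, hence uniform convergence of the series.
  have hs : Summable c := by simpa using (h 0).summable
  have hs' : Summable fun k : ℤ => c k • (fourier (d + 1 + 2 * k) :
      C(AddCircle (2 * Real.pi), ℂ)) := by
    refine Summable.of_norm ?_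
    simpa only [norm_smul, fourier_norm, mul_one] using hs.norm
  obtain ⟨f, hf⟩ := hs'
  have hf0 : f = 0 := by
    refine lift_ext fun θ => ?_
    have h1 := (ContinuousMap.evalCLM ℂ (θ : AddCircle (2 * Real.pi))).hasSum hf
    refine h1.unique ?_
    refine hasSum_of_eq (h θ) fun k => ?_
    rw [← fourier_coe_two_pi]
    rfl
  rw [hf0] at hf
  have h2 := (fourierCoeffCLM (d + 1 + 2 * k)).hasSum hf
  rw [map_zero] at h2
  have h3 : HasSum (fun l : ℤ => if l = k then c k else 0) (c k) := hasSum_ite_eq k (c k)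
  refine h3.unique (hasSum_of_eq h2 fun l => ?_)
  rw [map_smul, smul_eq_mul]
  change _ = _ * fourierCoeff (fourier (d + 1 + 2 * l) : C(AddCircle (2 * Real.pi), ℂ)) _
  rw [fourierCoeff_fourier, Pi.single_apply]
  by_cases hl : l = k
  · simp [hl]
  · rw [if_neg hl, if_neg, mul_zero]
    exact fun h => hl ((injective_weight d h).symm)

/-! ### Invariant subspaces -/

/-- The function `θ ↦ l (π(rot θ) φ)` vanishes identically, and the products are its Fourier
coefficients. This takes the place of projecting onto weight spaces by integrals with values in
`I_d`. -/
theorem coeff_mul_eq_zero {W : Submodule ℂ (ISpace d)} (hW : ∀ α, ∀ φ ∈ W, rep d (rot α) φ ∈ W)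
    (l : ISpace d →L[ℂ] ℂ) (hl : ∀ φ ∈ W, l φ = 0) {φ : ISpace d} (hφ : φ ∈ W) (k : ℤ) :
    coeff φ (d + 1 + 2 * k) * l (kType d k) = 0 := by
  refine eq_zero_of_hasSum_fourier (d := d) (c := fun k => coeff φ (d + 1 + 2 * k) * l (kType d k))
    (fun θ => ?_) k
  have h := l.hasSum (hasSum_kType (rep d (rot θ) φ))
  rw [hl _ (hW θ φ hφ)] at h
  refine hasSum_of_eq h fun k => ?_
  rw [map_smul, coeff_rep_rot, smul_eq_mul]
  ring

theorem le_of_forall_functional {W U : Submodule ℂ (ISpace d)} (hW : IsClosed (W : Set (ISpace d)))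
    (h : ∀ l : ISpace d →L[ℂ] ℂ, (∀ φ ∈ W, l φ = 0) → ∀ φ ∈ U, l φ = 0) : U ≤ W := by
  intro φ hφ
  by_contra hφW
  have hconv : Convex ℝ (W : Set (ISpace d)) := (W.restrictScalars ℝ).convex
  obtain ⟨f, u, hf, hu⟩ := RCLike.geometric_hahn_banach_closed_point (𝕜 := ℂ) hconv hW hφW
  have h0 : 0 < u := by simpa using hf 0 W.zero_mem
  have hz : ∀ a ∈ W, f a = 0 := by
    intro a ha
    by_contra hne
    -- The multiple of `a` on which `f` takes the value `u`, contradicting the strict bound `re f <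
    -- u` on the subspace.
    have := hf ((u / f a : ℂ) • a) (W.smul_mem _ ha)
    rw [map_smul, smul_eq_mul, div_mul_cancel₀ _ hne] at this
    simp at this
  have := h f hz φ hφ
  rw [this] at hu
  simp at hu
  linarith

/-! ### The Fourier transform -/

/-- The Fourier transform `y ↦ ∫ f(x) e ^ (-i x y) dx`. -/
def hat (f : ℝ → ℂ) (y : ℝ) : ℂ := ∫ x : ℝ, Complex.exp (-(x * y * Complex.I)) * f x

theorem norm_exp_neg_mul_I (x y : ℝ) : ‖Complex.exp (-(x * y * Complex.I))‖ = 1 := by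
  rw [show -(x * y * Complex.I) = ((-(x * y) : ℝ) : ℂ) * Complex.I by push_cast; ring]
  exact Complex.norm_exp_ofReal_mul_I _

open FourierTransform in
theorem hat_eq (f : ℝ → ℂ) (y : ℝ) : hat f y = 𝓕 f (y / (2 * Real.pi)) := by
  rw [Real.fourier_real_eq_integral_exp_smul, hat]
  refine integral_congr_ae (.of_forall fun x => ?_)
  dsimp only
  rw [smul_eq_mul]
  congr 2
  have : (Real.pi : ℂ) ≠ 0 := by exact_mod_cast Real.pi_ne_zero
  push_cast
  field_simp

open FourierTransform in
theorem fourier_eq_hat (f : ℝ → ℂ) (y : ℝ) : 𝓕 f y = hat f (2 * Real.pi * y) := by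
  rw [hat_eq, mul_div_cancel_left₀ _ Real.two_pi_pos.ne']

theorem integrable_exp_mul {f : ℝ → ℂ} (hf : Integrable f) (y : ℝ) :
    Integrable fun x : ℝ => Complex.exp (-(x * y * Complex.I)) * f x :=
  hf.bdd_mul (Continuous.aestronglyMeasurable (by fun_prop))
    (.of_forall fun x => (norm_exp_neg_mul_I x y).le)

theorem continuous_hat {f : ℝ → ℂ} (hf : Integrable f) : Continuous (hat f) := by
  refine continuous_of_dominated (bound := fun x => ‖f x‖)
    (fun y => (integrable_exp_mul hf y).aestronglyMeasurable)
    (fun y => .of_forall fun x => ?_) hf.norm (.of_forall fun x => by fun_prop)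
  rw [norm_mul, norm_exp_neg_mul_I, one_mul]

theorem norm_hat_le (f : ℝ → ℂ) (y : ℝ) : ‖hat f y‖ ≤ ∫ x : ℝ, ‖f x‖ := by
  refine (norm_integral_le_integral_norm _).trans (le_of_eq ?_)
  simp only [norm_mul, norm_exp_neg_mul_I, one_mul]

theorem hat_add {f g : ℝ → ℂ} (hf : Integrable f) (hg : Integrable g) (y : ℝ) :
    hat (fun x => f x + g x) y = hat f y + hat g y := by
  rw [hat, hat, hat, ← integral_add (integrable_exp_mul hf y) (integrable_exp_mul hg y)]
  congr 1
  funext x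
  ring

theorem hat_const_mul (c : ℂ) (f : ℝ → ℂ) (y : ℝ) : hat (fun x => c * f x) y = c * hat f y := by
  rw [hat, hat, ← integral_const_mul]
  congr 1
  funext x
  ring

theorem hasDerivAt_hat {f : ℝ → ℂ} (hf : Integrable f) (hf' : Integrable fun x : ℝ => (x : ℂ) * f x)
    (y : ℝ) : HasDerivAt (hat f) (hat (fun x => -Complex.I * (x * f x)) y) y := by
  have h1 := (Real.hasDerivAt_fourier hf (by simpa only [Complex.real_smul] using hf')
    (y / (2 * Real.pi))).scomp y ((hasDerivAt_id y).div_const (2 * Real.pi))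
  have h2 : hat f = fun y => _ := funext (hat_eq f)
  rw [h2]
  refine h1.congr_deriv ?_
  rw [← hat_eq, Complex.real_smul, ← hat_const_mul]
  congr 1
  funext x
  have : (Real.pi : ℂ) ≠ 0 := by exact_mod_cast Real.pi_ne_zero
  rw [smul_eq_mul]
  push_cast
  field_simp

theorem hat_deriv {f : ℝ → ℂ} (hf : Integrable f) (hd : Differentiable ℝ f)
    (hf' : Integrable (deriv f)) (y : ℝ) : hat (deriv f) y = Complex.I * y * hat f y := by
  rw [hat_eq, Real.fourier_deriv hf hd hf', hat_eq]
  dsimp only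
  rw [smul_eq_mul]
  congr 1
  have : (Real.pi : ℂ) ≠ 0 := by exact_mod_cast Real.pi_ne_zero
  push_cast
  field_simp

open FourierTransform in
theorem hat_hat {f : ℝ → ℂ} (hc : Continuous f) (hf : Integrable f) (hf' : Integrable (hat f))
    (x : ℝ) : hat (hat f) (-x) = 2 * Real.pi * f x := by
  have hF : 𝓕 f = fun y => hat f (2 * Real.pi * y) := funext (fourier_eq_hat f)
  have hpi : (0 : ℝ) < 2 * Real.pi := Real.two_pi_pos
  have h1 : Integrable (𝓕 f) := by
    rw [hF]
    exact hf'.comp_mul_left' hpi.ne'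
  have h2 := congrFun (hc.fourierInv_fourier_eq hf h1) x
  rw [Real.fourierInv_eq_fourier_neg, fourier_eq_hat, hF, hat] at h2
  have h3 := Measure.integral_comp_mul_left
    (fun y : ℝ => Complex.exp (-(y * (-x : ℝ) * Complex.I)) * hat f y) (2 * Real.pi)
  rw [abs_of_pos (inv_pos.2 hpi)] at h3
  rw [← h2, hat]
  have h4 : ∀ y : ℝ, Complex.exp (-(y * ((2 * Real.pi * -x : ℝ) : ℂ) * Complex.I)) *
      hat f (2 * Real.pi * y) = Complex.exp (-(((2 * Real.pi * y : ℝ) : ℂ) * (-x : ℝ) * Complex.I)) *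
      hat f (2 * Real.pi * y) := by
    intro y
    congr 2
    push_cast
    ring
  simp only [h4]
  rw [h3, Complex.real_smul]
  generalize (∫ y : ℝ, Complex.exp (-(y * (-x : ℝ) * Complex.I)) * hat f y) = J
  have : (Real.pi : ℂ) ≠ 0 := by exact_mod_cast Real.pi_ne_zero
  push_cast
  field_simp

theorem hat_comp_neg (f : ℝ → ℂ) (y : ℝ) : hat (fun x => f (-x)) y = hat f (-y) := by
  rw [hat, hat, ← integral_neg_eq_self]
  congr 1
  funext x
  simp

/-- Fourier inversion, for a function given as an inverse transform. -/
theorem hat_of_eq_hat_neg {φ h : ℝ → ℂ} (hc : Continuous h) (hh : Integrable h)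
    (hφ : Integrable φ) (e : ∀ x, φ x = hat h (-x)) (y : ℝ) : hat φ y = 2 * Real.pi * h y := by
  have e' : φ = fun x => hat h (-x) := funext e
  have h1 : Integrable (hat h) := by
    have := hφ.comp_neg
    rw [e'] at this
    simpa using this
  rw [e', hat_comp_neg, hat_hat hc hh h1]

/-! ### Laplace integrals -/

theorem integrableOn_pow_mul_exp_neg (n : ℕ) :
    IntegrableOn (fun t : ℝ => t ^ n * Real.exp (-t)) (Set.Ioi 0) := by
  have := Real.GammaIntegral_convergent (s := n + 1) (by positivity)
  refine this.congr_fun (fun t _ => ?_) measurableSet_Ioi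
  simp [mul_comm]

theorem norm_pow_mul_exp {a : ℂ} (ha : a.re = 1) (n : ℕ) {t : ℝ} (ht : 0 ≤ t) :
    ‖(t : ℂ) ^ n * Complex.exp (-(a * t))‖ = t ^ n * Real.exp (-t) := by
  rw [norm_mul, norm_pow, Complex.norm_real, Complex.norm_exp, Real.norm_of_nonneg ht]
  simp [ha]

theorem integrableOn_cpow_mul_exp {a : ℂ} (ha : a.re = 1) (n : ℕ) :
    IntegrableOn (fun t : ℝ => (t : ℂ) ^ n * Complex.exp (-(a * t))) (Set.Ioi 0) := by
  refine Integrable.mono' (integrableOn_pow_mul_exp_neg n)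
    (Continuous.aestronglyMeasurable (by fun_prop)) ?_
  filter_upwards [ae_restrict_mem measurableSet_Ioi] with t ht
  exact (norm_pow_mul_exp ha n (le_of_lt ht)).le

theorem tendsto_pow_mul_cexp {a : ℂ} (ha : a.re = 1) (n : ℕ) : Filter.Tendsto
    (fun t : ℝ => (t : ℂ) ^ n * Complex.exp (-(a * t))) Filter.atTop (𝓝 0) := by
  rw [tendsto_zero_iff_norm_tendsto_zero]
  refine (Real.tendsto_pow_mul_exp_neg_atTop_nhds_zero n).congr' ?_
  filter_upwards [Filter.eventually_ge_atTop 0] with t ht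
  exact (norm_pow_mul_exp ha n ht).symm

theorem hasDerivAt_cexp_neg_mul (a : ℂ) (t : ℝ) :
    HasDerivAt (fun t : ℝ => Complex.exp (-(a * t))) (-a * Complex.exp (-(a * t))) t :=
  (((hasDerivAt_ofReal_comp t).const_mul a).fun_neg.cexp).congr_deriv (by ring)

theorem integral_pow_mul_cexp {a : ℂ} (ha : a.re = 1) (n : ℕ) :
    ∫ t in Set.Ioi (0 : ℝ), (t : ℂ) ^ n * Complex.exp (-(a * t)) = n.factorial * (a ^ (n + 1))⁻¹ := by
  have ha0 : a ≠ 0 := by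
    rintro rfl
    simp at ha
  induction n with
  | zero =>
    have h := integral_Ioi_of_hasDerivAt_of_tendsto' (a := (0 : ℝ)) (m := 0)
      (fun t _ => hasDerivAt_cexp_neg_mul a t)
      (by
        have h := (integrableOn_cpow_mul_exp ha 0).const_mul (-a)
        simp only [pow_zero, one_mul] at h
        exact h)
      (by simpa using tendsto_pow_mul_cexp ha 0)
    rw [integral_const_mul] at h
    simp only [pow_zero, one_mul, Nat.factorial_zero, Nat.cast_one, zero_add, pow_one]
    simp only [Complex.ofReal_zero, mul_zero, neg_zero, Complex.exp_zero, zero_sub, neg_mul,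
      neg_inj] at h
    exact eq_inv_of_mul_eq_one_right h
  | succ n ih =>
    have hd : ∀ t ∈ Set.Ici (0 : ℝ), HasDerivAt
        (fun t : ℝ => (t : ℂ) ^ (n + 1) * Complex.exp (-(a * t)))
        ((n + 1) * ((t : ℂ) ^ n * Complex.exp (-(a * t))) -
          a * ((t : ℂ) ^ (n + 1) * Complex.exp (-(a * t)))) t := by
      intro t _
      refine (((hasDerivAt_ofReal_comp t).fun_pow (n + 1)).fun_mul
        (hasDerivAt_cexp_neg_mul a t)).congr_deriv ?_
      push_cast
      simp
      ring
    have i1 := (integrableOn_cpow_mul_exp ha n).const_mul ((n : ℂ) + 1)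
    have i2 := (integrableOn_cpow_mul_exp ha (n + 1)).const_mul a
    have h := integral_Ioi_of_hasDerivAt_of_tendsto' hd (i1.sub i2) (tendsto_pow_mul_cexp ha (n + 1))
    rw [integral_sub i1 i2, integral_const_mul, integral_const_mul, ih] at h
    simp only [Complex.ofReal_zero, ne_eq, Nat.add_eq_zero_iff, one_ne_zero, and_false,
      not_false_eq_true, zero_pow, zero_mul, sub_zero] at h
    rw [Nat.factorial_succ]
    push_cast
    rw [pow_succ a (n + 1), mul_inv]
    rw [sub_eq_zero] at h
    field_simp at h ⊢
    linear_combination -h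

/-- Pairing an integrable function with a negative power of `1 + i ε x`, where `ε = ±1`. -/
theorem integral_mul_inv_pow {f : ℝ → ℂ} (hf : Integrable f) (ε : ℝ) (n : ℕ) :
    ∫ x : ℝ, f x * ((1 + Complex.I * (ε * x)) ^ (n + 1))⁻¹ = (n.factorial : ℂ)⁻¹ *
      ∫ t in Set.Ioi (0 : ℝ), (t : ℂ) ^ n * Complex.exp (-t) * hat f (ε * t) := by
  have hn : (n.factorial : ℂ) ≠ 0 := by exact_mod_cast n.factorial_ne_zero
  have hre : ∀ x : ℝ, (1 + Complex.I * (ε * x) : ℂ).re = 1 := by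
    intro x
    simp [← Complex.ofReal_mul]
  have h1 : ∀ x : ℝ, f x * ((1 + Complex.I * (ε * x)) ^ (n + 1))⁻¹ = (n.factorial : ℂ)⁻¹ *
      ∫ t in Set.Ioi (0 : ℝ), f x *
        ((t : ℂ) ^ n * Complex.exp (-((1 + Complex.I * (ε * x)) * t))) := by
    intro x
    rw [integral_const_mul, integral_pow_mul_cexp (hre x)]
    field_simp
  simp only [h1]
  rw [integral_const_mul, integral_integral_swap]
  · congr 1
    refine integral_congr_ae (.of_forall fun t => ?_)
    dsimp only
    rw [hat, ← integral_const_mul]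
    congr 1
    funext x
    rw [show -((1 + Complex.I * (ε * x)) * t) = -(t : ℂ) + -(x * ((ε * t : ℝ) : ℂ) * Complex.I) by
      push_cast; ring, Complex.exp_add]
    ring
  · have h2 := hf.norm.mul_prod (integrableOn_pow_mul_exp_neg n)
    refine h2.mono' (AEStronglyMeasurable.mul (hf.aestronglyMeasurable.comp_fst)
      (Continuous.aestronglyMeasurable (by fun_prop))) ?_
    have h3 : ∀ᵐ p : ℝ × ℝ ∂(volume.prod (volume.restrict (Set.Ioi (0 : ℝ)))), 0 < p.2 :=
      Measure.quasiMeasurePreserving_snd.ae (ae_restrict_mem measurableSet_Ioi)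
    filter_upwards [h3] with p hp
    rw [Function.uncurry_def]
    dsimp only
    rw [norm_mul, norm_pow_mul_exp (hre _) n hp.le]

theorem continuous_pow_mul_exp_indicator {n : ℕ} (hn : n ≠ 0) :
    Continuous ((Set.Ioi (0 : ℝ)).indicator fun t : ℝ => (t : ℂ) ^ n * Complex.exp (-t)) := by
  refine Continuous.indicator ?_ (by fun_prop)
  intro t ht
  rw [frontier_Ioi, Set.mem_singleton_iff] at ht
  simp [ht, hn]

theorem norm_one_sub_I_mul_sq (x : ℝ) : ‖(1 - Complex.I * x : ℂ)‖ ^ 2 = 1 + x ^ 2 := by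
  rw [Complex.sq_norm, Complex.normSq_apply]
  simp
  ring

theorem integrable_inv_one_sub_pow {n : ℕ} (hn : n ≠ 0) :
    Integrable fun x : ℝ => ((1 - Complex.I * x : ℂ) ^ (n + 1))⁻¹ := by
  have hne : ∀ x : ℝ, (1 - Complex.I * x : ℂ) ≠ 0 := by
    intro x h
    have := norm_one_sub_I_mul_sq x
    rw [h] at this
    simp at this
    nlinarith
  refine integrable_inv_one_add_sq.mono' (Continuous.aestronglyMeasurable
    (Continuous.inv₀ (by fun_prop) fun x => pow_ne_zero _ (hne x))) (.of_forall fun x => ?_)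
  have h1 : 1 ≤ ‖(1 - Complex.I * x : ℂ)‖ := by
    have h := norm_one_sub_I_mul_sq x
    nlinarith [norm_nonneg (1 - Complex.I * x : ℂ), sq_nonneg x]
  rw [norm_inv, norm_pow, ← norm_one_sub_I_mul_sq]
  exact inv_anti₀ (by positivity) (pow_le_pow_right₀ h1 (by omega))

/-- The Laplace integral of `t^n e^(-t)` exhibits `(1 - ix)^(-n-1)` as an inverse transform. For `n
≠ 0` the density is continuous at `0`, so that pointwise inversion applies. -/
theorem hat_inv_one_sub_pow {n : ℕ} (hn : n ≠ 0) (y : ℝ) :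
    hat (fun x : ℝ => ((1 - Complex.I * x : ℂ) ^ (n + 1))⁻¹) y = 2 * Real.pi / n.factorial *
      (Set.Ioi (0 : ℝ)).indicator (fun t : ℝ => (t : ℂ) ^ n * Complex.exp (-t)) y := by
  have hre : ∀ x : ℝ, (1 - Complex.I * x : ℂ).re = 1 := by simp
  have hi : Integrable ((Set.Ioi (0 : ℝ)).indicator
      fun t : ℝ => (t : ℂ) ^ n * Complex.exp (-t)) := by
    rw [integrable_indicator_iff measurableSet_Ioi]
    simpa using integrableOn_cpow_mul_exp (a := 1) (by simp) n
  have hn' : (n.factorial : ℂ) ≠ 0 := by exact_mod_cast n.factorial_ne_zero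
  have h := hat_of_eq_hat_neg (φ := fun x : ℝ => (n.factorial : ℂ) *
    ((1 - Complex.I * x : ℂ) ^ (n + 1))⁻¹) (continuous_pow_mul_exp_indicator hn) hi
    ((integrable_inv_one_sub_pow hn).const_mul _) (fun x => ?_) y
  · rw [hat_const_mul] at h
    rw [div_mul_eq_mul_div, ← h, mul_div_cancel_left₀ _ hn']
  · rw [← integral_pow_mul_cexp (hre x), hat, ← integral_indicator measurableSet_Ioi]
    congr 1
    funext t
    by_cases ht : t ∈ Set.Ioi (0 : ℝ)
    · rw [Set.indicator_of_mem ht, Set.indicator_of_mem ht, mul_left_comm, ← Complex.exp_add]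
      congr 2
      push_cast
      ring
    · rw [Set.indicator_of_notMem ht, Set.indicator_of_notMem ht, mul_zero]

/-! ### Integrable functions whose Fourier transform lives on a half line -/

/-- `f` is integrable and its Fourier transform vanishes on `(-∞, 0]`. -/
structure IsHardy (f : ℝ → ℂ) : Prop where
  integrable : Integrable f
  hat_eq_zero : ∀ y ≤ 0, hat f y = 0

theorem IsHardy.of_neg {f : ℝ → ℂ} (hf : Integrable f) (h : ∀ y < 0, hat f y = 0) : IsHardy f := by
  refine ⟨hf, fun y hy => ?_⟩
  have hcl : IsClosed {y : ℝ | hat f y = 0} := isClosed_eq (continuous_hat hf) continuous_const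
  have h1 := hcl.closure_subset_iff.2 (fun y hy => h y hy : Set.Iio (0 : ℝ) ⊆ _)
  rw [closure_Iio] at h1
  exact h1 hy

theorem IsHardy.add {f g : ℝ → ℂ} (hf : IsHardy f) (hg : IsHardy g) :
    IsHardy fun x => f x + g x :=
  ⟨hf.1.add hg.1, fun y hy => by rw [hat_add hf.1 hg.1, hf.2 y hy, hg.2 y hy, add_zero]⟩

theorem IsHardy.const_mul {f : ℝ → ℂ} (hf : IsHardy f) (c : ℂ) : IsHardy fun x => c * f x :=
  ⟨hf.1.const_mul c, fun y hy => by rw [hat_const_mul, hf.2 y hy, mul_zero]⟩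

theorem IsHardy.integral_eq_zero {f : ℝ → ℂ} (hf : IsHardy f) : ∫ x, f x = 0 := by
  simpa [hat] using hf.2 0 le_rfl

theorem one_sub_I_mul_ne_zero (x : ℝ) : (1 - Complex.I * x : ℂ) ≠ 0 := by
  intro h
  have := norm_one_sub_I_mul_sq x
  rw [h] at this
  simp at this
  nlinarith

theorem one_add_I_mul_ne_zero (x : ℝ) : (1 + Complex.I * x : ℂ) ≠ 0 := by
  simpa using one_sub_I_mul_ne_zero (-x)

theorem one_le_norm_one_sub_I_mul (x : ℝ) : 1 ≤ ‖(1 - Complex.I * x : ℂ)‖ := by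
  have h := norm_one_sub_I_mul_sq x
  nlinarith [norm_nonneg (1 - Complex.I * x : ℂ), sq_nonneg x]

theorem hasDerivAt_hat_one_sub {f : ℝ → ℂ} (hf : Integrable f)
    (hi : Integrable fun x : ℝ => (1 - Complex.I * x) * f x) (y : ℝ) :
    HasDerivAt (hat f) (hat (fun x : ℝ => (1 - Complex.I * x) * f x) y - hat f y) y := by
  have h1 : Integrable fun x : ℝ => (x : ℂ) * f x := by
    refine ((hi.sub hf).const_mul Complex.I).congr (.of_forall fun x => ?_)
    simp only [Pi.sub_apply]
    linear_combination (-(x : ℂ) * f x) * Complex.I_mul_I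
  refine (hasDerivAt_hat hf h1 y).congr_deriv ?_
  have h2 := hat_add hf (h1.const_mul (-Complex.I)) y
  rw [eq_sub_iff_add_eq', ← h2]
  congr 1
  funext x
  ring

/-- On the transform, multiplication by `1 - ix` is `u ↦ u + u'`, a local operation. -/
theorem IsHardy.mul_one_sub {f : ℝ → ℂ} (hf : IsHardy f)
    (hi : Integrable fun x : ℝ => (1 - Complex.I * x) * f x) :
    IsHardy fun x : ℝ => (1 - Complex.I * x) * f x := by
  refine .of_neg hi fun y hy => ?_
  have h2 : HasDerivAt (hat f) 0 y := by
    refine (hasDerivAt_const y (0 : ℂ)).congr_of_eventuallyEq ?_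
    filter_upwards [Iio_mem_nhds hy] with z hz using hf.2 z (le_of_lt hz)
  have h3 := (hasDerivAt_hat_one_sub hf.1 hi y).unique h2
  rwa [hf.2 y hy.le, sub_zero] at h3

/-- Dividing by `1 - ix` convolves the transform with `e^(-t)` on `(0, ∞)`, so its value at `y`
involves only the points `y - t` below `y`. -/
theorem IsHardy.mul_inv_one_sub {f : ℝ → ℂ} (hf : IsHardy f) :
    IsHardy fun x : ℝ => (1 - Complex.I * x)⁻¹ * f x := by
  refine ⟨hf.1.bdd_mul (c := 1) (Continuous.aestronglyMeasurable
    (Continuous.inv₀ (by fun_prop) one_sub_I_mul_ne_zero)) (.of_forall fun x => ?_), fun y hy => ?_⟩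
  · rw [norm_inv]
    exact inv_le_one_of_one_le₀ (one_le_norm_one_sub_I_mul x)
  · have h := integral_mul_inv_pow (integrable_exp_mul hf.1 y) (-1) 0
    have h0 : ∀ t ∈ Set.Ioi (0 : ℝ), (t : ℂ) ^ 0 * Complex.exp (-t) *
        hat (fun x : ℝ => Complex.exp (-(x * y * Complex.I)) * f x) (-1 * t) = 0 := by
      intro t ht
      have h1 : hat (fun x : ℝ => Complex.exp (-(x * y * Complex.I)) * f x) (-1 * t) =
          hat f (y - t) := by
        rw [hat, hat]
        refine integral_congr_ae (.of_forall fun x => ?_)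
        dsimp only
        rw [← mul_assoc, ← Complex.exp_add]
        congr 2
        push_cast
        ring
      rw [h1, hf.2 _ (by linarith [Set.mem_Ioi.1 ht]), mul_zero]
    rw [setIntegral_congr_fun measurableSet_Ioi h0, integral_zero, mul_zero] at h
    rw [hat, ← h]
    refine integral_congr_ae (.of_forall fun x => ?_)
    dsimp only
    push_cast
    rw [pow_one, show (1 + Complex.I * (-1 * x) : ℂ) = 1 - Complex.I * x by ring]
    ring

/-- The Cayley transform. -/
def cayley (x : ℝ) : ℂ := (1 + Complex.I * x) / (1 - Complex.I * x)

theorem cayley_eq (x : ℝ) : cayley x = 2 * (1 - Complex.I * x)⁻¹ - 1 := by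
  have := one_sub_I_mul_ne_zero x
  rw [cayley]
  field_simp
  ring

theorem cayley_ne_zero (x : ℝ) : cayley x ≠ 0 :=
  div_ne_zero (one_add_I_mul_ne_zero x) (one_sub_I_mul_ne_zero x)

theorem IsHardy.cayley_pow_mul {f : ℝ → ℂ} (hf : IsHardy f) (m : ℕ) :
    IsHardy fun x : ℝ => cayley x ^ m * f x := by
  induction m with
  | zero => simpa using hf
  | succ m ih =>
    convert (ih.mul_inv_one_sub.const_mul 2).add (ih.const_mul (-1)) using 2 with x
    rw [pow_succ, cayley_eq]
    ring

theorem isHardy_inv_pow {n : ℕ} (hn : n ≠ 0) :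
    IsHardy fun x : ℝ => ((1 - Complex.I * x) ^ (n + 1))⁻¹ :=
  ⟨integrable_inv_one_sub_pow hn, fun y hy => by
    rw [hat_inv_one_sub_pow hn, Set.indicator_of_notMem (by simpa using hy), mul_zero]⟩

theorem norm_sqrt_eq (x : ℝ) : ‖(1 - Complex.I * x : ℂ)‖ = √(1 + x ^ 2) := by
  rw [← norm_one_sub_I_mul_sq, Real.sqrt_sq (norm_nonneg _)]

theorem exp_arctan (x : ℝ) : ((√(1 + x ^ 2) : ℝ) : ℂ) * Complex.exp (Real.arctan x * Complex.I) =
    1 + Complex.I * x := by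
  have h : √(1 + x ^ 2) ≠ 0 := by positivity
  have h' : ((√(1 + x ^ 2) : ℝ) : ℂ) ≠ 0 := by exact_mod_cast h
  rw [Complex.exp_mul_I, ← Complex.ofReal_cos, ← Complex.ofReal_sin, Real.cos_arctan,
    Real.sin_arctan]
  push_cast
  field_simp

theorem exp_neg_arctan (x : ℝ) :
    ((√(1 + x ^ 2) : ℝ) : ℂ) * (Complex.exp (Real.arctan x * Complex.I))⁻¹ =
    1 - Complex.I * x := by
  have := exp_arctan (-x)
  rw [Real.arctan_neg] at this
  rw [← Complex.exp_neg]
  push_cast at this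
  simpa [sub_eq_add_neg] using this

theorem cayley_eq_exp (x : ℝ) : cayley x = Complex.exp (Real.arctan x * Complex.I) ^ 2 := by
  have h : √(1 + x ^ 2) ≠ 0 := by positivity
  have h' : ((√(1 + x ^ 2) : ℝ) : ℂ) ≠ 0 := by exact_mod_cast h
  have h1 := Complex.exp_ne_zero (Real.arctan x * Complex.I)
  rw [cayley, ← exp_arctan, ← exp_neg_arctan]
  field_simp

theorem exp_int_mul_arctan (k : ℤ) (x : ℝ) :
    Complex.exp (((d + 1 + 2 * k : ℤ) : ℂ) * Real.arctan x * Complex.I) =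
      Complex.exp (Real.arctan x * Complex.I) ^ (d + 1) * cayley x ^ k := by
  rw [cayley_eq_exp, mul_assoc, Complex.exp_int_mul, zpow_add₀ (Complex.exp_ne_zero _), zpow_mul]
  norm_cast

theorem kType_apply (k : ℤ) (x : ℝ) :
    kType d k x = ((1 - Complex.I * x) ^ (d + 1))⁻¹ * cayley x ^ k := by
  have h : √(1 + x ^ 2) ≠ 0 := by positivity
  have h' : ((√(1 + x ^ 2) : ℝ) : ℂ) ≠ 0 := by exact_mod_cast h
  have h1 := lift_arctan (kType d k) x
  rw [lift_kType, fourier_coe_two_pi, exp_int_mul_arctan] at h1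
  rw [← exp_neg_arctan, mul_pow, mul_inv, inv_pow, inv_inv, mul_assoc, h1, inv_mul_cancel_left₀]
  exact pow_ne_zero _ h'

theorem norm_apply_le (φ : ISpace d) (x : ℝ) :
    ‖φ x‖ ≤ ‖lift d φ‖ * (‖(1 - Complex.I * x : ℂ)‖ ^ (d + 1))⁻¹ := by
  have h : 0 < √(1 + x ^ 2) := by positivity
  have h1 := (lift d φ).norm_coe_le_norm (Real.arctan x : ℝ)
  rw [lift_arctan, norm_mul, norm_pow, Complex.norm_real, Real.norm_of_nonneg h.le] at h1
  rw [norm_sqrt_eq, ← div_eq_mul_inv, le_div_iff₀ (by positivity)]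
  linarith

/-- A vector of `I_d` decays like `|x|^(-d-1)`, so multiplying by fewer than `d` powers still leaves
decay of order `|x|^(-2)`. -/
theorem integrable_pow_mul (φ : ISpace d) {e : ℕ} (he : e < d) :
    Integrable fun x : ℝ => (1 - Complex.I * x) ^ e * φ x := by
  have hc := φ.contDiff.continuous
  refine (integrable_inv_one_add_sq.const_mul ‖lift d φ‖).mono'
    (Continuous.aestronglyMeasurable (by fun_prop)) (.of_forall fun x => ?_)
  have h1 := one_le_norm_one_sub_I_mul x
  have h0 : 0 < ‖(1 - Complex.I * x : ℂ)‖ := by linarith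
  rw [norm_mul, norm_pow, ← norm_one_sub_I_mul_sq]
  calc _ ≤ ‖(1 - Complex.I * x : ℂ)‖ ^ e * (‖lift d φ‖ * (‖(1 - Complex.I * x : ℂ)‖ ^ (d + 1))⁻¹) := by
        gcongr
        exact norm_apply_le φ x
    _ = ‖lift d φ‖ * (‖(1 - Complex.I * x : ℂ)‖ ^ (d + 1 - e))⁻¹ := by
        rw [show d + 1 = e + (d + 1 - e) by omega, pow_add, Nat.add_sub_cancel_left]
        field_simp
    _ ≤ _ := by
        gcongr ‖lift d φ‖ * ?_
        exact inv_anti₀ (by positivity) (pow_le_pow_right₀ h1 (by omega))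

theorem integrable_ISpace (hd : 0 < d) (φ : ISpace d) : Integrable φ := by
  simpa using integrable_pow_mul φ hd

theorem isHardy_pow_mul {φ : ISpace d} (h : IsHardy φ) {e : ℕ} (he : e < d) :
    IsHardy fun x : ℝ => (1 - Complex.I * x) ^ e * φ x := by
  induction e with
  | zero => simpa using h
  | succ e ih =>
    have h1 := integrable_pow_mul φ he
    simp only [pow_succ', mul_assoc] at h1 ⊢
    exact (ih (by omega)).mul_one_sub h1

/-! ### The Hardy space -/

/-- For weights of the right parity the integrand has period `π`, so the circle integral is twice
the integral over `(-π/2, π/2)`, the range of `arctan`. -/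
theorem coeff_eq_integral_arctan (φ : ISpace d) (k : ℤ) : coeff φ (d + 1 + 2 * k) =
    (Real.pi : ℂ)⁻¹ * ∫ x : ℝ, (1 + x ^ 2)⁻¹ •
      (Complex.exp (-(((d + 1 + 2 * k : ℤ) : ℂ) * Real.arctan x * Complex.I)) *
        lift d φ (Real.arctan x : ℝ)) := by
  set G : ℝ → ℂ := fun θ => Complex.exp (-(((d + 1 + 2 * k : ℤ) : ℂ) * θ * Complex.I)) *
    lift d φ (θ : ℝ) with hG
  have hc : Continuous G := (by fun_prop : Continuous fun θ : ℝ =>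
    Complex.exp (-(((d + 1 + 2 * k : ℤ) : ℂ) * θ * Complex.I))).mul (continuous_lift_coe φ)
  have hp : Function.Periodic G Real.pi := by
    intro θ
    have h1 := exp_int_mul_add_pi (-(d + 1 + 2 * k)) θ
    rw [zpow_neg, zpow_neg_one_mul] at h1
    have h2 : ∀ τ : ℝ, -(((d + 1 + 2 * k : ℤ) : ℂ) * τ * Complex.I) =
        ((-(d + 1 + 2 * k) : ℤ) : ℂ) * τ * Complex.I := by
      intro τ
      push_cast
      ring
    simp only [hG]
    rw [h2, h1, lift_add_pi, h2]
    have h3 : ((-1 : ℂ) ^ (d + 1)) ≠ 0 := pow_ne_zero _ (by norm_num)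
    field_simp
  rw [integral_comp_arctan G, coeff_eq_integral φ _ (-(Real.pi / 2)),
    ← intervalIntegral.integral_add_adjacent_intervals (b := Real.pi / 2)
      (hc.intervalIntegrable _ _) (hc.intervalIntegrable _ _)]
  have h4 := hp.intervalIntegral_add_eq (-(Real.pi / 2)) (Real.pi / 2)
  rw [show -(Real.pi / 2) + Real.pi = Real.pi / 2 by ring] at h4
  rw [show -(Real.pi / 2) + 2 * Real.pi = Real.pi / 2 + Real.pi by ring, ← h4, ← two_mul,
    ← mul_assoc]
  congr 1
  have : (Real.pi : ℂ) ≠ 0 := by exact_mod_cast Real.pi_ne_zero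
  field_simp

/-- The weight here is `d - 1 - 2m`; combined with the factor `(1 + x²)^((d-1)/2)` its exponential
becomes `(1 - ix)^(d-1)` times a nonnegative power of the Cayley transform. Both multipliers
preserve the Hardy condition, so for Hardy `φ` the integral is the value at `0` of a vanishing
transform. -/
theorem coeff_neg_eq_integral (hd : 0 < d) (φ : ISpace d) (m : ℕ) :
    coeff φ (d + 1 + 2 * (-(m + 1 : ℕ))) = (Real.pi : ℂ)⁻¹ * ∫ x : ℝ,
      cayley x ^ m * ((1 - Complex.I * x) ^ (d - 1) * φ x) := by
  rw [coeff_eq_integral_arctan]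
  congr 1
  refine integral_congr_ae (.of_forall fun x => ?_)
  obtain ⟨e, rfl⟩ : ∃ e, d = e + 1 := ⟨d - 1, by omega⟩
  have h : √(1 + x ^ 2) ≠ 0 := by positivity
  have h' : ((√(1 + x ^ 2) : ℝ) : ℂ) ≠ 0 := by exact_mod_cast h
  have h1 := Complex.exp_ne_zero (Real.arctan x * Complex.I)
  have h2 : (1 + x ^ 2)⁻¹ = (√(1 + x ^ 2) ^ 2)⁻¹ := by rw [Real.sq_sqrt (by positivity)]
  dsimp only
  rw [Complex.exp_neg, exp_int_mul_arctan, lift_arctan, h2, ← exp_neg_arctan, cayley_eq_exp,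
    Complex.real_smul, zpow_neg, zpow_natCast]
  rw [Nat.add_sub_cancel]
  generalize Complex.exp (Real.arctan x * Complex.I) = u at *
  push_cast
  generalize ((√(1 + x ^ 2) : ℝ) : ℂ) = r at *
  rw [mul_pow, inv_pow]
  field_simp
  ring

/-- The vectors of `I_d` whose nonzero Fourier coefficients have weight at least `d + 1`. -/
def hardy (d : ℕ) : Submodule ℂ (ISpace d) where
  carrier := {φ | ∀ k : ℤ, k < 0 → coeff φ (d + 1 + 2 * k) = 0}
  zero_mem' := fun k _ => by
    rw [coeff, map_zero]
    exact (fourierCoeffCLM _).map_zero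
  add_mem' := fun h h' k hk => by rw [coeff_add, h k hk, h' k hk, add_zero]
  smul_mem' := fun c φ h k hk => by
    rw [coeff, map_smul]
    refine (fourierCoeff.const_smul _ _ _).trans ?_
    change c • coeff φ _ = 0
    rw [h k hk, smul_zero]

theorem mem_hardy {φ : ISpace d} :
    φ ∈ hardy d ↔ ∀ k : ℤ, k < 0 → coeff φ (d + 1 + 2 * k) = 0 := Iff.rfl

theorem isClosed_hardy : IsClosed (hardy d : Set (ISpace d)) := by
  have : (hardy d : Set (ISpace d)) =
      ⋂ (k : ℤ) (_ : k < 0), {φ | coeff φ (d + 1 + 2 * k) = 0} := by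
    ext φ
    simp [mem_hardy]
  rw [this]
  exact isClosed_biInter fun k _ => isClosed_eq (continuous_coeff _) continuous_const

theorem isHardy_kType (hd : 0 < d) (k : ℕ) : IsHardy (kType d k) := by
  convert (isHardy_inv_pow hd.ne').cayley_pow_mul k using 2 with x
  rw [kType_apply, zpow_natCast, mul_comm]

theorem continuous_hat_apply (hd : 0 < d) (y : ℝ) : Continuous fun φ : ISpace d => hat φ y := by
  let f : ISpace d →+ ℂ :=
    AddMonoidHom.mk' (fun φ => hat φ y) fun φ φ' =>
      hat_add (integrable_ISpace hd φ) (integrable_ISpace hd φ') y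
  refine continuous_of_continuousAt_zero f ?_
  have h1 : ∀ φ : ISpace d, ‖f φ‖ ≤ ‖lift d φ‖ * Real.pi := by
    intro φ
    refine (norm_hat_le _ _).trans ?_
    have h2 := integral_const_mul (μ := volume) ‖lift d φ‖ fun x : ℝ => (1 + x ^ 2)⁻¹
    rw [integral_univ_inv_one_add_sq] at h2
    refine le_of_le_of_eq ?_ h2
    refine integral_mono (integrable_ISpace hd φ).norm
      (integrable_inv_one_add_sq.const_mul _) fun x => (norm_apply_le φ x).trans ?_
    rw [← norm_one_sub_I_mul_sq]
    gcongr ‖lift d φ‖ * ?_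
    exact inv_anti₀ (by have := one_le_norm_one_sub_I_mul x; positivity)
      (pow_le_pow_right₀ (one_le_norm_one_sub_I_mul x) (by omega))
  rw [ContinuousAt, map_zero]
  refine squeeze_zero_norm h1 ?_
  have h2 : Continuous fun φ : ISpace d => ‖lift d φ‖ * Real.pi :=
    continuous_lift.norm.mul continuous_const
  simpa using h2.tendsto 0

/-- The Fourier transform at a point as a continuous linear functional on `I_d`. -/
def hatCLM (hd : 0 < d) (y : ℝ) : ISpace d →L[ℂ] ℂ where
  toFun φ := hat φ y
  map_add' φ φ' := hat_add (integrable_ISpace hd φ) (integrable_ISpace hd φ') y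
  map_smul' c φ := hat_const_mul c φ y
  cont := continuous_hat_apply hd y

/-- Forwards, evaluation of the Fourier transform at `y ≤ 0` is a continuous functional that kills
every `kType d k` with `k ≥ 0`, hence the sum of the expansion. Backwards, the coefficients with `k
< 0` are integrals of Hardy functions. -/
theorem mem_hardy_iff (hd : 0 < d) {φ : ISpace d} : φ ∈ hardy d ↔ IsHardy φ := by
  constructor
  · intro h
    refine ⟨integrable_ISpace hd φ, fun y hy => ?_⟩
    have h1 := (hatCLM hd y).hasSum (hasSum_kType φ)
    refine h1.unique (hasSum_of_eq hasSum_zero fun k => ?_)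
    rw [map_smul]
    rcases lt_or_ge k 0 with hk | hk
    · rw [h k hk, zero_smul]
    · lift k to ℕ using hk
      have h2 : hatCLM hd y (kType d k) = 0 := (isHardy_kType hd k).2 y hy
      rw [h2, smul_zero]
  · intro h k hk
    obtain ⟨m, rfl⟩ : ∃ m : ℕ, k = -(m + 1 : ℕ) := ⟨(-k - 1).toNat, by omega⟩
    rw [coeff_neg_eq_integral hd,
      ((isHardy_pow_mul h (by omega)).cayley_pow_mul m).integral_eq_zero, mul_zero]

/-! ### Invariance of the Hardy space -/

theorem rep_rot_mem_hardy {φ : ISpace d} (h : φ ∈ hardy d) (α : ℝ) :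
    rep d (rot α) φ ∈ hardy d := fun k hk => by rw [coeff_rep_rot, h k hk, mul_zero]

theorem hat_comp_affine (f : ℝ → ℂ) {a : ℝ} (ha : 0 < a) (b y : ℝ) :
    hat (fun x => f (a * x + b)) y = Complex.exp (b * (y / a : ℝ) * Complex.I) *
      ((a⁻¹ : ℝ) * hat f (y / a)) := by
  have h1 := Measure.integral_comp_mul_left (fun x : ℝ => Complex.exp (-((x + b : ℝ) * (y / a : ℝ) *
    Complex.I)) * f (x + b)) a
  rw [integral_add_right_eq_self (fun x : ℝ => Complex.exp (-(x * (y / a : ℝ) *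
    Complex.I)) * f x), abs_of_pos (inv_pos.2 ha), Complex.real_smul] at h1
  rw [hat, hat, ← h1, ← integral_const_mul]
  refine integral_congr_ae (.of_forall fun x => ?_)
  dsimp only
  rw [← mul_assoc, ← Complex.exp_add]
  have : (a : ℂ) ≠ 0 := by exact_mod_cast ha.ne'
  congr 2
  push_cast
  field_simp
  ring

/-- Such an element acts, up to a constant, by the substitution `x ↦ s² x + s q`. Its slope is
positive, so the transform is dilated without exchanging the half lines. -/
theorem rep_upper_mem_hardy (hd : 0 < d) {φ : ISpace d} (h : φ ∈ hardy d) {g : SL2R}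
    (hg : g 1 0 = 0) : rep d g φ ∈ hardy d := by
  rw [mem_hardy_iff hd] at h ⊢
  refine ⟨integrable_ISpace hd _, fun y hy => ?_⟩
  have hdet := SL2R_det g
  rw [hg, mul_zero, sub_zero] at hdet
  have hp : g 0 0 ≠ 0 := left_ne_zero_of_mul_eq_one hdet
  have hs : g 1 1 ≠ 0 := right_ne_zero_of_mul_eq_one hdet
  have hs2 : 0 < g 1 1 ^ 2 := by positivity
  have h1 : (ISpace.incl d (rep d g φ) : ℝ → ℂ) = fun x => ((g 0 0 : ℂ) ^ (d + 1))⁻¹ *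
      φ (g 1 1 ^ 2 * x + g 1 1 * g 0 1) := by
    funext x
    rw [rep_apply, hg, zero_mul, zero_add, homog_of_ne hp]
    congr 1
    refine congrArg (ISpace.incl d φ) ?_
    rw [div_eq_iff hp]
    linear_combination (-(g 1 1 * x + g 0 1)) * hdet
  rw [h1, hat_const_mul, hat_comp_affine _ hs2, h.2 _ (div_nonpos_of_nonpos_of_nonneg hy hs2.le)]
  simp

theorem coe_rot (α : ℝ) : (rot α : Matrix (Fin 2) (Fin 2) ℝ) =
    !![Real.cos α, Real.sin α; -Real.sin α, Real.cos α] := rfl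

theorem rot_mul_rot_neg (α : ℝ) : rot α * rot (-α) = 1 := by
  ext i j
  have := Real.sin_sq_add_cos_sq α
  fin_cases i <;> fin_cases j <;> 
    simp [coe_rot] <;> linarith

theorem exists_rot_mul (g : SL2R) : ∃ (α : ℝ) (b : SL2R), b 1 0 = 0 ∧ g = rot α * b := by
  -- The first column of `rot α` is `(cos α, -sin α)`, so the angle that clears the lower left entry
  -- is the argument of `p - i r`.
  set z : ℂ := ⟨g 0 0, -g 1 0⟩ with hz
  refine ⟨z.arg, rot (-z.arg) * g, ?_, by rw [← mul_assoc, rot_mul_rot_neg, one_mul]⟩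
  have h1 : z ≠ 0 := by
    intro h
    have e1 := congrArg Complex.re h
    have e2 := congrArg Complex.im h
    have := SL2R_det g
    simp [hz] at e1 e2
    simp [e1, e2] at this
  have h2 : ‖z‖ ≠ 0 := norm_ne_zero_iff.2 h1
  simp only [Matrix.SpecialLinearGroup.coe_mul, coe_rot, Matrix.mul_apply, Fin.sum_univ_two]
  simp [Complex.sin_arg, Complex.cos_arg h1]
  simp [hz]
  ring

theorem rep_mem_hardy (hd : 0 < d) {φ : ISpace d} (h : φ ∈ hardy d) (g : SL2R) :
    rep d g φ ∈ hardy d := by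
  obtain ⟨α, b, hb, rfl⟩ := exists_rot_mul g
  rw [map_mul]
  exact rep_rot_mem_hardy (rep_upper_mem_hardy hd h hb) α

/-! ### Translations -/

/-- The translation `φ ↦ φ (· + s)`, as an element of `SL(2, ℝ)`. -/
def transl (s : ℝ) : SL2R := ⟨!![1, s; 0, 1], by simp⟩

theorem continuous_transl : Continuous transl :=
  Continuous.subtype_mk (by fun_prop) _

theorem rep_transl_apply (s : ℝ) (φ : ISpace d) (x : ℝ) : rep d (transl s) φ x = φ (x + s) := by
  change homog d φ (0 * x + 1) (1 * x + s) = _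
  rw [homog_of_ne (by simp)]
  simp

theorem lieEnd_transl_apply (φ : ISpace d) (x : ℝ) : lieEnd d 0 1 0 φ x = deriv φ x := by
  rw [lieEnd_apply, lieOp]
  simp

/-- Differentiation under the integral over the line, where translation is the plain substitution `x
↦ x + s`. -/
theorem hasDerivAt_coeff_transl (φ : ISpace d) (k : ℤ) :
    HasDerivAt (fun s => coeff (rep d (transl s) φ) (d + 1 + 2 * k))
      (coeff (lieEnd d 0 1 0 φ) (d + 1 + 2 * k)) 0 := by
  set ψ := lieEnd d 0 1 0 φ
  set e : ℝ → ℂ := fun x => Complex.exp (-(((d + 1 + 2 * k : ℤ) : ℂ) * Real.arctan x * Complex.I))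
  have he : Continuous e := by
    have := Real.continuous_arctan
    fun_prop
  have hne : ∀ x, ‖e x‖ = 1 := by
    intro x
    have h1 := Complex.norm_exp_ofReal_mul_I (-((d + 1 + 2 * k : ℤ) * Real.arctan x))
    rw [← h1]
    simp only [e]
    congr 2
    generalize Real.arctan x = a
    push_cast
    ring
  have hl : ∀ χ : ISpace d, Continuous fun x : ℝ => lift d χ (Real.arctan x : ℝ) := fun χ =>
    (continuous_lift_coe χ).comp Real.continuous_arctan
  have hw : Continuous fun x : ℝ => (1 + x ^ 2 : ℝ)⁻¹ :=
    Continuous.inv₀ (by fun_prop) fun x => by positivity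
  have hmeas : ∀ χ : ISpace d, Continuous fun x : ℝ => (1 + x ^ 2)⁻¹ •
      (e x * lift d χ (Real.arctan x : ℝ)) := fun χ => hw.smul (he.mul (hl χ))
  have hbd : ∀ (χ : ISpace d) (x : ℝ), ‖(1 + x ^ 2)⁻¹ • (e x * lift d χ (Real.arctan x : ℝ))‖ ≤
      ‖lift d χ‖ * (1 + x ^ 2)⁻¹ := by
    intro χ x
    rw [norm_smul, norm_mul, hne, one_mul, Real.norm_of_nonneg (by positivity), mul_comm]
    gcongr
    exact (lift d χ).norm_coe_le_norm _
  have hone : transl 0 = 1 := by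
    ext i j
    fin_cases i <;> fin_cases j <;> simp [transl]
  have hcont : Continuous fun s => ‖lift d (rep d (transl s) ψ)‖ :=
    (continuous_lift.comp (continuous_rep.comp
      (continuous_transl.prodMk continuous_const))).norm
  -- Continuity of the action bounds the translates of `ψ` uniformly for `s` near `0`; this supplies
  -- the dominating function.
  have hs : {s | ‖lift d (rep d (transl s) ψ)‖ < ‖lift d ψ‖ + 1} ∈ 𝓝 (0 : ℝ) := by
    refine (isOpen_lt hcont continuous_const).mem_nhds ?_
    simp [hone]
  have h := hasDerivAt_integral_of_dominated_loc_of_deriv_le (μ := volume) (x₀ := (0 : ℝ))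
    (F := fun s x => (1 + x ^ 2)⁻¹ • (e x * lift d (rep d (transl s) φ) (Real.arctan x : ℝ)))
    (F' := fun s x => (1 + x ^ 2)⁻¹ • (e x * lift d (rep d (transl s) ψ) (Real.arctan x : ℝ)))
    (bound := fun x => (‖lift d ψ‖ + 1) * (1 + x ^ 2)⁻¹) hs
    (.of_forall fun s => (hmeas _).aestronglyMeasurable)
    ((integrable_inv_one_add_sq.const_mul _).mono' (hmeas _).aestronglyMeasurable
      (.of_forall (hbd _))) (hmeas _).aestronglyMeasurable
    (.of_forall fun x s hs => (hbd _ x).trans ?_) (integrable_inv_one_add_sq.const_mul _)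
    (.of_forall fun x s _ => ?_)
  · have h1 := h.2.const_mul (Real.pi : ℂ)⁻¹
    simp only [hone, map_one, Module.End.one_apply] at h1
    simp only [coeff_eq_integral_arctan]
    exact h1
  · gcongr
    exact le_of_lt hs
  · have h2 := (φ.contDiff.differentiable (by simp) _).hasDerivAt.comp_const_add x s
    simp only [lift_arctan, rep_transl_apply, ψ, lieEnd_transl_apply]
    exact ((h2.const_mul _).const_mul (e x)).const_smul (1 + x ^ 2)⁻¹

theorem coeff_smul (c : ℂ) (φ : ISpace d) (n : ℤ) : coeff (c • φ) n = c * coeff φ n := by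
  rw [coeff, map_smul]
  exact fourierCoeff.const_smul _ _ _

theorem coeff_kType (j k : ℤ) : coeff (kType d k) (d + 1 + 2 * j) = if j = k then 1 else 0 := by
  rw [coeff, lift_kType, fourierCoeff_fourier, Pi.single_apply]
  simp

/-- The lowering coefficient is proportional to `k` and the raising one to `k + d + 1`. Thus the
chain breaks below `k = 0` and is connected above it. -/
theorem lieEnd_transl_kType (k : ℤ) : lieEnd d 0 1 0 (kType d k) =
    (Complex.I / 2 * k) • kType d (k - 1) + (Complex.I / 2 * (2 * k + d + 1)) • kType d k +
      (Complex.I / 2 * (k + d + 1)) • kType d (k + 1) := by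
  refine ISpace.ext fun x => ?_
  have hM := one_sub_I_mul_ne_zero x
  have hP := one_add_I_mul_ne_zero x
  have h0 : HasDerivAt (fun x : ℝ => (1 - Complex.I * x : ℂ)) (-Complex.I) x := by
    simpa using ((hasDerivAt_ofReal_comp x).const_mul Complex.I).const_sub 1
  have h0' : HasDerivAt (fun x : ℝ => (1 + Complex.I * x : ℂ)) Complex.I x := by
    simpa using ((hasDerivAt_ofReal_comp x).const_mul Complex.I).const_add 1
  have h1 : HasDerivAt cayley _ x := h0'.fun_div h0 hM
  have h2 := (hasDerivAt_zpow k (cayley x) (Or.inl (cayley_ne_zero x))).scomp x h1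
  have h3 := ((h0.fun_pow (d + 1)).fun_inv (pow_ne_zero _ hM)).fun_mul h2
  have h4 : (kType d k : ℝ → ℂ) = _ := funext (kType_apply k)
  rw [lieEnd_transl_apply, h4]
  refine h3.deriv.trans ?_
  simp only [ISpace.add_apply, ISpace.smul_apply, kType_apply, Function.comp]
  rw [zpow_sub_one₀ (cayley_ne_zero x), zpow_add_one₀ (cayley_ne_zero x)]
  have h5 := cayley_ne_zero x
  generalize hz : cayley x ^ k = z
  rw [cayley]
  rw [show (1 + Complex.I * x : ℂ) = 2 - (1 - Complex.I * x) by ring] at hP ⊢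
  generalize (1 - Complex.I * x : ℂ) = M at *
  simp only [smul_eq_mul, Nat.add_sub_cancel]
  push_cast
  field_simp
  ring

theorem coeff_lieEnd_kType_succ (k : ℕ) :
    coeff (lieEnd d 0 1 0 (kType d k)) (d + 1 + 2 * (k + 1 : ℕ)) ≠ 0 := by
  rw [lieEnd_transl_kType, coeff_add, coeff_add, coeff_smul, coeff_smul, coeff_smul,
    coeff_kType, coeff_kType, coeff_kType, if_neg (by omega), if_neg (by omega),
    if_pos (by omega)]
  have h : ((k : ℤ) + d + 1 : ℂ) ≠ 0 := by exact_mod_cast (by omega : ((k : ℤ) + d + 1) ≠ 0)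
  simpa using h

theorem coeff_lieEnd_kType_pred (k : ℕ) :
    coeff (lieEnd d 0 1 0 (kType d (k + 1 : ℕ))) (d + 1 + 2 * k) ≠ 0 := by
  rw [lieEnd_transl_kType, coeff_add, coeff_add, coeff_smul, coeff_smul, coeff_smul,
    coeff_kType, coeff_kType, coeff_kType, if_pos (by omega), if_neg (by omega),
    if_neg (by omega)]
  have h : (((k + 1 : ℕ) : ℤ) : ℂ) ≠ 0 := by exact_mod_cast k.succ_ne_zero
  simpa using h

/-! ### Irreducibility of the Hardy space -/

/-- By `coeff_mul_eq_zero`, every continuous functional that vanishes on `W` also vanishes on `kType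
d k`. -/
theorem kType_mem_of_coeff_ne_zero {W : Submodule ℂ (ISpace d)} (hc : IsClosed (W : Set (ISpace d)))
    (hW : ∀ g, ∀ φ ∈ W, rep d g φ ∈ W) {φ : ISpace d} (hφ : φ ∈ W) {k : ℤ}
    (hk : coeff φ (d + 1 + 2 * k) ≠ 0) : kType d k ∈ W := by
  have h := le_of_forall_functional (U := ℂ ∙ kType d k) hc fun l hl ψ hψ => by
    obtain ⟨c, rfl⟩ := Submodule.mem_span_singleton.1 hψ
    rw [map_smul, (mul_eq_zero.1 (coeff_mul_eq_zero (fun α => hW (rot α)) l hl hφ k)).resolve_left hk,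
      smul_zero]
  exact h (Submodule.mem_span_singleton_self _)

/-- Otherwise the coefficient at `k` would vanish on all translates of `φ`, and so would its
derivative at the origin. In this way the stability of `W` under the Lie algebra is not needed. -/
theorem kType_mem_of_coeff_lieEnd_ne_zero {W : Submodule ℂ (ISpace d)}
    (hc : IsClosed (W : Set (ISpace d))) (hW : ∀ g, ∀ φ ∈ W, rep d g φ ∈ W) {φ : ISpace d}
    (hφ : φ ∈ W) {k : ℤ} (hk : coeff (lieEnd d 0 1 0 φ) (d + 1 + 2 * k) ≠ 0) : kType d k ∈ W := by
  by_contra h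
  refine hk ((hasDerivAt_coeff_transl φ k).unique ?_)
  have h1 : (fun s => coeff (rep d (transl s) φ) (d + 1 + 2 * k)) = fun _ => 0 := by
    funext s
    by_contra h2
    exact h (kType_mem_of_coeff_ne_zero hc hW (hW _ _ hφ) h2)
  rw [h1]
  exact hasDerivAt_const _ _

/-- From some weight that occurs one descends to `k = 0`, then climbs through all `k ≥ 0`; the
expansion in the `kType d k` and closedness finish. -/
theorem eq_hardy_of_le {W : Submodule ℂ (ISpace d)} (hc : IsClosed (W : Set (ISpace d)))
    (hW : ∀ g, ∀ φ ∈ W, rep d g φ ∈ W) (hle : W ≤ hardy d) (hne : W ≠ ⊥) : W = hardy d := by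
  obtain ⟨φ, hφ, hφ0⟩ := W.ne_bot_iff.1 hne
  have h1 : ∃ k : ℤ, coeff φ (d + 1 + 2 * k) ≠ 0 := by
    by_contra! h
    exact hφ0 ((hasSum_kType φ).unique (hasSum_of_eq hasSum_zero fun k => by rw [h, zero_smul]))
  obtain ⟨k, hk⟩ := h1
  have hk0 : 0 ≤ k := by
    by_contra! h
    exact hk (hle hφ k h)
  lift k to ℕ using hk0
  have hkW := kType_mem_of_coeff_ne_zero hc hW hφ hk
  have h0 : ∀ n : ℕ, kType d n ∈ W → kType d (0 : ℕ) ∈ W := by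
    intro n
    induction n with
    | zero => exact id
    | succ n ih =>
      exact fun h => ih (kType_mem_of_coeff_lieEnd_ne_zero hc hW h (coeff_lieEnd_kType_pred n))
  have hall : ∀ n : ℕ, kType d n ∈ W := by
    intro n
    induction n with
    | zero => exact h0 k hkW
    | succ n ih => exact kType_mem_of_coeff_lieEnd_ne_zero hc hW ih (coeff_lieEnd_kType_succ n)
  refine le_antisymm hle (le_of_forall_functional hc fun l hl ψ hψ => ?_)
  refine (l.hasSum (hasSum_kType ψ)).unique (hasSum_of_eq hasSum_zero fun j => ?_)
  rw [map_smul]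
  rcases lt_or_ge j 0 with hj | hj
  · rw [hψ j hj, zero_smul]
  · lift j to ℕ using hj
    rw [hl _ (hall j), smul_zero]

theorem kType_mem_hardy (k : ℕ) : kType d k ∈ hardy d := fun j hj => by
  rw [coeff_kType, if_neg (by omega)]

theorem hardy_ne_bot : hardy d ≠ ⊥ := by
  refine (Submodule.ne_bot_iff _).2 ⟨kType d (0 : ℕ), kType_mem_hardy 0, fun h => ?_⟩
  have h1 := coeff_kType (d := d) (0 : ℕ) (0 : ℕ)
  rw [h, if_pos rfl, coeff, map_zero] at h1
  exact zero_ne_one ((fourierCoeffCLM _).map_zero.symm.trans h1)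

/-! ### Schwartz functions on the closed half line, through their derivatives -/

/-- `A n` is the `n`-th derivative of the Schwartz function `A 0` on `[0, ∞)`. -/
structure IsSchwartzSeq (A : ℕ → ℝ → ℂ) : Prop where
  hasDeriv : ∀ n, ∀ x ∈ Set.Ici (0 : ℝ), HasDerivWithinAt (A n) (A (n + 1) x) (Set.Ici 0) x
  decay : ∀ k n : ℕ, ∃ C : ℝ, ∀ x ∈ Set.Ici (0 : ℝ), |x| ^ k * ‖A n x‖ ≤ C

theorem IsSchwartzOn.isSchwartzSeq {f : ℝ → ℂ} (hf : IsSchwartzOn (Set.Ici 0) f) :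
    IsSchwartzSeq fun n => iteratedDerivWithin n f (Set.Ici 0) := by
  refine ⟨fun n x hx => ?_, hf.decay⟩
  rw [iteratedDerivWithin_succ]
  exact (hf.smooth.differentiableOn_iteratedDerivWithin (by exact_mod_cast WithTop.coe_lt_top _)
    (uniqueDiffOn_Ici 0) x hx).hasDerivWithinAt

theorem IsSchwartzSeq.iteratedDerivWithin_eq {A : ℕ → ℝ → ℂ} (hA : IsSchwartzSeq A) (n : ℕ) {x : ℝ}
    (hx : x ∈ Set.Ici (0 : ℝ)) : iteratedDerivWithin n (A 0) (Set.Ici 0) x = A n x := by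
  induction n generalizing x with
  | zero => simp
  | succ n ih =>
    rw [iteratedDerivWithin_succ, derivWithin_congr (fun y hy => ih hy) (ih hx)]
    exact (hA.hasDeriv n x hx).derivWithin (uniqueDiffOn_Ici 0 x hx)

theorem IsSchwartzSeq.isSchwartzOn {A : ℕ → ℝ → ℂ} (hA : IsSchwartzSeq A) :
    IsSchwartzOn (Set.Ici 0) (A 0) where
  smooth := contDiffOn_of_differentiableOn_deriv fun n _ =>
    DifferentiableOn.congr (fun x hx => (hA.hasDeriv n x hx).differentiableWithinAt)
      fun x hx => hA.iteratedDerivWithin_eq n hx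
  decay k n := by
    obtain ⟨C, hC⟩ := hA.decay k n
    exact ⟨C, fun x hx => by rw [hA.iteratedDerivWithin_eq n hx]; exact hC x hx⟩

theorem IsSchwartzSeq.shift {A : ℕ → ℝ → ℂ} (hA : IsSchwartzSeq A) :
    IsSchwartzSeq fun n => A (n + 1) :=
  ⟨fun n => hA.1 (n + 1), fun k n => hA.2 k (n + 1)⟩

theorem IsSchwartzSeq.add {A B : ℕ → ℝ → ℂ} (hA : IsSchwartzSeq A) (hB : IsSchwartzSeq B) :
    IsSchwartzSeq fun n x => A n x + B n x := by
  refine ⟨fun n x hx => (hA.1 n x hx).fun_add (hB.1 n x hx), fun k n => ?_⟩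
  obtain ⟨C, hC⟩ := hA.2 k n
  obtain ⟨C', hC'⟩ := hB.2 k n
  refine ⟨C + C', fun x hx => ?_⟩
  calc _ ≤ |x| ^ k * (‖A n x‖ + ‖B n x‖) := by gcongr; exact norm_add_le _ _
    _ ≤ C + C' := by rw [mul_add]; exact add_le_add (hC x hx) (hC' x hx)

theorem IsSchwartzSeq.const_mul {A : ℕ → ℝ → ℂ} (hA : IsSchwartzSeq A) (c : ℂ) :
    IsSchwartzSeq fun n x => c * A n x := by
  refine ⟨fun n x hx => (hA.1 n x hx).const_mul c, fun k n => ?_⟩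
  obtain ⟨C, hC⟩ := hA.2 k n
  refine ⟨‖c‖ * C, fun x hx => ?_⟩
  rw [norm_mul, mul_left_comm]
  gcongr
  exact hC x hx

/-- The Leibniz rule for `x f`; at `n = 0` the truncated index `n - 1` is harmless, as its factor
`n` is zero. -/
theorem IsSchwartzSeq.mul_id {A : ℕ → ℝ → ℂ} (hA : IsSchwartzSeq A) :
    IsSchwartzSeq fun n x => x * A n x + n * A (n - 1) x := by
  refine ⟨fun n x hx => ?_, fun k n => ?_⟩
  · have h1 := (hasDerivAt_ofReal_comp x).hasDerivWithinAt.fun_mul (hA.1 n x hx)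
    rcases n with _ | n
    · simpa [add_comm] using h1
    · refine (h1.fun_add ((hA.1 n x hx).const_mul ((n + 1 : ℕ) : ℂ))).congr_deriv ?_
      simp only [Nat.add_sub_cancel]
      push_cast
      ring
  · obtain ⟨C, hC⟩ := hA.2 (k + 1) n
    obtain ⟨C', hC'⟩ := hA.2 k (n - 1)
    refine ⟨C + n * C', fun x hx => ?_⟩
    calc _ ≤ |x| ^ k * (|x| * ‖A n x‖ + n * ‖A (n - 1) x‖) := by
          gcongr
          refine (norm_add_le _ _).trans (le_of_eq ?_)
          simp
      _ = |x| ^ (k + 1) * ‖A n x‖ + n * (|x| ^ k * ‖A (n - 1) x‖) := by ring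
      _ ≤ C + n * C' := add_le_add (hC x hx) (mul_le_mul_of_nonneg_left (hC' x hx) n.cast_nonneg)

/-! ### The transform `f ↦ ∫ y ^ d * f(y) * e ^ (i y x) dy` over the half line -/

/-- `x ↦ ∫ y ^ d * f(y) * e ^ (i y x) dy`, over `(0, ∞)`. -/
def synth (d : ℕ) (f : ℝ → ℂ) (x : ℝ) : ℂ :=
  ∫ y in Set.Ioi (0 : ℝ), (y : ℂ) ^ d * f y * Complex.exp (Complex.I * y * x)

theorem norm_exp_I_mul (y x : ℝ) : ‖Complex.exp (Complex.I * y * x)‖ = 1 := by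
  rw [show Complex.I * y * x = ((y * x : ℝ) : ℂ) * Complex.I by push_cast; ring]
  exact Complex.norm_exp_ofReal_mul_I _

theorem synth_eq_hat (d : ℕ) (f : ℝ → ℂ) (x : ℝ) : synth d f x =
    hat ((Set.Ioi (0 : ℝ)).indicator fun y : ℝ => (y : ℂ) ^ d * f y) (-x) := by
  rw [synth, hat, ← integral_indicator measurableSet_Ioi]
  refine integral_congr_ae (.of_forall fun y => ?_)
  by_cases hy : y ∈ Set.Ioi (0 : ℝ)
  · simp only [Set.indicator_of_mem hy]
    rw [mul_comm]
    congr 2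
    push_cast
    ring
  · simp only [Set.indicator_of_notMem hy, mul_zero]

theorem IsSchwartzSeq.continuousOn {A : ℕ → ℝ → ℂ} (hA : IsSchwartzSeq A) (n : ℕ) :
    ContinuousOn (A n) (Set.Ici 0) := fun x hx => (hA.1 n x hx).continuousWithinAt

theorem IsSchwartzSeq.integrableOn {A : ℕ → ℝ → ℂ} (hA : IsSchwartzSeq A) (d n : ℕ) :
    IntegrableOn (fun y : ℝ => (y : ℂ) ^ d * A n y) (Set.Ioi 0) := by
  obtain ⟨C, hC⟩ := hA.2 d n
  obtain ⟨C', hC'⟩ := hA.2 (d + 2) n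
  refine Integrable.mono' (g := fun y : ℝ => (C + C') * (1 + y ^ 2)⁻¹)
    (integrable_inv_one_add_sq.const_mul _).integrableOn ?_ ?_
  · refine ContinuousOn.aestronglyMeasurable ?_ measurableSet_Ioi
    have h1 := (hA.continuousOn n).mono Set.Ioi_subset_Ici_self
    fun_prop
  · filter_upwards [ae_restrict_mem measurableSet_Ioi] with y hy
    have hy' : y ∈ Set.Ici (0 : ℝ) := Set.Ioi_subset_Ici_self hy
    rw [norm_mul, norm_pow, Complex.norm_real, Real.norm_eq_abs, ← div_eq_mul_inv,
      le_div_iff₀ (by positivity)]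
    calc _ = |y| ^ d * ‖A n y‖ + |y| ^ (d + 2) * ‖A n y‖ := by rw [← sq_abs y]; ring
      _ ≤ _ := add_le_add (hC y hy') (hC' y hy')

theorem IsSchwartzSeq.integrable_indicator {A : ℕ → ℝ → ℂ} (hA : IsSchwartzSeq A) (d n : ℕ) :
    Integrable ((Set.Ioi (0 : ℝ)).indicator fun y : ℝ => (y : ℂ) ^ d * A n y) :=
  (integrable_indicator_iff measurableSet_Ioi).2 (hA.integrableOn d n)

theorem IsSchwartzSeq.integrableOn_exp {A : ℕ → ℝ → ℂ} (hA : IsSchwartzSeq A) (d n : ℕ) (x : ℝ) :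
    IntegrableOn (fun y : ℝ => (y : ℂ) ^ d * A n y * Complex.exp (Complex.I * y * x))
      (Set.Ioi 0) :=
  Integrable.mul_bdd (c := 1) (hA.integrableOn d n) (Continuous.aestronglyMeasurable (by fun_prop))
    (.of_forall fun y => (norm_exp_I_mul y x).le)

theorem synth_add {A B : ℕ → ℝ → ℂ} (hA : IsSchwartzSeq A) (hB : IsSchwartzSeq B) (d : ℕ) (x : ℝ) :
    synth d (fun y => A 0 y + B 0 y) x = synth d (A 0) x + synth d (B 0) x := by
  rw [synth, synth, synth, ← integral_add (hA.integrableOn_exp d 0 x) (hB.integrableOn_exp d 0 x)]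
  congr 1
  funext y
  ring

theorem synth_const_mul (c : ℂ) (f : ℝ → ℂ) (d : ℕ) (x : ℝ) :
    synth d (fun y => c * f y) x = c * synth d f x := by
  rw [synth, synth, ← integral_const_mul]
  congr 1
  funext y
  ring

theorem synth_succ (d : ℕ) (f : ℝ → ℂ) (x : ℝ) :
    synth (d + 1) f x = synth d (fun y => y * f y) x := by
  rw [synth, synth]
  congr 1
  funext y
  ring

theorem hasDerivAt_synth {A : ℕ → ℝ → ℂ} (hA : IsSchwartzSeq A) (d : ℕ) (x : ℝ) :
    HasDerivAt (synth d (A 0)) (Complex.I * synth (d + 1) (A 0) x) x := by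
  have h0 : synth d (A 0) = fun x => _ := funext (synth_eq_hat d (A 0))
  have h1 : ∀ y : ℝ, (y : ℂ) * (Set.Ioi (0 : ℝ)).indicator (fun y : ℝ => (y : ℂ) ^ d * A 0 y) y =
      (Set.Ioi (0 : ℝ)).indicator (fun y : ℝ => (y : ℂ) ^ (d + 1) * A 0 y) y := by
    intro y
    by_cases hy : y ∈ Set.Ioi (0 : ℝ)
    · simp only [Set.indicator_of_mem hy]
      ring
    · simp only [Set.indicator_of_notMem hy, mul_zero]
  have h2 := (hasDerivAt_hat (hA.integrable_indicator d 0)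
    (by simp only [h1]; exact hA.integrable_indicator (d + 1) 0) (-x)).scomp x (hasDerivAt_neg x)
  rw [h0]
  refine h2.congr_deriv ?_
  simp only [h1]
  rw [hat_const_mul, ← synth_eq_hat, neg_smul, one_smul]
  ring

theorem IsSchwartzSeq.tendsto_atTop {A : ℕ → ℝ → ℂ} (hA : IsSchwartzSeq A) (d n : ℕ) (x : ℝ) :
    Filter.Tendsto (fun y : ℝ => (y : ℂ) ^ d * A n y * Complex.exp (Complex.I * y * x))
      Filter.atTop (𝓝 0) := by
  obtain ⟨C, hC⟩ := hA.2 (d + 1) n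
  have h1 : Filter.Tendsto (fun y : ℝ => C * y⁻¹) Filter.atTop (𝓝 0) := by
    simpa using tendsto_inv_atTop_zero.const_mul C
  refine squeeze_zero_norm' ?_ h1
  filter_upwards [Filter.eventually_gt_atTop 0] with y hy
  have h2 := hC y hy.le
  rw [norm_mul, norm_exp_I_mul, mul_one, norm_mul, norm_pow, Complex.norm_real, Real.norm_eq_abs,
    ← div_eq_mul_inv, le_div_iff₀ hy]
  calc _ = |y| ^ (d + 1) * ‖A n y‖ := by rw [abs_of_pos hy]; ring
    _ ≤ C := h2

/-- Integration by parts. -/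
theorem I_mul_synth {A : ℕ → ℝ → ℂ} (hA : IsSchwartzSeq A) (d : ℕ) (x : ℝ) :
    Complex.I * x * synth d (A 0) x =
      -(0 ^ d * A 0 0 + d * synth (d - 1) (A 0) x + synth d (A 1) x) := by
  have hd : ∀ y ∈ Set.Ioi (0 : ℝ), HasDerivAt
      (fun y : ℝ => (y : ℂ) ^ d * A 0 y * Complex.exp (Complex.I * y * x))
      (d * ((y : ℂ) ^ (d - 1) * A 0 y * Complex.exp (Complex.I * y * x)) +
        (y : ℂ) ^ d * A 1 y * Complex.exp (Complex.I * y * x) +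
        Complex.I * x * ((y : ℂ) ^ d * A 0 y * Complex.exp (Complex.I * y * x))) y := by
    intro y hy
    have h1 := (hA.1 0 y (Set.Ioi_subset_Ici_self hy)).hasDerivAt (Ici_mem_nhds hy)
    have h2 := (((hasDerivAt_ofReal_comp y).const_mul Complex.I).mul_const (x : ℂ)).cexp
    refine ((((hasDerivAt_ofReal_comp y).fun_pow d).fun_mul h1).fun_mul h2).congr_deriv ?_
    ring
  have hc : ContinuousWithinAt (fun y : ℝ => (y : ℂ) ^ d * A 0 y * Complex.exp (Complex.I * y * x))
      (Set.Ici 0) 0 := by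
    have h1 := hA.continuousOn 0 0 Set.self_mem_Ici
    have h2 : ContinuousWithinAt (fun y : ℝ => (y : ℂ) ^ d) (Set.Ici 0) 0 :=
      (by fun_prop : Continuous fun y : ℝ => (y : ℂ) ^ d).continuousWithinAt
    have h3 : ContinuousWithinAt (fun y : ℝ => Complex.exp (Complex.I * y * x)) (Set.Ici 0) 0 :=
      (by fun_prop : Continuous fun y : ℝ => Complex.exp (Complex.I * y * x)).continuousWithinAt
    exact (h2.mul h1).mul h3
  have i1 := (hA.integrableOn_exp (d - 1) 0 x).const_mul (d : ℂ)
  have i2 := hA.integrableOn_exp d 1 x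
  have i3 := (hA.integrableOn_exp d 0 x).const_mul (Complex.I * x)
  have h := integral_Ioi_of_hasDerivAt_of_tendsto hc hd ((i1.fun_add i2).fun_add i3)
    (hA.tendsto_atTop d 0 x)
  rw [integral_add (i1.fun_add i2) i3, integral_add i1 i2, integral_const_mul, integral_const_mul] at h
  change (d : ℂ) * synth (d - 1) (A 0) x + synth d (A 1) x + Complex.I * x * synth d (A 0) x = _ at h
  -- The boundary term at `0` is `0^d f(0)`, which survives only for `d = 0`.
  simp only [Complex.ofReal_zero, mul_zero, zero_mul, Complex.exp_zero, mul_one, zero_sub] at h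
  linear_combination h

theorem tendsto_synth_zero (f : ℝ → ℂ) :
    Filter.Tendsto (synth 0 f) (Filter.cocompact ℝ) (𝓝 0) := by
  have h1 : synth 0 f = fun x => _ := funext fun x => (synth_eq_hat 0 f x).trans (hat_eq _ _)
  rw [h1]
  refine (Real.zero_at_infty_fourier _).comp ?_
  have h2 : Topology.IsClosedEmbedding fun x : ℝ => -x / (2 * Real.pi) := by
    have h3 := (Homeomorph.mulRight₀ (-(2 * Real.pi)⁻¹) (by simp)).isClosedEmbedding
    convert h3 using 2 with x
    simp [div_eq_mul_inv]
  exact h2.tendsto_cocompact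

/-- Integration by parts `d + 1` times: the factor `y^d` kills all boundary terms but the last, and
Riemann-Lebesgue removes the remaining integral. Each step lowers `d`, through `y^(d+1) f' = y^d (y
f')`. -/
theorem exists_tendsto_synth (d : ℕ) {A : ℕ → ℝ → ℂ} (hA : IsSchwartzSeq A) :
    ∃ c, Filter.Tendsto (fun x : ℝ => (Complex.I * x) ^ (d + 1) * synth d (A 0) x)
      (Filter.cocompact ℝ) (𝓝 c) := by
  induction d generalizing A with
  | zero =>
    refine ⟨_, (((tendsto_synth_zero (A 1)).const_add (A 0 0)).neg).congr fun x => ?_⟩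
    rw [zero_add, pow_one, I_mul_synth hA]
    simp
  | succ d ih =>
    obtain ⟨c, hc⟩ := ih hA
    obtain ⟨c', hc'⟩ := ih hA.shift.mul_id
    refine ⟨_, (((hc.const_mul ((d + 1 : ℕ) : ℂ)).add hc').neg).congr fun x => ?_⟩
    have h1 := I_mul_synth hA (d + 1) x
    have h2 : synth d (fun x => x * A (0 + 1) x + (0 : ℕ) * A (0 - 1 + 1) x) x =
        synth (d + 1) (A 1) x := by
      rw [synth_succ d (A 1)]
      simp
    rw [h2, pow_succ _ (d + 1), mul_assoc, h1, zero_pow d.succ_ne_zero, Nat.add_sub_cancel]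
    ring

/-- The derivatives of `y * f'' + (d + 1) * f'`, in terms of those of `f`. -/
def besselSeq (d : ℕ) (A : ℕ → ℝ → ℂ) (n : ℕ) (x : ℝ) : ℂ :=
  (x * A (n + 1 + 1) x + n * A (n - 1 + 1 + 1) x) + (d + 1) * A (n + 1) x

theorem IsSchwartzSeq.besselSeq {A : ℕ → ℝ → ℂ} (hA : IsSchwartzSeq A) (d : ℕ) :
    IsSchwartzSeq (besselSeq d A) :=
  hA.shift.shift.mul_id.add (hA.shift.const_mul _)

theorem synth_besselSeq {A : ℕ → ℝ → ℂ} (hA : IsSchwartzSeq A) (d : ℕ) (x : ℝ) :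
    synth d (besselSeq d A 0) x = synth (d + 1) (A 2) x + (d + 1) * synth d (A 1) x := by
  have h := synth_add hA.shift.shift.mul_id (hA.shift.const_mul (d + 1)) d x
  rw [synth_const_mul] at h
  refine h.trans ?_
  rw [synth_succ]
  simp

theorem contDiff_synth {A : ℕ → ℝ → ℂ} (hA : IsSchwartzSeq A) (d : ℕ) :
    ContDiff ℝ ∞ (synth d (A 0)) := by
  have h := contDiff_of_hasDerivAt_succ (A := fun j x => Complex.I ^ j * synth (d + j) (A 0) x)
    (fun j x => ((hasDerivAt_synth hA (d + j) x).const_mul (Complex.I ^ j)).congr_deriv (by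
      rw [pow_succ, add_assoc]
      ring)) 0
  simpa using h

/-- On the half line side this generator is the Bessel type operator `f ↦ y f'' + (d + 1) f'`, which
preserves Schwartz functions up to the end point. -/
theorem lieOp_synth {A : ℕ → ℝ → ℂ} (hA : IsSchwartzSeq A) (d : ℕ) (x : ℝ) :
    lieOp d 0 0 (-1) (synth d (A 0)) x = -Complex.I * synth d (besselSeq d A 0) x := by
  have h1 := I_mul_synth hA (d + 1) x
  have h2 := I_mul_synth hA.shift (d + 1) x
  rw [zero_pow d.succ_ne_zero, Nat.add_sub_cancel] at h1 h2
  rw [synth_besselSeq hA, lieOp, (hasDerivAt_synth hA d x).deriv]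
  push_cast at h1 h2 ⊢
  linear_combination (x : ℂ) * h1 + Complex.I * h2 - (x * synth (d + 1) (A 1) x) * Complex.I_mul_I

/-- The iterates of `besselSeq`. -/
def besselIter (d : ℕ) (A : ℕ → ℝ → ℂ) : ℕ → ℕ → ℝ → ℂ
  | 0 => A
  | n + 1 => besselSeq d (besselIter d A n)

theorem IsSchwartzSeq.besselIter {A : ℕ → ℝ → ℂ} (hA : IsSchwartzSeq A) (d n : ℕ) :
    IsSchwartzSeq (besselIter d A n) := by
  induction n with
  | zero => exact hA
  | succ n ih => exact ih.besselSeq d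

theorem tendsto_ext_synth (d : ℕ) {A : ℕ → ℝ → ℂ} (hA : IsSchwartzSeq A) :
    ∃ c, Filter.Tendsto (fun x : ℝ => ((x : ℂ) ^ (d + 1))⁻¹ * synth d (A 0) (-x⁻¹)) (𝓝[≠] 0)
      (𝓝 c) := by
  obtain ⟨c, hc⟩ := exists_tendsto_synth d hA
  have h1 : Filter.Tendsto (fun x : ℝ => -x⁻¹) (𝓝[≠] 0) (Filter.cocompact ℝ) := by
    rw [← Metric.cobounded_eq_cocompact]
    exact Filter.tendsto_neg_cobounded.comp Filter.tendsto_inv₀_nhdsNE_zero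
  refine ⟨_, ((hc.comp h1).const_mul ((-Complex.I) ^ (d + 1))⁻¹).congr' ?_⟩
  filter_upwards [self_mem_nhdsWithin] with x hx
  have hx' : (x : ℂ) ≠ 0 := by exact_mod_cast hx
  rw [Function.comp, ← mul_assoc, ← inv_pow, ← mul_pow, ← inv_pow]
  congr 2
  push_cast
  field_simp

/-- In the chart at infinity the operator of `lieOp_synth` becomes plain differentiation. So away
from `0` every derivative of the extension is, up to a constant, the extension of another transform
of the same kind, and all of these have limits at `0`. -/
theorem synth_mem (d : ℕ) {A : ℕ → ℝ → ℂ} (hA : IsSchwartzSeq A) :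
    synth d (A 0) ∈ inducedSubmodule d := by
  refine ⟨contDiff_synth hA d, ?_⟩
  choose c hc using fun n => tendsto_ext_synth d (hA.besselIter d n)
  set G : ℕ → ℝ → ℂ := fun n => synth d (besselIter d A n 0) with hG
  set ψ : ℕ → ℝ → ℂ := fun n => Function.update
    (fun x : ℝ => ((x : ℂ) ^ (d + 1))⁻¹ * G n (-x⁻¹)) 0 (c n) with hψ
  have e : ∀ n (x : ℝ), x ≠ 0 → ψ n x = ((x : ℂ) ^ (d + 1))⁻¹ * G n (-x⁻¹) := fun n x hx =>
    Function.update_of_ne hx _ _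
  have hcont : ∀ n, ContinuousAt (ψ n) 0 := fun n => continuousAt_update_same.2 (hc n)
  have hsm : ∀ n, ContDiff ℝ ∞ (G n) := fun n => contDiff_synth (hA.besselIter d n) d
  have hder : ∀ n (x : ℝ), x ≠ 0 → HasDerivAt (ψ n) (-Complex.I * ψ (n + 1) x) x := by
    intro n x hx
    have hxc : (x : ℂ) ≠ 0 := by exact_mod_cast hx
    have h1 : DifferentiableAt ℝ (ψ n) x := by
      have h2 : DifferentiableAt ℝ (fun x : ℝ => ((x : ℂ) ^ (d + 1))⁻¹ * G n (-x⁻¹)) x := by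
        have h3 := ((hsm n).differentiable (by simp) (-x⁻¹)).comp x
          (differentiableAt_inv hx).fun_neg
        exact (((hasDerivAt_ofReal_comp x).fun_pow (d + 1)).fun_inv
          (pow_ne_zero _ hxc)).differentiableAt.fun_mul h3
      refine h2.congr_of_eventuallyEq ?_
      filter_upwards [eventually_ne_nhds hx] with y hy using e n y hy
    have h4 := lieOp_ext (hsm n) (e n) 0 0 (-1) hx
    rw [lieOp_synth (hA.besselIter d n), mul_left_comm] at h4
    change _ = -Complex.I * (_ * G (n + 1) _) at h4
    rw [← e (n + 1) x hx] at h4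
    rw [← h4]
    simpa [lieOp] using h1.hasDerivAt
  have h := contDiff_of_hasDerivAt_succ (A := fun n x => (-Complex.I) ^ n * ψ n x) (fun n x => by
    -- A continuous function whose derivative off `0` extends continuously is differentiable at `0`
    -- as well.
    refine hasDerivAt_of_hasDerivAt_of_ne' (x := 0)
      (g := fun x => (-Complex.I) ^ (n + 1) * ψ (n + 1) x) (fun y hy => ?_)
      (continuousAt_const.mul (hcont n)) (continuousAt_const.mul (hcont (n + 1))) x
    exact ((hder n y hy).const_mul _).congr_deriv (by rw [pow_succ]; ring)) 0
  exact ⟨ψ 0, by simpa using h, e 0⟩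

/-- The transform, as an element of `I_d`. -/
def synthI (d : ℕ) {A : ℕ → ℝ → ℂ} (hA : IsSchwartzSeq A) : ISpace d :=
  ⟨synth d (A 0), synth_mem d hA⟩

theorem synthI_mem_hardy (hd : 0 < d) {A : ℕ → ℝ → ℂ} (hA : IsSchwartzSeq A) :
    synthI d hA ∈ hardy d := by
  rw [mem_hardy_iff hd]
  refine ⟨integrable_ISpace hd _, fun y hy => ?_⟩
  have hc : Continuous ((Set.Ioi (0 : ℝ)).indicator fun y : ℝ => (y : ℂ) ^ d * A 0 y) := by
    refine continuous_indicator (fun y hy => ?_) ?_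
    · rw [frontier_Ioi, Set.mem_singleton_iff] at hy
      simp [hy, hd.ne']
    · rw [closure_Ioi]
      have h1 := hA.continuousOn 0
      fun_prop
  rw [hat_of_eq_hat_neg hc (hA.integrable_indicator d 0) (integrable_ISpace hd (synthI d hA))
    (synth_eq_hat d (A 0)), Set.indicator_of_notMem (by simpa using hy), mul_zero]

/-! ### Division by the coordinate -/

theorem continuous_iteratedDeriv_infty {ψ : ℝ → ℂ} (hψ : ContDiff ℝ ∞ ψ) (n : ℕ) :
    Continuous (iteratedDeriv n ψ) :=
  hψ.continuous_iteratedDeriv n (by exact_mod_cast le_top)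

theorem hasDerivAt_iteratedDeriv {ψ : ℝ → ℂ} (hψ : ContDiff ℝ ∞ ψ) (n : ℕ) (x : ℝ) :
    HasDerivAt (iteratedDeriv n ψ) (iteratedDeriv (n + 1) ψ x) x := by
  rw [iteratedDeriv_succ]
  exact (hψ.differentiable_iteratedDeriv n (by exact_mod_cast WithTop.coe_lt_top _) x).hasDerivAt

theorem hasDerivAt_integral_iteratedDeriv {ψ : ℝ → ℂ} (hψ : ContDiff ℝ ∞ ψ) (n : ℕ) (x : ℝ) :
    HasDerivAt (fun x : ℝ => ∫ t in (0 : ℝ)..1, (t : ℂ) ^ n * iteratedDeriv (n + 1) ψ (t * x))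
      (∫ t in (0 : ℝ)..1, (t : ℂ) ^ (n + 1) * iteratedDeriv (n + 2) ψ (t * x)) x := by
  have hc := continuous_iteratedDeriv_infty hψ
  obtain ⟨C, hC⟩ := (isCompact_Icc (a := -(|x| + 1)) (b := |x| + 1)).exists_bound_of_continuousOn
    (hc (n + 2)).continuousOn
  have hm : ∀ (j k : ℕ) (y : ℝ),
      Continuous fun t : ℝ => (t : ℂ) ^ j * iteratedDeriv k ψ (t * y) := by
    intro j k y
    have := hc k
    fun_prop
  refine (intervalIntegral.hasDerivAt_integral_of_dominated_loc_of_deriv_le (μ := volume)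
    (F := fun (x t : ℝ) => (t : ℂ) ^ n * iteratedDeriv (n + 1) ψ (t * x))
    (F' := fun (x t : ℝ) => (t : ℂ) ^ (n + 1) * iteratedDeriv (n + 2) ψ (t * x))
    (s := Metric.ball x 1) (bound := fun _ => C) (Metric.ball_mem_nhds x one_pos)
    (.of_forall fun y => (hm _ _ y).aestronglyMeasurable) ((hm _ _ x).intervalIntegrable _ _)
    (hm _ _ x).aestronglyMeasurable (.of_forall fun t ht y hy => ?_)
    intervalIntegrable_const (.of_forall fun t ht y hy => ?_)).2
  · rw [Set.uIoc_of_le zero_le_one] at ht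
    have ht0 : 0 ≤ t := ht.1.le
    have hyx : |y| ≤ |x| + 1 := by
      have h1 : |y - x| < 1 := by simpa [Real.dist_eq] using hy
      have h2 := abs_sub_abs_le_abs_sub y x
      linarith
    have hty : |t * y| ≤ |x| + 1 := by
      rw [abs_mul, abs_of_nonneg ht0]
      exact (mul_le_of_le_one_left (abs_nonneg y) ht.2).trans hyx
    rw [norm_mul, norm_pow, Complex.norm_real, Real.norm_of_nonneg ht0]
    exact (mul_le_of_le_one_left (norm_nonneg _) (pow_le_one₀ ht0 ht.2)).trans (hC _ (abs_le.1 hty))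
  · have h1 := (hasDerivAt_iteratedDeriv hψ (n + 1) (t * y)).scomp y ((hasDerivAt_id y).const_mul t)
    refine (h1.const_mul ((t : ℂ) ^ n)).congr_deriv ?_
    rw [mul_one, Complex.real_smul]
    ring

/-- Hadamard's lemma, with quotient `∫₀¹ ψ'(t x) dt`. -/
theorem exists_eq_mul_of_apply_zero {ψ : ℝ → ℂ} (hψ : ContDiff ℝ ∞ ψ) (h0 : ψ 0 = 0) :
    ∃ χ : ℝ → ℂ, ContDiff ℝ ∞ χ ∧ ∀ x, ψ x = x * χ x := by
  refine ⟨_, contDiff_of_hasDerivAt_succ (hasDerivAt_integral_iteratedDeriv hψ) 0, fun x => ?_⟩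
  have hc := continuous_iteratedDeriv_infty hψ 1
  have h1 : ∀ t ∈ Set.uIcc (0 : ℝ) 1, HasDerivAt (fun t : ℝ => ψ (t * x))
      (x * iteratedDeriv 1 ψ (t * x)) t := by
    intro t _
    have h2 := (hasDerivAt_iteratedDeriv hψ 0 (t * x)).scomp t ((hasDerivAt_id t).mul_const x)
    rw [iteratedDeriv_zero] at h2
    exact h2.congr_deriv (by rw [one_mul, Complex.real_smul])
  have h2 := intervalIntegral.integral_eq_sub_of_hasDerivAt h1
    (Continuous.intervalIntegrable (by fun_prop) _ _)
  rw [one_mul, zero_mul, h0, sub_zero, intervalIntegral.integral_const_mul] at h2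
  simpa using h2.symm

/-- Splitting off the leading term at infinity. -/
theorem exists_eq_add_mem_succ (φ : ISpace d) : ∃ (a : ℂ) (φ' : ISpace (d + 1)),
    ∀ x : ℝ, φ x = a * ((1 - Complex.I * x) ^ (d + 1))⁻¹ + φ' x := by
  obtain ⟨ψ, hψ, e⟩ := φ.exists_ext
  have hne : ∀ x : ℝ, (x + Complex.I : ℂ) ≠ 0 := by
    intro x h
    have := congrArg Complex.im h
    simp at this
  -- In the chart at infinity `(1 - ix)^(-d-1)` is `(x + i)^(-d-1)`, with value `i^(-d-1)` at `0`.
  -- After subtraction the extension vanishes at `0`, and dividing it by `x` raises `d` by one.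
  set a := ψ 0 * Complex.I ^ (d + 1) with ha
  have hx0 : ContDiff ℝ ∞ fun x : ℝ => (x : ℂ) := Complex.ofRealCLM.contDiff
  obtain ⟨χ, hχ, e'⟩ := exists_eq_mul_of_apply_zero
    (ψ := fun x : ℝ => ψ x - a * ((x + Complex.I) ^ (d + 1))⁻¹)
    (hψ.sub (contDiff_const.mul (((hx0.add contDiff_const).pow _).inv
      fun x => pow_ne_zero _ (hne x)))) (by
        rw [ha, Complex.ofReal_zero, zero_add, mul_assoc,
          mul_inv_cancel₀ (pow_ne_zero _ Complex.I_ne_zero), mul_one, sub_self])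
  refine ⟨a, ⟨fun x => φ x - a * ((1 - Complex.I * x) ^ (d + 1))⁻¹, ?_, χ, hχ, fun x hx => ?_⟩,
    fun x => ?_⟩
  · exact φ.contDiff.sub (contDiff_const.mul (((contDiff_const.sub (contDiff_const.mul hx0)).pow
      _).inv fun x => pow_ne_zero _ (one_sub_I_mul_ne_zero x)))
  · have hxc : (x : ℂ) ≠ 0 := by exact_mod_cast hx
    have h1 := e' x
    rw [e x hx] at h1
    have h2 : (1 - Complex.I * ((-x⁻¹ : ℝ) : ℂ)) = (x + Complex.I) / x := by
      push_cast
      field_simp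
      ring
    beta_reduce
    rw [h2, div_pow, inv_div, pow_succ _ (d + 1), mul_inv]
    rw [mul_comm (x : ℂ), ← div_eq_iff hxc] at h1
    rw [← h1]
    have h3 := pow_ne_zero (d + 1) (hne x)
    field_simp
  · exact (add_sub_cancel _ _).symm

/-- Up to a function that is smooth at `0`, the Fourier transform of a vector of the Hardy space
is that of a vector which is as small as desired at infinity. -/
theorem exists_hat_eq_add (hd : 0 < d) {φ : ISpace d} (h : IsHardy φ) (N : ℕ) :
    ∃ (E : ℝ → ℂ) (χ : ISpace (d + N)), ContDiff ℝ ∞ E ∧ IsHardy χ ∧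
      ∀ y > 0, hat φ y = (y : ℂ) ^ d * E y + hat χ y := by
  induction N with
  | zero => exact ⟨0, φ, contDiff_const, h, fun y _ => by simp⟩
  | succ N ih =>
    obtain ⟨E, χ, hE, hχ, e⟩ := ih
    obtain ⟨a, χ', e'⟩ := exists_eq_add_mem_succ χ
    have hn : d + N ≠ 0 := by omega
    have h1 := isHardy_inv_pow hn
    have h2 : (ISpace.incl (d + N) χ : ℝ → ℂ) =
      fun x : ℝ => a * ((1 - Complex.I * x) ^ (d + N + 1))⁻¹ + χ' x := funext e'
    have h3 : IsHardy χ' := by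
      have h4 := hχ.add (h1.const_mul (-a))
      rw [h2] at h4
      simpa using h4
    have hx0 : ContDiff ℝ ∞ fun x : ℝ => (x : ℂ) := Complex.ofRealCLM.contDiff
    -- The transform of the term split off is a multiple of `y^(d+N) e^(-y)` on `y > 0`, that is
    -- `y^d` times a smooth function.
    refine ⟨fun y => E y + a * (2 * Real.pi / (d + N).factorial) *
      ((y : ℂ) ^ N * Complex.exp (-y)), χ', ?_, h3, fun y hy => ?_⟩
    · exact hE.add (contDiff_const.mul ((hx0.pow N).mul (Complex.contDiff_exp.comp hx0.neg)))
    · change _ = _ + hat (ISpace.incl (d + N + 1) χ') y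
      rw [e y hy, h2, hat_add (h1.1.const_mul a) h3.1, hat_const_mul, hat_inv_one_sub_pow hn,
        Set.indicator_of_mem (Set.mem_Ioi.2 hy), pow_add]
      ring

/-! ### The behaviour at `0` of the Fourier transform -/

/-- The derivative of `e^y ĝ` is `e^y` times the transform of `(1 - ix) g`. Starting from the
integrable `(1 - ix)^e χ`, each removal of a factor `1 - ix` is an integration from `0`, where the
transform vanishes, and gains a power of `y`. -/
theorem exists_norm_hat_le {e : ℕ} {χ : ISpace (e + 1)} (h : IsHardy χ) :
    ∃ C, ∀ y ∈ Set.Icc (0 : ℝ) 1, ‖hat χ y‖ ≤ C * y ^ e := by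
  suffices H : ∀ j ≤ e, ∃ C, 0 ≤ C ∧ ∀ y ∈ Set.Icc (0 : ℝ) 1,
      ‖hat (fun x : ℝ => (1 - Complex.I * x) ^ (e - j) * χ x) y‖ ≤ C * y ^ j by
    obtain ⟨C, -, hC⟩ := H e le_rfl
    exact ⟨C, by simpa using hC⟩
  intro j
  induction j with
  | zero =>
    intro _
    refine ⟨∫ x : ℝ, ‖(1 - Complex.I * x) ^ e * χ x‖, integral_nonneg fun _ => norm_nonneg _,
      fun y _ => ?_⟩
    rw [pow_zero, mul_one, Nat.sub_zero]
    exact norm_hat_le _ y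
  | succ j ih =>
    intro hj
    obtain ⟨C, hC0, hC⟩ := ih (by omega)
    have hs : e - j = (e - (j + 1)) + 1 := by omega
    have h1 := isHardy_pow_mul h (e := e - (j + 1)) (by omega)
    have h2 := (isHardy_pow_mul h (e := e - j) (by omega)).1
    simp only [hs, pow_succ', mul_assoc] at hC h2
    set g : ℝ → ℂ := fun x : ℝ => (1 - Complex.I * x) ^ (e - (j + 1)) * χ x with hg
    refine ⟨Real.exp 1 * C, by positivity, fun y hy => ?_⟩
    have hder : ∀ t : ℝ, HasDerivAt (fun t : ℝ => (Real.exp t : ℂ) * hat g t)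
        (Real.exp t * hat (fun x : ℝ => (1 - Complex.I * x) * g x) t) t := by
      intro t
      refine ((Real.hasDerivAt_exp t).ofReal_comp.fun_mul
        (hasDerivAt_hat_one_sub h1.1 h2 t)).congr_deriv ?_
      ring
    have hb := norm_image_sub_le_of_norm_deriv_le_segment' (a := 0) (b := y)
      (C := Real.exp 1 * (C * y ^ j)) (fun t _ => (hder t).hasDerivWithinAt) (fun t ht => ?_) y
      ⟨hy.1, le_rfl⟩
    · rw [h1.2 0 le_rfl, mul_zero, sub_zero, sub_zero, norm_mul, Complex.norm_real,
        Real.norm_of_nonneg (Real.exp_pos y).le] at hb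
      calc ‖hat g y‖ ≤ Real.exp y * ‖hat g y‖ :=
            le_mul_of_one_le_left (norm_nonneg _) (Real.one_le_exp hy.1)
        _ ≤ Real.exp 1 * (C * y ^ j) * y := hb
        _ = _ := by ring
    · rw [norm_mul, Complex.norm_real, Real.norm_of_nonneg (Real.exp_pos t).le]
      have ht1 : t ≤ 1 := ht.2.le.trans hy.2
      gcongr
      exact (hC t ⟨ht.1, ht1⟩).trans (by gcongr; exacts [ht.1, ht.2.le])

/-! ### The Euler operator -/

/-- The operator `χ ↦ -(x * χ' + χ)`, whose effect on Fourier transforms is `u ↦ y * u'`. -/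
def euler (e : ℕ) (χ : ISpace e) : ISpace e :=
  lieEnd e (1 / 2) 0 0 χ + (((e : ℂ) - 1) / 2) • χ

theorem euler_apply {e : ℕ} (χ : ISpace e) (x : ℝ) : euler e χ x = -(x * deriv χ x + χ x) := by
  rw [euler, ISpace.add_apply, ISpace.smul_apply, lieEnd_apply, lieOp]
  push_cast
  ring

theorem hat_lieEnd_transl {e : ℕ} (he : 0 < e) (χ : ISpace e) (y : ℝ) :
    hat (lieEnd e 0 1 0 χ) y = Complex.I * y * hat χ y := by
  have h1 : (ISpace.incl e (lieEnd e 0 1 0 χ) : ℝ → ℂ) = deriv χ := funext (lieEnd_transl_apply χ)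
  have h2 := integrable_ISpace he (lieEnd e 0 1 0 χ)
  rw [h1] at h2 ⊢
  exact hat_deriv (integrable_ISpace he χ) (χ.contDiff.differentiable (by simp)) h2 y

/-- For `e = 1` the function `x χ` need not be integrable, so the transform is not differentiated
directly. It is written as `(iy)⁻¹` times that of `χ'`, and `x χ'` is integrable because it lies in
`I_e`. -/
theorem hasDerivAt_hat_euler {e : ℕ} (he : 0 < e) (χ : ISpace e) {y : ℝ} (hy : y ≠ 0) :
    HasDerivAt (hat χ) ((y : ℂ)⁻¹ * hat (euler e χ) y) y := by
  set χ' := lieEnd e 0 1 0 χ with hχ'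
  have i0 := integrable_ISpace he χ
  have i1 := integrable_ISpace he (euler e χ)
  have h1 : ∀ x : ℝ, (x : ℂ) * χ' x = -1 * (euler e χ x + χ x) := by
    intro x
    rw [euler_apply, hχ', lieEnd_transl_apply]
    ring
  have h2 := hasDerivAt_hat (integrable_ISpace he χ')
    (by simp only [h1]; exact (i1.fun_add i0).const_mul _) y
  simp only [h1] at h2
  rw [hat_const_mul, hat_const_mul, hat_add i1 i0] at h2
  have hyc : (y : ℂ) ≠ 0 := by exact_mod_cast hy
  have h3 := (((hasDerivAt_ofReal_comp y).const_mul Complex.I).fun_inv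
    (mul_ne_zero Complex.I_ne_zero hyc)).fun_mul h2
  refine (h3.congr_of_eventuallyEq ?_).congr_deriv ?_
  · filter_upwards [eventually_ne_nhds hy] with z hz
    have hzc : (z : ℂ) ≠ 0 := by exact_mod_cast hz
    rw [hat_lieEnd_transl he, inv_mul_cancel_left₀ (mul_ne_zero Complex.I_ne_zero hzc)]
  · rw [hat_lieEnd_transl he]
    have hI := Complex.I_ne_zero
    field_simp
    ring

theorem isHardy_euler {e : ℕ} (he : 0 < e) {χ : ISpace e} (h : IsHardy χ) :
    IsHardy (euler e χ) := by
  refine .of_neg (integrable_ISpace he _) fun y hy => ?_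
  have h2 : HasDerivAt (hat χ) 0 y := by
    refine (hasDerivAt_const y (0 : ℂ)).congr_of_eventuallyEq ?_
    filter_upwards [Iio_mem_nhds hy] with z hz using h.2 z (le_of_lt hz)
  have h3 := (hasDerivAt_hat_euler he χ hy.ne).unique h2
  have hyc : (y : ℂ) ≠ 0 := by exact_mod_cast hy.ne
  exact (mul_eq_zero.1 h3).resolve_left (inv_ne_zero hyc)

/-- The vectors whose Fourier transforms are, up to powers of `y`, the derivatives of
`y ^ (-d)` times the Fourier transform of `χ`. -/
def eulerSeq (d e : ℕ) (χ : ISpace e) : ℕ → ISpace e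
  | 0 => χ
  | n + 1 => euler e (eulerSeq d e χ n) + (-((d : ℂ) + n)) • eulerSeq d e χ n

theorem isHardy_eulerSeq (d : ℕ) {e : ℕ} (he : 0 < e) {χ : ISpace e} (h : IsHardy χ) (n : ℕ) :
    IsHardy (eulerSeq d e χ n) := by
  induction n with
  | zero => exact h
  | succ n ih => exact (isHardy_euler he ih).add (ih.const_mul _)

/-- The derivatives of `y ^ (-d)` times the Fourier transform of `χ`. -/
def divHat (d e : ℕ) (χ : ISpace e) (n : ℕ) (y : ℝ) : ℂ :=
  ((y : ℂ) ^ (d + n))⁻¹ * hat (eulerSeq d e χ n) y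

theorem hasDerivAt_divHat (d : ℕ) {e : ℕ} (he : 0 < e) (χ : ISpace e) (n : ℕ) {y : ℝ} (hy : 0 < y) :
    HasDerivAt (divHat d e χ n) (divHat d e χ (n + 1) y) y := by
  have hyc : (y : ℂ) ≠ 0 := by exact_mod_cast hy.ne'
  set χn := eulerSeq d e χ n with hn
  have h1 := (((hasDerivAt_ofReal_comp y).fun_pow (d + n)).fun_inv (pow_ne_zero _ hyc)).fun_mul
    (hasDerivAt_hat_euler he χn hy.ne')
  refine h1.congr_deriv ?_
  have h2 : hat (eulerSeq d e χ (n + 1)) y = hat (euler e χn) y + -((d : ℂ) + n) * hat χn y := by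
    rw [← hat_const_mul, ← hat_add (integrable_ISpace he _) ((integrable_ISpace he _).const_mul _)]
    rfl
  rw [divHat, h2, ← add_assoc, pow_succ]
  rcases Nat.eq_zero_or_pos (d + n) with h0 | h0
  · have h3 : (d : ℂ) + n = 0 := by exact_mod_cast h0
    rw [h0, h3]
    simp
  · obtain ⟨m, hm⟩ : ∃ m, d + n = m + 1 := ⟨d + n - 1, by omega⟩
    have h3 : (d : ℂ) + n = m + 1 := by exact_mod_cast hm
    rw [hm, h3, Nat.add_sub_cancel]
    push_cast
    field_simp
    ring

/-- In `I_(d+n+2)` the transform is `O(y^(d+n+1))`, one power more than the denominator `y^(d+n)`.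
-/
theorem tendsto_divHat_add (d n : ℕ) {χ : ISpace (d + (n + 2))} (h : IsHardy χ) :
    Filter.Tendsto (divHat d (d + (n + 2)) χ n) (𝓝[>] 0) (𝓝 0) := by
  obtain ⟨C, hC⟩ := exists_norm_hat_le (e := d + (n + 1))
    (isHardy_eulerSeq d (e := d + (n + 2)) (by omega) h n)
  have h1 : Filter.Tendsto (fun y : ℝ => C * y) (𝓝[>] 0) (𝓝 0) := by
    have h2 : Continuous fun y : ℝ => C * y := by fun_prop
    simpa using (h2.tendsto 0).mono_left nhdsWithin_le_nhds
  refine squeeze_zero_norm' ?_ h1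
  filter_upwards [Ioc_mem_nhdsGT one_pos] with y hy
  have h3 := hC y ⟨hy.1.le, hy.2⟩
  have hy0 := hy.1
  rw [divHat, norm_mul, norm_inv, norm_pow, Complex.norm_real, Real.norm_of_nonneg hy0.le,
    inv_mul_le_iff₀ (by positivity)]
  refine h3.trans (le_of_eq ?_)
  ring

/-- For the splitting with `N = n + 2`, the derivative of order `n` is that of the smooth part `E`
plus a remainder tending to `0`. -/
theorem exists_tendsto_divHat (hd : 0 < d) {φ : ISpace d} (h : IsHardy φ) (n : ℕ) :
    ∃ c, Filter.Tendsto (divHat d d φ n) (𝓝[>] 0) (𝓝 c) := by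
  obtain ⟨E, χ, hE, hχ, e⟩ := exists_hat_eq_add hd h (n + 2)
  have h1 : ∀ j, ∀ y > 0, divHat d d φ j y = iteratedDeriv j E y + divHat d (d + (n + 2)) χ j y := by
    intro j
    induction j with
    | zero =>
      intro y hy
      have hyc : (y : ℂ) ≠ 0 := by exact_mod_cast hy.ne'
      simp only [divHat, eulerSeq, add_zero, iteratedDeriv_zero]
      rw [e y hy]
      field_simp
    | succ j ih =>
      intro y hy
      refine (hasDerivAt_divHat d hd φ j hy).unique (HasDerivAt.congr_of_eventuallyEq
        ((hasDerivAt_iteratedDeriv hE j y).add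
          (hasDerivAt_divHat d (e := d + (n + 2)) (by omega) χ j hy)) ?_)
      filter_upwards [Ioi_mem_nhds hy] with z hz using ih z hz
  refine ⟨_, ((((continuous_iteratedDeriv_infty hE n).tendsto 0).mono_left
    nhdsWithin_le_nhds).add (tendsto_divHat_add d n hχ)).congr' ?_⟩
  filter_upwards [self_mem_nhdsWithin] with y hy using (h1 n y hy).symm

/-! ### The Hardy space as an image -/

/-- All derivatives of `χ` stay in `I_e`, hence are integrable. -/
theorem exists_pow_mul_norm_hat_le {e : ℕ} (he : 0 < e) (χ : ISpace e) (k : ℕ) :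
    ∃ C, ∀ y : ℝ, |y| ^ k * ‖hat χ y‖ ≤ C := by
  refine ⟨∫ x : ℝ, ‖ISpace.incl e (((lieEnd e 0 1 0) ^ k) χ) x‖, fun y => ?_⟩
  refine le_of_eq_of_le ?_ (norm_hat_le _ y)
  induction k with
  | zero => simp
  | succ k ih =>
    rw [pow_succ' (lieEnd e 0 1 0), Module.End.mul_apply, hat_lieEnd_transl he, norm_mul, ← ih]
    simp
    ring

/-- Off `0` the derivatives are the `divHat`; their one-sided limits at `0` make the function smooth
up to the end point. For `x ≥ 1` division by a power of `x` only improves the decay. -/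
theorem exists_isSchwartzSeq (hd : 0 < d) {φ : ISpace d} (h : IsHardy φ) :
    ∃ A : ℕ → ℝ → ℂ, IsSchwartzSeq A ∧ ∀ y > 0, A 0 y = ((y : ℂ) ^ d)⁻¹ * hat φ y := by
  choose c hc using exists_tendsto_divHat hd h
  set A : ℕ → ℝ → ℂ := fun n => Function.update (divHat d d φ n) 0 (c n) with hA
  have e : ∀ n, ∀ y > 0, A n y = divHat d d φ n y := fun n y hy =>
    Function.update_of_ne (ne_of_gt hy) _ _
  have hder : ∀ n, ∀ y > 0, HasDerivAt (A n) (A (n + 1) y) y := by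
    intro n y hy
    rw [e _ y hy]
    refine (hasDerivAt_divHat d hd φ n hy).congr_of_eventuallyEq ?_
    filter_upwards [Ioi_mem_nhds hy] with z hz using e n z hz
  have hlim : ∀ n, Filter.Tendsto (A n) (𝓝[>] 0) (𝓝 (A n 0)) := by
    intro n
    have h0 : A n 0 = c n := Function.update_self _ _ _
    rw [h0]
    refine (hc n).congr' ?_
    filter_upwards [self_mem_nhdsWithin] with y hy using (e n y hy).symm
  have hder' : ∀ n, ∀ x ∈ Set.Ici (0 : ℝ), HasDerivWithinAt (A n) (A (n + 1) x) (Set.Ici 0) x := by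
    intro n x hx
    rcases (Set.mem_Ici.1 hx).eq_or_lt with rfl | hx0
    · refine hasDerivWithinAt_Ici_of_tendsto_deriv (s := Set.Ioi 0)
        (fun y hy => (hder n y hy).differentiableAt.differentiableWithinAt) (hlim n)
        self_mem_nhdsWithin ((hlim (n + 1)).congr' ?_)
      filter_upwards [self_mem_nhdsWithin] with y hy using (hder n y hy).deriv.symm
    · exact (hder n x hx0).hasDerivWithinAt
  refine ⟨A, ⟨hder', fun k n => ?_⟩, fun y hy => (e 0 y hy).trans (by simp [divHat, eulerSeq])⟩
  have hcont : ContinuousOn (A n) (Set.Icc 0 1) := fun x hx =>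
    ((hder' n x hx.1).continuousWithinAt).mono Set.Icc_subset_Ici_self
  obtain ⟨C, hC⟩ := isCompact_Icc.exists_bound_of_continuousOn hcont
  obtain ⟨C', hC'⟩ := exists_pow_mul_norm_hat_le hd (eulerSeq d d φ n) k
  refine ⟨max C C', fun x hx => ?_⟩
  have hx0 : 0 ≤ x := hx
  rw [abs_of_nonneg hx0]
  rcases le_total x 1 with hx1 | hx1
  · exact (mul_le_of_le_one_left (norm_nonneg _) (pow_le_one₀ hx0 hx1)).trans
      ((hC x ⟨hx0, hx1⟩).trans (le_max_left _ _))
  · have hpos : 0 < x := by linarith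
    rw [e n x hpos, divHat, norm_mul, norm_inv, norm_pow, Complex.norm_real,
      Real.norm_of_nonneg hx0]
    have h2 := hC' x
    rw [abs_of_nonneg hx0] at h2
    refine le_trans ?_ (h2.trans (le_max_right _ _))
    gcongr
    exact mul_le_of_le_one_left (norm_nonneg _) (inv_le_one_of_one_le₀ (one_le_pow₀ hx1))

theorem integrable_hat (hd : 0 < d) (φ : ISpace d) : Integrable (hat φ) := by
  obtain ⟨C, hC⟩ := exists_pow_mul_norm_hat_le hd φ 0
  obtain ⟨C', hC'⟩ := exists_pow_mul_norm_hat_le hd φ 2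
  refine (integrable_inv_one_add_sq.const_mul (C + C')).mono'
    (continuous_hat (integrable_ISpace hd φ)).aestronglyMeasurable (.of_forall fun y => ?_)
  rw [← div_eq_mul_inv, le_div_iff₀ (by positivity)]
  calc _ = |y| ^ 0 * ‖hat φ y‖ + |y| ^ 2 * ‖hat φ y‖ := by rw [sq_abs]; ring
    _ ≤ _ := add_le_add (hC y) (hC' y)

theorem exists_synth_eq (hd : 0 < d) {φ : ISpace d} (h : IsHardy φ) :
    ∃ A : ℕ → ℝ → ℂ, IsSchwartzSeq A ∧ ∀ x, φ x = synth d (A 0) x := by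
  obtain ⟨A, hA, e⟩ := exists_isSchwartzSeq hd h
  have hpi : (2 * Real.pi : ℂ) ≠ 0 := by exact_mod_cast Real.two_pi_pos.ne'
  refine ⟨_, hA.const_mul (2 * Real.pi : ℂ)⁻¹, fun x => ?_⟩
  rw [synth_const_mul, synth_eq_hat]
  have h1 : (Set.Ioi (0 : ℝ)).indicator (fun y : ℝ => (y : ℂ) ^ d * A 0 y) = hat φ := by
    funext y
    by_cases hy : 0 < y
    · have hyc : (y : ℂ) ≠ 0 := by exact_mod_cast hy.ne'
      rw [Set.indicator_of_mem (Set.mem_Ioi.2 hy), e y hy,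
        mul_inv_cancel_left₀ (pow_ne_zero _ hyc)]
    · rw [Set.indicator_of_notMem (by simpa using hy), h.2 y (not_lt.1 hy)]
  rw [h1, hat_hat φ.contDiff.continuous (integrable_ISpace hd φ) (integrable_hat hd φ),
    inv_mul_cancel_left₀ hpi]

/-! ### The image of the operator `T_d` -/

theorem kernel_eq {f f₁ : ℝ → ℂ} {y : ℝ} (hy : y ≠ 0)
    (e : f y = ((|y| ^ (((d : ℝ) + 1) / 2) : ℝ) : ℂ) * f₁ y) :
    ((|y| ^ (((d : ℝ) - 1) / 2) : ℝ) : ℂ) * f y = ((|y| : ℝ) : ℂ) ^ d * f₁ y := by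
  rw [e, ← mul_assoc, ← Complex.ofReal_mul, ← Real.rpow_add (abs_pos.2 hy),
    show ((d : ℝ) - 1) / 2 + ((d : ℝ) + 1) / 2 = d by ring, Real.rpow_natCast, Complex.ofReal_pow]

theorem opT_Ici_apply {f f₁ : ℝ → ℂ} (hf : f ∈ halfSpace d (Set.Ici 0) (uniqueDiffOn_Ici 0))
    (e : ∀ x ∈ Set.Ici (0 : ℝ), f x = ((|x| ^ (((d : ℝ) + 1) / 2) : ℝ) : ℂ) * f₁ x) (z : ℝ) :
    opT d (Set.Ici 0) (uniqueDiffOn_Ici 0) measurableSet_Ici ⟨f, hf⟩ z =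
      ((√(2 * Real.pi) : ℝ) : ℂ)⁻¹ * synth d f₁ z := by
  refine congrArg (((√(2 * Real.pi) : ℝ) : ℂ)⁻¹ * ·) ?_
  rw [synth, ← setIntegral_eq_integral_of_forall_compl_eq_zero (s := Set.Ioi (0 : ℝ))]
  · refine setIntegral_congr_fun measurableSet_Ioi fun y hy => ?_
    dsimp only
    rw [kernel_eq (ne_of_gt hy) (e y (Set.Ioi_subset_Ici_self hy)), abs_of_pos hy]
  · intro y hy
    -- At `y = 0` the integrand vanishes thanks to `f`; for `d = 1` the other power `|y|^((d-1)/2)`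
    -- is `1` there.
    rcases (not_lt.1 (show ¬(0 : ℝ) < y from hy)).eq_or_lt with rfl | hy0
    · dsimp only
      rw [e 0 Set.self_mem_Ici, abs_zero, Real.zero_rpow (x := ((d : ℝ) + 1) / 2) (by positivity)]
      simp
    · dsimp only
      rw [hf.2 y (by simpa using hy0)]
      simp

/-- The half-integral powers multiply to `y^d` and the constant is absorbed in the Schwartz
function. -/
theorem mem_imagePlus_iff {F : ℝ → ℂ} :
    F ∈ imagePlus d ↔ ∃ A : ℕ → ℝ → ℂ, IsSchwartzSeq A ∧ ∀ x, F x = synth d (A 0) x := by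
  have hpi : ((√(2 * Real.pi) : ℝ) : ℂ) ≠ 0 := by
    exact_mod_cast (Real.sqrt_pos.2 Real.two_pi_pos).ne'
  constructor
  · rintro ⟨⟨f, hf⟩, rfl⟩
    obtain ⟨⟨f₁, h₁, e⟩, -⟩ := id hf
    refine ⟨_, h₁.isSchwartzSeq.const_mul ((√(2 * Real.pi) : ℝ) : ℂ)⁻¹, fun x => ?_⟩
    rw [opT_Ici_apply hf e, synth_const_mul]
    simp
  · rintro ⟨A, hA, e⟩
    have hB := (hA.const_mul ((√(2 * Real.pi) : ℝ) : ℂ)).isSchwartzOn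
    set f₁ : ℝ → ℂ := fun x => ((√(2 * Real.pi) : ℝ) : ℂ) * A 0 x with hf₁
    have e1 : ∀ x ∈ Set.Ici (0 : ℝ), (Set.Ici (0 : ℝ)).indicator (fun x : ℝ =>
        ((|x| ^ (((d : ℝ) + 1) / 2) : ℝ) : ℂ) * f₁ x) x =
        ((|x| ^ (((d : ℝ) + 1) / 2) : ℝ) : ℂ) * f₁ x := fun x hx => Set.indicator_of_mem hx _
    have hf : (Set.Ici (0 : ℝ)).indicator (fun x : ℝ =>
        ((|x| ^ (((d : ℝ) + 1) / 2) : ℝ) : ℂ) * f₁ x) ∈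
        halfSpace d (Set.Ici 0) (uniqueDiffOn_Ici 0) :=
      ⟨⟨f₁, hB, e1⟩, fun x hx => Set.indicator_of_notMem hx _⟩
    refine ⟨⟨_, hf⟩, funext fun z => ?_⟩
    rw [opT_Ici_apply hf e1, e, hf₁, synth_const_mul, inv_mul_cancel_left₀ hpi]

theorem imagePlus_le (d : ℕ) : imagePlus d ≤ inducedSubmodule d := by
  intro F hF
  obtain ⟨A, hA, e⟩ := mem_imagePlus_iff.1 hF
  rw [show F = synth d (A 0) from funext e]
  exact synth_mem d hA

theorem IPlus_eq_hardy (hd : 0 < d) : IPlus d = hardy d := by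
  ext φ
  rw [IPlus, Submodule.mem_comap, mem_imagePlus_iff]
  constructor
  · rintro ⟨A, hA, e⟩
    rw [show φ = synthI d hA from ISpace.ext e]
    exact synthI_mem_hardy hd hA
  · exact fun h => exists_synth_eq hd ((mem_hardy_iff hd).1 h)

/-! ### The reflection `x ↦ -x` -/

theorem IsSchwartzOn.comp_neg {s : Set ℝ} {f : ℝ → ℂ} (hf : IsSchwartzOn (-s) f) :
    IsSchwartzOn s fun x => f (-x) where
  smooth := hf.smooth.comp contDiff_neg.contDiffOn fun x hx => by simpa using hx
  decay k n := by
    obtain ⟨C, hC⟩ := hf.decay k n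
    refine ⟨C, fun x hx => ?_⟩
    rw [iteratedDerivWithin_comp_neg, norm_smul, norm_pow, norm_neg, norm_one, one_pow, one_mul,
      ← abs_neg]
    exact hC (-x) (by simpa using hx)

theorem comp_neg_mem_halfSpace {s t : Set ℝ} {hs : UniqueDiffOn ℝ s} {ht : UniqueDiffOn ℝ t}
    (hst : -s = t) {f : ℝ → ℂ} (hf : f ∈ halfSpace d t ht) :
    (fun x => f (-x)) ∈ halfSpace d s hs := by
  subst hst
  obtain ⟨⟨f₁, h₁, e⟩, h0⟩ := hf
  refine ⟨⟨_, h₁.comp_neg, fun x hx => ?_⟩, fun x hx => h0 (-x) (by simpa using hx)⟩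
  beta_reduce
  rw [e (-x) (by simpa using hx), abs_neg]

theorem opT_comp_neg {s t : Set ℝ} {hs : UniqueDiffOn ℝ s} {ht : UniqueDiffOn ℝ t}
    (hms : MeasurableSet s) (hmt : MeasurableSet t) (hst : -s = t) {f : ℝ → ℂ}
    (hf : f ∈ halfSpace d t ht) (z : ℝ) :
    opT d s hs hms ⟨fun x => f (-x), comp_neg_mem_halfSpace hst hf⟩ z =
      opT d t ht hmt ⟨f, hf⟩ (-z) := by
  refine congrArg (((√(2 * Real.pi) : ℝ) : ℂ)⁻¹ * ·) ?_
  rw [← integral_neg_eq_self]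
  congr 1
  funext y
  simp

theorem comp_neg_mem_imagePlus {F : ℝ → ℂ} :
    (fun x => F (-x)) ∈ imagePlus d ↔ F ∈ imageMinus d := by
  constructor
  · rintro ⟨⟨f, hf⟩, e⟩
    refine ⟨⟨_, comp_neg_mem_halfSpace (by simp) hf⟩, funext fun z => ?_⟩
    rw [opT_comp_neg measurableSet_Iic measurableSet_Ici (by simp) hf, e]
    simp
  · rintro ⟨⟨f, hf⟩, e⟩
    refine ⟨⟨_, comp_neg_mem_halfSpace (by simp) hf⟩, funext fun z => ?_⟩
    rw [opT_comp_neg measurableSet_Ici measurableSet_Iic (by simp) hf, e]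

theorem ext_comp_neg {φ ψ : ℝ → ℂ}
    (e : ∀ x : ℝ, x ≠ 0 → ψ x = ((x : ℂ) ^ (d + 1))⁻¹ * φ (-x⁻¹)) (x : ℝ) (hx : x ≠ 0) :
    (-1) ^ (d + 1) * ψ (-x) = ((x : ℂ) ^ (d + 1))⁻¹ * φ (-(-x⁻¹)) := by
  rw [e (-x) (neg_ne_zero.2 hx), ← mul_assoc]
  push_cast
  rw [neg_pow (x : ℂ), mul_inv, ← mul_assoc, mul_inv_cancel₀ (pow_ne_zero _ (by norm_num)), one_mul,
    inv_neg]

theorem comp_neg_mem_inducedSubmodule {φ : ℝ → ℂ} (h : φ ∈ inducedSubmodule d) :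
    (fun x => φ (-x)) ∈ inducedSubmodule d := by
  obtain ⟨hφ, ψ, hψ, e⟩ := h
  exact ⟨hφ.comp contDiff_neg, fun x => (-1) ^ (d + 1) * ψ (-x),
    contDiff_const.mul (hψ.comp contDiff_neg), ext_comp_neg e⟩

/-- The reflection `φ ↦ φ (-·)` of `I_d`. -/
def reflect (d : ℕ) : Module.End ℂ (ISpace d) where
  toFun φ := ⟨fun x => φ (-x), comp_neg_mem_inducedSubmodule φ.2⟩
  map_add' _ _ := rfl
  map_smul' _ _ := rfl

theorem reflect_apply (φ : ISpace d) (x : ℝ) : reflect d φ x = φ (-x) := rfl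

theorem reflect_reflect (φ : ISpace d) : reflect d (reflect d φ) = φ :=
  ISpace.ext fun x => by rw [reflect_apply, reflect_apply, neg_neg]

theorem lift_reflect (φ : ISpace d) (θ : ℝ) :
    lift d (reflect d φ) (θ : ℝ) = lift d φ ((-θ : ℝ) : AddCircle (2 * Real.pi)) := by
  have h := eq_of_eq_arctan (d := d) (F := fun θ : ℝ => lift d (reflect d φ) (θ : ℝ))
    (G := fun θ : ℝ => lift d φ ((-θ : ℝ) : AddCircle (2 * Real.pi))) (continuous_lift_coe _)
    ((continuous_lift_coe φ).comp continuous_neg) (fun θ => lift_add_pi _ θ) (fun θ => ?_)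
    (fun x => ?_)
  · exact congrFun h θ
  · have h1 := lift_add_pi φ (-(θ + Real.pi))
    rw [show -(θ + Real.pi) + Real.pi = -θ by ring] at h1
    rw [h1, ← mul_assoc, ← mul_pow]
    simp
  · rw [← Real.arctan_neg, lift_arctan, lift_arctan, reflect_apply, neg_sq]

theorem rotOp_reflect (φ : ISpace d) : rotOp d (reflect d φ) = -reflect d (rotOp d φ) := by
  refine lift_injective (lift_ext fun θ => ?_)
  have h1 := hasDerivAt_lift (reflect d φ) θ
  simp only [lift_reflect] at h1
  have h2 := (hasDerivAt_lift φ (-θ)).scomp θ (hasDerivAt_neg θ)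
  rw [h1.unique h2, map_neg, ContinuousMap.neg_apply, lift_reflect, neg_smul, one_smul]

/-- Reflection is `θ ↦ -θ` on the circle, so it changes the jet component of order `j` only by the
sign `(-1)^j` and a substitution. -/
theorem continuous_reflect : Continuous (reflect d) := by
  refine isInducing_jet.continuous_iff.2 (continuous_pi fun j => ?_)
  have h1 : ∀ j (φ : ISpace d), (rotOp d ^ j) (reflect d φ) =
      (-1 : ℂ) ^ j • reflect d ((rotOp d ^ j) φ) := by
    intro j φ
    induction j with
    | zero => simp
    | succ j ih =>
      rw [pow_succ' (rotOp d), Module.End.mul_apply, ih, map_smul, rotOp_reflect,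
        Module.End.mul_apply, pow_succ, mul_smul, neg_one_smul]
  let ν : C(AddCircle (2 * Real.pi), AddCircle (2 * Real.pi)) := ⟨fun t => -t, continuous_neg⟩
  have h2 : (fun φ : ISpace d => jet d (reflect d φ) j) =
      fun φ => (-1 : ℂ) ^ j • (jet d φ j).comp ν := by
    funext φ
    rw [jet_apply, h1, map_smul, jet_apply]
    congr 1
    refine lift_ext fun θ => ?_
    rw [lift_reflect]
    rfl
  change Continuous fun φ : ISpace d => jet d (reflect d φ) j
  rw [h2]
  have h3 : Continuous fun φ : ISpace d => (jet d φ j).comp ν :=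
    (ContinuousMap.continuous_precomp ν).comp ((continuous_apply j).comp continuous_jet)
  exact h3.const_smul ((-1 : ℂ) ^ j)

/-- The automorphism of `SL(2, ℝ)` that corresponds to the reflection. -/
def twist (g : SL2R) : SL2R :=
  ⟨!![g 0 0, -g 0 1; -g 1 0, g 1 1], by
    rw [Matrix.det_fin_two_of]
    linear_combination SL2R_det g⟩

theorem twist_twist (g : SL2R) : twist (twist g) = g := by
  ext i j
  fin_cases i <;> fin_cases j <;> simp [twist]

theorem homog_reflect (φ : ISpace d) {u v : ℝ} (h : u ≠ 0 ∨ v ≠ 0) :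
    homog d (reflect d φ) u v = homog d φ u (-v) := by
  by_cases hu : u = 0
  · have hv : v ≠ 0 := h.resolve_left (not_not.2 hu)
    obtain ⟨ψ, hψ, e⟩ := φ.exists_ext
    have hψ' : Continuous fun x => (-1) ^ (d + 1) * ψ (-x) :=
      continuous_const.mul (hψ.continuous.comp continuous_neg)
    rw [homog_eq_ext hψ' (fun x hx => ext_comp_neg e x hx) hv,
      homog_eq_ext hψ.continuous e (neg_ne_zero.2 hv), hu, neg_neg]
    push_cast
    rw [neg_pow (v : ℂ), mul_inv, ← inv_pow]
    simp only [neg_zero, zero_div]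
    have h1 : ((-1 : ℂ)⁻¹) ^ (d + 1) * (-1) ^ (d + 1) = 1 := by
      rw [← mul_pow]
      simp
    linear_combination (((v : ℂ) ^ (d + 1))⁻¹ * ψ 0) * h1
  · rw [homog_of_ne hu, homog_of_ne hu, reflect_apply, neg_div]

/-- `twist` is conjugation by `diag(1, -1)`, the matrix that induces the reflection. -/
theorem rep_reflect (g : SL2R) (φ : ISpace d) :
    rep d g (reflect d φ) = reflect d (rep d (twist g) φ) := by
  refine ISpace.ext fun x => ?_
  have h := row_mul_ne g (u := 1) (v := x) (by simp)
  rw [reflect_apply, rep_apply, rep_apply, homog_reflect]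
  · congr 1
    · simp [twist]
    · simp [twist]
      ring
  · convert h using 2 <;> ring

/-! ### Irreducible subrepresentations -/

/-- A closed invariant subspace that is minimal among the nonzero ones. -/
structure IsMinimalClosed (U : Submodule ℂ (ISpace d)) : Prop where
  closed : IsClosed (U : Set (ISpace d))
  invariant : ∀ g, ∀ φ ∈ U, rep d g φ ∈ U
  ne_bot : U ≠ ⊥
  minimal : ∀ W : Submodule ℂ (ISpace d), IsClosed (W : Set (ISpace d)) →
    (∀ g, ∀ φ ∈ W, rep d g φ ∈ W) → W ≤ U → W ≠ ⊥ → W = U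

theorem isMinimalClosed_hardy (hd : 0 < d) : IsMinimalClosed (hardy d) where
  closed := isClosed_hardy
  invariant g _ hφ := rep_mem_hardy hd hφ g
  ne_bot := hardy_ne_bot
  minimal _ := eq_hardy_of_le

theorem comap_reflect_comap_reflect (U : Submodule ℂ (ISpace d)) :
    (U.comap (reflect d)).comap (reflect d) = U := by
  ext φ
  rw [Submodule.mem_comap, Submodule.mem_comap, reflect_reflect]

theorem invariant_comap_reflect {U : Submodule ℂ (ISpace d)} (h : ∀ g, ∀ φ ∈ U, rep d g φ ∈ U)
    (g : SL2R) (φ : ISpace d) (hφ : φ ∈ U.comap (reflect d)) :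
    rep d g φ ∈ U.comap (reflect d) := by
  have h1 := rep_reflect (twist g) φ
  rw [twist_twist] at h1
  rw [Submodule.mem_comap, ← h1]
  exact h _ _ hφ

/-- The reflection is a continuous involution that permutes the closed invariant subspaces, since it
intertwines the action up to an automorphism of the group. -/
theorem IsMinimalClosed.comap_reflect {U : Submodule ℂ (ISpace d)} (h : IsMinimalClosed U) :
    IsMinimalClosed (U.comap (reflect d)) where
  closed := h.closed.preimage continuous_reflect
  invariant := invariant_comap_reflect h.invariant
  ne_bot hb := h.ne_bot (by
    rw [← comap_reflect_comap_reflect U, hb]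
    exact LinearMap.ker_eq_bot.2 (Function.LeftInverse.injective reflect_reflect))
  minimal W hc hW hle hne := by
    have h1 := h.minimal (W.comap (reflect d)) (hc.preimage continuous_reflect)
      (invariant_comap_reflect hW)
      ((Submodule.comap_mono hle).trans (comap_reflect_comap_reflect U).le) fun hb => hne (by
        rw [← comap_reflect_comap_reflect W, hb]
        exact LinearMap.ker_eq_bot.2 (Function.LeftInverse.injective reflect_reflect))
    rw [← h1, comap_reflect_comap_reflect]

theorem IMinus_eq_comap (d : ℕ) : IMinus d = (IPlus d).comap (reflect d) := by
  ext φ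
  exact comp_neg_mem_imagePlus.symm

theorem imageMinus_le (d : ℕ) : imageMinus d ≤ inducedSubmodule d := by
  intro F hF
  have h := comp_neg_mem_inducedSubmodule (imagePlus_le d (comp_neg_mem_imagePlus.2 hF))
  simpa using h

theorem IsMinimalClosed.isIrreducible (V : Subrepresentation (rep d))
    (h : IsMinimalClosed V.toSubmodule) :
    IsIrreducibleFrechetRepresentation V.toRepresentation where
  frechet :=
    { uniformAddGroup := AddSubgroup.isUniformAddGroup V.toSubmodule.toAddSubgroup
      continuousSMul := inferInstance
      locallyConvex := Topology.IsInducing.locallyConvexSpace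
        (f := V.toSubmodule.subtype.restrictScalars ℝ) .subtypeVal
      metrizable := Topology.IsEmbedding.subtypeVal.metrizableSpace
      complete := h.closed.completeSpace_coe }
  continuous_act := by
    refine Continuous.subtype_mk (continuous_rep.comp
      (continuous_fst.prodMk (continuous_subtype_val.comp continuous_snd))) _
  nontrivial := Submodule.nontrivial_iff_ne_bot.2 h.ne_bot
  irreducible W hW := by
    by_cases hb : W.toSubmodule = ⊥
    · exact Or.inl hb
    · right
      -- As `V` is closed, the image of `W` in `I_d` is a closed invariant subspace, to which
      -- minimality applies.
      have h1 := h.minimal (W.toSubmodule.map V.toSubmodule.subtype)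
        (h.closed.isClosedEmbedding_subtypeVal.isClosedMap _ hW) ?_ (Submodule.map_subtype_le _ _)
        fun h0 => hb (Submodule.map_injective_of_injective V.toSubmodule.subtype_injective
          (h0.trans (Submodule.map_bot _).symm))
      · refine Submodule.map_injective_of_injective V.toSubmodule.subtype_injective ?_
        rw [h1, Submodule.map_subtype_top]
      · rintro g _ ⟨φ, hφ, rfl⟩
        exact ⟨V.toRepresentation g φ, W.apply_mem_toSubmodule g hφ, rfl⟩

theorem exists_subrepresentation {U : Submodule ℂ (ISpace d)} (h : IsMinimalClosed U) :
    ∃ V : Subrepresentation (rep d), V.toSubmodule = U ∧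
      IsClosed (V.toSubmodule : Set (ISpace d)) ∧
      IsIrreducibleFrechetRepresentation V.toRepresentation :=
  ⟨⟨U, h.invariant⟩, rfl, h.closed, h.isIrreducible ⟨U, h.invariant⟩⟩

end HankelKirillov

end

theorem mainTheorem6 (d : ℕ) (hd : 0 < d) :
    (HankelKirillov.imagePlus d ≤ HankelKirillov.inducedSubmodule d ∧
      ∃ V : Subrepresentation (HankelKirillov.rep d),
        V.toSubmodule = HankelKirillov.IPlus d ∧
        IsClosed (V.toSubmodule : Set (HankelKirillov.ISpace d)) ∧
        HankelKirillov.IsIrreducibleFrechetRepresentation V.toRepresentation) ∧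
    (HankelKirillov.imageMinus d ≤ HankelKirillov.inducedSubmodule d ∧
      ∃ V : Subrepresentation (HankelKirillov.rep d),
        V.toSubmodule = HankelKirillov.IMinus d ∧
        IsClosed (V.toSubmodule : Set (HankelKirillov.ISpace d)) ∧
        HankelKirillov.IsIrreducibleFrechetRepresentation V.toRepresentation) := by
  have h := HankelKirillov.isMinimalClosed_hardy hd
  rw [HankelKirillov.IMinus_eq_comap, HankelKirillov.IPlus_eq_hardy hd]
  exact ⟨⟨HankelKirillov.imagePlus_le d, HankelKirillov.exists_subrepresentation h⟩,
    HankelKirillov.imageMinus_le d, HankelKirillov.exists_subrepresentation h.comap_reflect⟩
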